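/- Let $(M,h)$ be a 2-sphere of revolution: a compact smooth Riemannian manifold homeomorphic to the 2-sphere with a point $p$ (a pole) such that for all $q_1,q_2\in M$ with $d_h(p,q_1)=d_h(p,q_2)$ there is an $h$-isometry $f$ with $f(q_1)=q_2$ and $f(p)=p$. Let $(p,q)$ be a pair of poles (each is the unique cut point of the other), let $d_h(p,q)=2a$, and let $(r,\theta)$ be geodesic polar coordinates around $p$ on $M\setminus\{p,q\}$. Put $m(r(x)):=\|(\partial/\partial\theta)_x\|_h$. Let $\mu\in\mathbb R$ satisfy $|\mu|\,m(r)<1$ for all $r\in(0,2a)$, let $W:=\mu\,\frac{\partial}{\partial\theta}$ (with $W=0$ at $p$ and $q$), let $\varphi(s;r,\theta)=(r,\theta+\mu s)$ be its flow (which fixes $p$ and $q$), and let $$F(x,y)=\frac{\sqrt{\lambda\|y\|_h^2+W_0^2}}{\lambda}-\frac{W_0}{\lambda},\qquad \lambda=1-\|W\|_h^2,\quad W_0=h(W,y),$$ be the Randers metric with navigation data $(h,W)$. For a Riemannian or Finsler metric, geodesics are the constant speed solutions of the Euler-Lagrange equation of the energy, a Jacobi field along a geodesic $c:[0,l]\to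 M$ is the variation field of a smooth one-parameter variation of $c$ through geodesics, and $c(l)$ is conjugate to $c(0)$ along $c$ if some Jacobi field along $c$ that does not vanish identically vanishes at $0$ and at $l$. Let $l>0$, let $\gamma:[0,l]\to M$ be an $h$-unit speed $h$-geodesic and let $\mathcal P(s)=\varphi(s,\gamma(s))$, $s\in[0,l]$. Then $\mathcal P$ is an $F$-geodesic, and $\mathcal P(l)$ is conjugate to $\mathcal P(0)=\gamma(0)$ along $\mathcal P$ with respect to $F$ if and only if $\gamma(l)$ is conjugate to $\gamma(0)$ along $\gamma$ with respect to $h$. -/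

import Mathlib

open Set Manifold Bundle
open scoped ContDiff

noncomputable section

/-- The model plane `ℝ²` with its Euclidean norm. -/
abbrev Plane : Type := EuclideanSpace ℝ (Fin 2)

/-- Rotation of the plane through the angle `α`: `(r, θ) ↦ (r, θ + α)` in polar coordinates. -/
def planeRot (α : ℝ) (z : Plane) : Plane :=
  !₂[Real.cos α * z 0 - Real.sin α * z 1, Real.sin α * z 0 + Real.cos α * z 1]

/-- The vector `∂/∂θ` of polar coordinates of the plane at the point `z`. -/
def planeAngular (z : Plane) : Plane := !₂[-z 1, z 0]

section Finsler

variable {M : Type*} [TopologicalSpace M] [ChartedSpace Plane M]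

/-- The energy Lagrangian `F² / 2` read in the chart `e`, as a function of position and velocity. -/
def chartLagrangian (F : ∀ x : M, TangentSpace (𝓡 2) x → ℝ) (e : OpenPartialHomeomorph M Plane)
    (z y : Plane) : ℝ :=
  F (e.symm z) (mfderiv (𝓡 2) (𝓡 2) e.symm z y) ^ 2 / 2

/-- `γ` is a (constant speed) geodesic of `F` on the interval `S`: it is smooth on `S` and satisfies
the Euler-Lagrange equation of the energy `F² / 2`,
`d/ds (∂L/∂y (x, x')) = ∂L/∂x (x, x')`, in every smooth chart, at every interior time. -/
structure IsGeodesicOn (F : ∀ x : M, TangentSpace (𝓡 2) x → ℝ) (γ : ℝ → M) (S : Set ℝ) :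
    Prop where
  smooth : ContMDiffOn 𝓘(ℝ, ℝ) (𝓡 2) ∞ γ S
  euler_lagrange : ∀ e ∈ IsManifold.maximalAtlas (𝓡 2) ∞ M, ∀ s ∈ interior S, γ s ∈ e.source →
    ∀ w : Plane,
      HasDerivAt
        (fun σ => fderiv ℝ (fun y => chartLagrangian F e (e (γ σ)) y)
          (deriv (fun τ => e (γ τ)) σ) w)
        (fderiv ℝ (fun z => chartLagrangian F e z (deriv (fun τ => e (γ τ)) s)) (e (γ s)) w) s

/-- `J` is a Jacobi field along `γ` on `[0, l]`: the variation field `∂Γ/∂t (0, ·)` of a smooth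
one-parameter family `Γ (t, s)`, `|t| < ε`, `s ∈ [0, l]`, of geodesics of `F` with `Γ (0, ·) = γ`.
The last clause is an equality of points of the tangent bundle, so that it contains
`Γ (0, s) = γ s`. -/
def IsJacobiField (F : ∀ x : M, TangentSpace (𝓡 2) x → ℝ) (γ : ℝ → M) (l : ℝ)
    (J : ∀ s : ℝ, TangentSpace (𝓡 2) (γ s)) : Prop :=
  ∃ ε > 0, ∃ Γ : ℝ → ℝ → M,
    ContMDiffOn 𝓘(ℝ, ℝ × ℝ) (𝓡 2) ∞ (fun z : ℝ × ℝ => Γ z.1 z.2) (Ioo (-ε) ε ×ˢ Icc 0 l) ∧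
    (∀ t ∈ Ioo (-ε) ε, IsGeodesicOn F (Γ t) (Icc 0 l)) ∧
    ∀ s ∈ Icc 0 l,
      (⟨γ s, J s⟩ : TangentBundle (𝓡 2) M) =
        ⟨Γ 0 s, mfderiv 𝓘(ℝ, ℝ) (𝓡 2) (fun t => Γ t s) 0 (1 : ℝ)⟩

/-- `γ l` is conjugate to `γ 0` along the geodesic `γ` of `F`: some Jacobi field along `γ` on
`[0, l]` that does not vanish identically vanishes at `0` and at `l`. -/
def IsConjugateAlong (F : ∀ x : M, TangentSpace (𝓡 2) x → ℝ) (γ : ℝ → M) (l : ℝ) : Prop :=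
  ∃ J : ∀ s : ℝ, TangentSpace (𝓡 2) (γ s),
    IsJacobiField F γ l J ∧ J 0 = 0 ∧ J l = 0 ∧ ∃ s ∈ Icc 0 l, J s ≠ 0

open Classical in
/-- The vector field `∂/∂θ` of the polar coordinates `e x = (r cos θ, r sin θ)`, extended by zero
to the complement of the chart domain. -/
def angularField (e : OpenPartialHomeomorph M Plane) (x : M) : TangentSpace (𝓡 2) x :=
  if x ∈ e.source then
    mfderiv (𝓡 2) (𝓡 2) e.symm (e x) (planeAngular (e x))
  else 0

/-- The wind `W = μ ∂/∂θ`. -/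
def wind (e : OpenPartialHomeomorph M Plane) (μ : ℝ) (x : M) : TangentSpace (𝓡 2) x :=
  μ • angularField e x

open Classical in
/-- The flow `φ (s; r, θ) = (r, θ + μ s)` of the wind, which fixes every point outside the domain of
the polar coordinates. -/
def windFlow (e : OpenPartialHomeomorph M Plane) (μ s : ℝ) (x : M) : M :=
  if x ∈ e.source then e.symm (planeRot (μ * s) (e x)) else x

end Finsler

section Riemannian

variable {M : Type*} [MetricSpace M] [ChartedSpace Plane M]
  [RiemannianBundle (fun x : M => TangentSpace (𝓡 2) x)]

/-- The norm of the Riemannian metric `h`, as a Finsler norm. -/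
def riemannianNorm (x : M) (y : TangentSpace (𝓡 2) x) : ℝ := ‖y‖

/-- The Randers norm `F = α + β` with navigation data `(h, W)`:
`F = √(λ ‖y‖² + W₀²) / λ - W₀ / λ`, where `λ = 1 - ‖W‖²` and `W₀ = h (W, y)`. -/
def randersNorm (W : ∀ x : M, TangentSpace (𝓡 2) x) (x : M) (y : TangentSpace (𝓡 2) x) : ℝ :=
  Real.sqrt ((1 - ‖W x‖ ^ 2) * ‖y‖ ^ 2 + inner ℝ (W x) y ^ 2) / (1 - ‖W x‖ ^ 2)
    - inner ℝ (W x) y / (1 - ‖W x‖ ^ 2)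

/-- `(M, h)` is a 2-sphere of revolution with pole `p`: it is compact and homeomorphic to the
2-sphere, and any two points at the same distance from `p` are exchanged by an isometry
fixing `p`. -/
structure IsTwoSphereOfRevolution (p : M) : Prop where
  compact : CompactSpace M
  homeo_sphere : Nonempty (M ≃ₜ Metric.sphere (0 : EuclideanSpace ℝ (Fin 3)) 1)
  exists_isometry : ∀ q₁ q₂ : M, dist p q₁ = dist p q₂ →
    ∃ f : M ≃ₘ^∞⟮𝓡 2, 𝓡 2⟯ M,
      (∀ (x : M) (v w : TangentSpace (𝓡 2) x),
        inner ℝ (mfderiv (𝓡 2) (𝓡 2) f x v) (mfderiv (𝓡 2) (𝓡 2) f x w) = inner ℝ v w) ∧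
      f q₁ = q₂ ∧ f p = p

/-- `e` is the system of geodesic normal coordinates around `p`, defined on the complement of the
cut point `q` of `p`, where `d (p, q) = 2a`. It is the inverse of the exponential map
at `p` on the open disc of radius `2a`, for an orthonormal frame at `p`; the geodesic polar
coordinates `(r, θ)` around `p` are given by `e x = (r cos θ, r sin θ)`, and the rays from `p`
are minimizing before they reach `q`. -/
structure IsGeodesicPolarChart (p q : M) (a : ℝ) (e : OpenPartialHomeomorph M Plane) :
    Prop where
  mem_maximalAtlas : e ∈ IsManifold.maximalAtlas (𝓡 2) ∞ M
  source_eq : e.source = {q}ᶜ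
  target_eq : e.target = Metric.ball 0 (2 * a)
  center_ne : p ≠ q
  map_center : e p = 0
  orthonormal_frame : ∀ u : Plane, ‖mfderiv (𝓡 2) (𝓡 2) e.symm (0 : Plane) u‖ = ‖u‖
  ray_isGeodesicOn : ∀ u : Plane, ‖u‖ = 1 →
    IsGeodesicOn riemannianNorm (fun r : ℝ => e.symm (r • u)) (Ioo (-(2 * a)) (2 * a))
  dist_eq : ∀ x ∈ e.source, dist p x = ‖e x‖

/-- `(p, q)` is a pair of poles at distance `2a`: each is the unique cut point of the other, so that
geodesic polar coordinates around each of them exist on the complement of the other one. -/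
def IsPairOfPoles (p q : M) (a : ℝ) : Prop :=
  (∃ e, IsGeodesicPolarChart p q a e) ∧ ∃ e, IsGeodesicPolarChart q p a e

end Riemannian

theorem norm_planeRot (α : ℝ) (z : Plane) : ‖planeRot α z‖ = ‖z‖ := by
  rw [EuclideanSpace.norm_eq, EuclideanSpace.norm_eq]
  congr 1
  simp only [planeRot, Fin.sum_univ_two, Real.norm_eq_abs, sq_abs]
  simp
  nlinarith [Real.sin_sq_add_cos_sq α]

theorem planeRot_zero (z : Plane) : planeRot 0 z = z := by
  ext i; fin_cases i <;> simp [planeRot]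

theorem hasDerivAt_planeRot (μ s : ℝ) (z : Plane) :
    HasDerivAt (fun s => planeRot (μ * s) z) (μ • planeAngular (planeRot (μ * s) z)) s := by
  have h1 : HasDerivAt (fun s : ℝ => μ * s) μ s := by
    simpa using (hasDerivAt_id s).const_mul μ
  have hc := h1.cos
  have hs := h1.sin
  rw [hasDerivAt_iff_hasFDerivAt, ← hasFDerivWithinAt_univ, hasFDerivWithinAt_euclidean]
  intro i
  rw [hasFDerivWithinAt_univ, hasFDerivAt_iff_hasDerivAt]
  fin_cases i
  · simp [planeRot, planeAngular]
    exact ((hc.mul_const (z 0)).sub (hs.mul_const (z 1))).congr_deriv (by ring)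
  · simp [planeRot, planeAngular]
    exact ((hs.mul_const (z 0)).add (hc.mul_const (z 1))).congr_deriv (by ring)

theorem windFlow_zero {M : Type*} [TopologicalSpace M] [ChartedSpace Plane M]
    (e : OpenPartialHomeomorph M Plane) (μ : ℝ) (x : M) : windFlow e μ 0 x = x := by
  unfold windFlow
  split_ifs with h
  · rw [mul_zero, planeRot_zero, e.left_inv h]
  · rfl

theorem angularField_symm {M : Type*} [TopologicalSpace M] [ChartedSpace Plane M]
    (e : OpenPartialHomeomorph M Plane) {z : Plane} (hz : z ∈ e.target) :
    angularField e (e.symm z) = mfderiv (𝓡 2) (𝓡 2) e.symm z (planeAngular z) :=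
  (if_pos (e.map_target hz)).trans
    (congrArg (fun z' : Plane => (mfderiv (𝓡 2) (𝓡 2) e.symm z' (planeAngular z') : Plane))
      (e.right_inv hz))

/-- `windFlow` is the flow of the vector field `wind`. -/
theorem isMIntegralCurve_windFlow {M : Type*} [MetricSpace M] [ChartedSpace Plane M]
    [IsManifold (𝓡 2) ∞ M] [RiemannianBundle (fun x : M => TangentSpace (𝓡 2) x)]
    {p q : M} {a : ℝ} {e : OpenPartialHomeomorph M Plane} (he : IsGeodesicPolarChart p q a e)
    (μ : ℝ) (x : M) : IsMIntegralCurve (I := 𝓡 2) (fun s => windFlow e μ s x) (wind e μ) := by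
  have key : ∀ f g : ℝ → M, f = g → ∀ s,
      HasMFDerivAt 𝓘(ℝ, ℝ) (𝓡 2) g s ((1 : ℝ →L[ℝ] ℝ).smulRight (wind e μ (g s))) →
      HasMFDerivAt 𝓘(ℝ, ℝ) (𝓡 2) f s ((1 : ℝ →L[ℝ] ℝ).smulRight (wind e μ (f s))) := by
    rintro f g rfl s h
    exact h
  intro s
  by_cases hx : x ∈ e.source
  · have hz : planeRot (μ * s) (e x) ∈ e.target := by
      have := e.map_source hx
      rw [he.target_eq] at this ⊢
      simpa [norm_planeRot] using this
    have h1 : (fun s => windFlow e μ s x) = fun s => e.symm (planeRot (μ * s) (e x)) := by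
      funext s; simp [windFlow, hx]
    have h2 : wind e μ (e.symm (planeRot (μ * s) (e x))) =
        mfderiv (𝓡 2) (𝓡 2) e.symm (planeRot (μ * s) (e x))
          (μ • planeAngular (planeRot (μ * s) (e x))) :=
      (congrArg (μ • ·) (angularField_symm e hz)).trans (map_smul _ _ _).symm
    have h3 : MDifferentiableAt (𝓡 2) (𝓡 2) e.symm (planeRot (μ * s) (e x)) :=
      (contMDiffOn_symm_of_mem_maximalAtlas he.mem_maximalAtlas).contMDiffAt
        (e.open_target.mem_nhds hz) |>.mdifferentiableAt (by simp)
    have h4 := h3.hasMFDerivAt.comp s (hasDerivAt_planeRot μ s (e x)).hasFDerivAt.hasMFDerivAt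
    refine key _ _ h1 s (h4.congr_mfderiv ?_)
    ext1
    refine Eq.trans ?_ ((one_smul ℝ _).trans h2).symm
    exact congrArg (mfderiv (𝓡 2) (𝓡 2) e.symm (planeRot (μ * s) (e x))) (one_smul ℝ _)
  · have h1 : (fun s => windFlow e μ s x) = fun _ => x := by
      funext s; simp [windFlow, hx]
    have h2 : wind e μ x = 0 := by
      simp [wind, angularField, hx]
    refine key _ _ h1 s ((hasMFDerivAt_const x s).congr_mfderiv ?_)
    ext1
    exact ((one_smul ℝ _).trans h2).symm

end

/-! The rotations of a sphere of revolution are isometries, so `A = angularField e` is a Killing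
field with flow `φ = windFlow e 1`, and the wind is `μ A`. The rest of the argument works for any
Killing flow and compares two winds `μ A` and `(μ + ν) A`; the metric `h` itself is the case of zero
wind.

Geodesics. The indicatrix of `F` is the unit sphere of `h` translated by the wind
(`randersNorm_eq_iff`). Hence at vectors with `F = c` the differential of `F² / 2` is a multiple of
that of `E_b (v) = ‖v - b A‖² / 2`, where `b = c μ`, and the factor depends only on the momentum `m
= h (A, v - b A)` (`deriv_randersEnergy_comp`). By Noether's theorem `m` is constant along a
geodesic, so there `F² / 2` and `E_b` have the same Euler-Lagrange equation. The time-dependent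
isometry `φ (c ν s)` adds `c ν A` to velocities, so it turns the equation of `E_b` with `b = c μ`
into that with `b = c (μ + ν)`. Thus geodesics of speed `c` go to geodesics of speed `c`
(`IsGeodesicOn.flow`).

Conjugate points. A variation `Γ t` through geodesics of speed `c t` is carried to `φ (c t * ν * s)
(Γ t s)`, whose variation field is `dφ (J) + c' (0) ν s A`. If `J` vanishes at both ends, the first
variation formula gives `c' (0) = 0` (`hasDerivAt_speed_zero`). The new Jacobi field is then `dφ
(J)`, with the same zeros as `J` (`IsConjugateAlong.flow`). The converse is the same statement with
the wind taken away again.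

Killing property. The hypothesis supplies only single isometries that match two given points. By the
Gauss lemma an isometry fixing the pole is linear in normal coordinates
(`IsGeodesicPolarChart.exists_linear`), so it is a rotation or a reflection, and products of these
give every rotation. Smoothness of the flow at the cut point `q` is read off in the normal
coordinates centred at `q`. -/

open Set Manifold Bundle Filter Topology
open scoped ContDiff

noncomputable section

/-! ### Smooth curves in the tangent bundle and their chart expressions. -/

section TangentLift

variable {M : Type*} [TopologicalSpace M] [ChartedSpace Plane M]
variable {E₀ E₁ : Type*} [NormedAddCommGroup E₀] [NormedSpace ℝ E₀]
  [NormedAddCommGroup E₁] [NormedSpace ℝ E₁]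

/-- A pair of smooth maps into a vector space is a smooth map into its tangent bundle. -/
theorem contMDiffOn_tangentBundle_vectorSpace {n : WithTop ℕ∞} {a b : E₁ → E₀} {t : Set E₁}
    (ha : ContDiffOn ℝ n a t) (hb : ContDiffOn ℝ n b t) :
    ContMDiffOn 𝓘(ℝ, E₁) 𝓘(ℝ, E₀).tangent n
      (fun x => (⟨a x, b x⟩ : TangentBundle 𝓘(ℝ, E₀) E₀)) t := by
  intro x hx
  refine Bundle.contMDiffWithinAt_totalSpace.2 ⟨(ha x hx).contMDiffWithinAt, ?_⟩
  convert (hb x hx).contMDiffWithinAt with y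
  simp

/-- The derivative of a smooth map, applied to a smoothly varying vector, is smooth as a map into
the tangent bundle. -/
theorem contMDiffOn_mfderivWithin_apply [IsManifold (𝓡 2) 1 M] {m n : WithTop ℕ∞} {f : E₀ → M}
    {s : Set E₀} (hf : ContMDiffOn 𝓘(ℝ, E₀) (𝓡 2) m f s) (hmn : n + 1 ≤ m)
    (hs : UniqueMDiffOn 𝓘(ℝ, E₀) s) {a b : E₁ → E₀} {t : Set E₁}
    (ha : ContDiffOn ℝ n a t) (hb : ContDiffOn ℝ n b t) (hat : MapsTo a t s) :
    ContMDiffOn 𝓘(ℝ, E₁) (𝓡 2).tangent n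
      (fun x => (⟨f (a x), mfderivWithin 𝓘(ℝ, E₀) (𝓡 2) f s (a x) (b x)⟩ :
        TangentBundle (𝓡 2) M)) t :=
  (hf.contMDiffOn_tangentMapWithin hmn hs).comp (contMDiffOn_tangentBundle_vectorSpace ha hb)
    fun _ hx => hat hx

/-- The parametrization of the tangent bundle given by the chart `e`. -/
def chartLift (e : OpenPartialHomeomorph M Plane) (z : Plane × Plane) : TangentBundle (𝓡 2) M :=
  ⟨e.symm z.1, mfderiv (𝓡 2) (𝓡 2) e.symm z.1 z.2⟩

theorem contMDiffOn_chartLift [IsManifold (𝓡 2) ∞ M] {e : OpenPartialHomeomorph M Plane}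
    (he : e ∈ IsManifold.maximalAtlas (𝓡 2) ∞ M) :
    ContMDiffOn 𝓘(ℝ, Plane × Plane) (𝓡 2).tangent ∞ (chartLift e) (e.target ×ˢ univ) := by
  refine (contMDiffOn_mfderivWithin_apply (contMDiffOn_symm_of_mem_maximalAtlas he)
    (by simp) e.open_target.uniqueMDiffOn contDiff_fst.contDiffOn contDiff_snd.contDiffOn
    fun z hz => hz.1).congr fun z hz => ?_
  rw [mfderivWithin_of_isOpen e.open_target hz.1]
  rfl

/-- The velocity of a curve, as a curve in the tangent bundle. -/
abbrev velocity (γ : ℝ → M) (s : ℝ) : TangentBundle (𝓡 2) M :=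
  ⟨γ s, mfderiv 𝓘(ℝ, ℝ) (𝓡 2) γ s (1 : ℝ)⟩

theorem tangentBundle_mk_congr {x y : M} (h : x = y) {v : TangentSpace (𝓡 2) x}
    {w : TangentSpace (𝓡 2) y} (hvw : (v : Plane) = w) :
    (⟨x, v⟩ : TangentBundle (𝓡 2) M) = ⟨y, w⟩ := by
  subst h
  exact congrArg (fun u : TangentSpace (𝓡 2) x => (⟨x, u⟩ : TangentBundle (𝓡 2) M)) hvw

theorem velocity_congr {γ γ' : ℝ → M} {s : ℝ} (h : γ =ᶠ[𝓝 s] γ') :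
    velocity γ s = velocity γ' s :=
  tangentBundle_mk_congr h.eq_of_nhds (congrArg (fun T : ℝ →L[ℝ] Plane => T 1) h.mfderiv_eq)

theorem velocity_comp_symm {e : OpenPartialHomeomorph M Plane} [IsManifold (𝓡 2) ∞ M]
    (he : e ∈ IsManifold.maximalAtlas (𝓡 2) ∞ M) {u : ℝ → Plane} {s : ℝ} {u' : Plane}
    (hu : HasDerivAt u u' s) (hs : u s ∈ e.target) :
    velocity (fun σ => e.symm (u σ)) s = chartLift e (u s, u') := by
  have h3 : MDifferentiableAt (𝓡 2) (𝓡 2) e.symm (u s) :=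
    (contMDiffOn_symm_of_mem_maximalAtlas he).contMDiffAt
      (e.open_target.mem_nhds hs) |>.mdifferentiableAt (by simp)
  have h4 := (h3.hasMFDerivAt.comp s hu.hasFDerivAt.hasMFDerivAt).mfderiv
  refine tangentBundle_mk_congr rfl ?_
  refine (congrArg (fun T : ℝ →L[ℝ] Plane => T 1) h4).trans ?_
  exact congrArg (mfderiv (𝓡 2) (𝓡 2) e.symm (u s)) (one_smul ℝ u')

theorem velocity_eq_chartLift {e : OpenPartialHomeomorph M Plane} [IsManifold (𝓡 2) ∞ M]
    (he : e ∈ IsManifold.maximalAtlas (𝓡 2) ∞ M) {γ : ℝ → M} {s : ℝ} {u' : Plane}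
    (hc : ContinuousAt γ s) (hs : γ s ∈ e.source)
    (hu : HasDerivAt (fun σ => e (γ σ)) u' s) :
    velocity γ s = chartLift e (e (γ s), u') := by
  refine Eq.trans (velocity_congr ?_) (velocity_comp_symm he hu (e.map_source hs))
  filter_upwards [hc.preimage_mem_nhds (e.open_source.mem_nhds hs)] with σ hσ
  exact (e.left_inv hσ).symm

end TangentLift

/-! ### A chart-free form of the Euler-Lagrange equation. -/

section VariationalEulerLagrange

variable {M : Type*} [TopologicalSpace M] [ChartedSpace Plane M]

/-- The derivative of `L` along the fibre, at the vector `v` in the direction `w`. -/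
def fiberDeriv (L : TangentBundle (𝓡 2) M → ℝ) {x : M} (v w : TangentSpace (𝓡 2) x) : ℝ :=
  deriv (fun τ : ℝ => L ⟨x, v + τ • w⟩) 0

/-- The Euler-Lagrange equation of `L` along `Γ 0` at time `s`, tested on the variation `Γ`: the
momentum paired with the variation field changes at the rate of change of `L` in the family. -/
def EulerLagrangeVariation (L : TangentBundle (𝓡 2) M → ℝ) (Γ : ℝ → ℝ → M) (s : ℝ) : Prop :=
  HasDerivAt (fun σ => fiberDeriv L (velocity (Γ 0) σ).2 (velocity (fun t => Γ t σ) 0).2)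
    (deriv (fun t => L (velocity (Γ t) s)) 0) s

/-- The coordinate free Euler-Lagrange equation of `L` along `γ` at time `s`. -/
def IsStationaryAt (L : TangentBundle (𝓡 2) M → ℝ) (γ : ℝ → M) (s : ℝ) : Prop :=
  ∀ Γ : ℝ → ℝ → M, ContMDiffAt 𝓘(ℝ, ℝ × ℝ) (𝓡 2) 2 (fun z : ℝ × ℝ => Γ z.1 z.2) (0, s) →
    Γ 0 =ᶠ[𝓝 s] γ → EulerLagrangeVariation L Γ s

theorem fiberDeriv_eq_of_chartLift {L : TangentBundle (𝓡 2) M → ℝ}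
    {e : OpenPartialHomeomorph M Plane} {x : M} {v w : TangentSpace (𝓡 2) x} {z y y' : Plane}
    (hv : (⟨x, v⟩ : TangentBundle (𝓡 2) M) = chartLift e (z, y))
    (hw : (⟨x, w⟩ : TangentBundle (𝓡 2) M) = chartLift e (z, y'))
    (hL : DifferentiableAt ℝ (fun y => L (chartLift e (z, y))) y) :
    fiberDeriv L v w = fderiv ℝ (fun y => L (chartLift e (z, y))) y y' := by
  obtain rfl : x = e.symm z := congrArg TotalSpace.proj hv
  obtain rfl : v = mfderiv (𝓡 2) (𝓡 2) e.symm z y := TotalSpace.mk_injective _ hv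
  obtain rfl : w = mfderiv (𝓡 2) (𝓡 2) e.symm z y' := TotalSpace.mk_injective _ hw
  have h1 : HasDerivAt (fun τ : ℝ => y + τ • y') y' 0 := by
    simpa using ((hasDerivAt_id (0 : ℝ)).smul_const y').const_add y
  have h2 : HasFDerivAt (fun y => L (chartLift e (z, y)))
      (fderiv ℝ (fun y => L (chartLift e (z, y))) y) (y + (0 : ℝ) • y') := by
    simpa using hL.hasFDerivAt
  have h3 := (h2.comp_hasDerivAt (0 : ℝ) h1).deriv
  rw [← h3, fiberDeriv]
  congr 1
  funext τ
  refine congrArg L ?_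
  refine tangentBundle_mk_congr rfl ?_
  exact ((map_add (mfderiv (𝓡 2) (𝓡 2) e.symm z) y (τ • y')).trans
    (congrArg _ (map_smul (mfderiv (𝓡 2) (𝓡 2) e.symm z) τ y'))).symm

theorem hasDerivAt_fst_of_hasFDerivAt {E : Type*} [NormedAddCommGroup E] [NormedSpace ℝ E]
    {u : ℝ × ℝ → E} {t σ : ℝ} {u' : ℝ × ℝ →L[ℝ] E} (h : HasFDerivAt u u' (t, σ)) :
    HasDerivAt (fun t => u (t, σ)) (u' (1, 0)) t :=
  HasFDerivAt.comp_hasDerivAt t (f := fun t : ℝ => (t, σ)) h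
    ((hasDerivAt_id t).prodMk (hasDerivAt_const t σ))

theorem hasDerivAt_snd_of_hasFDerivAt {E : Type*} [NormedAddCommGroup E] [NormedSpace ℝ E]
    {u : ℝ × ℝ → E} {t σ : ℝ} {u' : ℝ × ℝ →L[ℝ] E} (h : HasFDerivAt u u' (t, σ)) :
    HasDerivAt (fun σ => u (t, σ)) (u' (0, 1)) σ :=
  HasFDerivAt.comp_hasDerivAt σ (f := fun σ : ℝ => (t, σ)) h
    ((hasDerivAt_const σ t).prodMk (hasDerivAt_id σ))

theorem eventually_snd_of_eventually {p : ℝ × ℝ → Prop} {t s : ℝ} (h : ∀ᶠ z in 𝓝 (t, s), p z) :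
    ∀ᶠ σ in 𝓝 s, p (t, σ) :=
  (Continuous.prodMk_right t).continuousAt.eventually h

theorem eventually_fst_of_eventually {p : ℝ × ℝ → Prop} {t s : ℝ} (h : ∀ᶠ z in 𝓝 (t, s), p z) :
    ∀ᶠ τ in 𝓝 t, p (τ, s) :=
  (Continuous.prodMk_left s).continuousAt.eventually h

variable [IsManifold (𝓡 2) ∞ M]

/-- The velocities of a family of curves in terms of its coordinate expression. -/
theorem velocity_eq_of_eventuallyEq {e : OpenPartialHomeomorph M Plane}
    (he : e ∈ IsManifold.maximalAtlas (𝓡 2) ∞ M) {Γ : ℝ → ℝ → M} {u : ℝ × ℝ → Plane} {z : ℝ × ℝ}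
    (hu : DifferentiableAt ℝ u z) (hz : u z ∈ e.target)
    (hΓ : ∀ᶠ z in 𝓝 z, Γ z.1 z.2 = e.symm (u z)) :
    velocity (Γ z.1) z.2 = chartLift e (u z, fderiv ℝ u z (0, 1)) ∧
      velocity (fun t => Γ t z.2) z.1 = chartLift e (u z, fderiv ℝ u z (1, 0)) := by
  obtain ⟨t, σ⟩ := z
  constructor
  · rw [velocity_congr (γ' := fun σ => e.symm (u (t, σ))) (eventually_snd_of_eventually hΓ)]
    exact velocity_comp_symm he (hasDerivAt_snd_of_hasFDerivAt hu.hasFDerivAt) hz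
  · rw [velocity_congr (γ' := fun t => e.symm (u (t, σ))) (eventually_fst_of_eventually hΓ)]
    exact velocity_comp_symm he (hasDerivAt_fst_of_hasFDerivAt hu.hasFDerivAt) hz

/-- The chain rule in the chart: besides the `∂L/∂x` term, the change of `L` in the family contains
`∂L/∂y` applied to the mixed derivative of `u`. Differentiability of `L` is asked only along the
velocity of `Γ 0`, because the Randers norm is smooth only off the zero section. -/
theorem eulerLagrangeVariation_iff {e : OpenPartialHomeomorph M Plane}
    (he : e ∈ IsManifold.maximalAtlas (𝓡 2) ∞ M) {L : TangentBundle (𝓡 2) M → ℝ}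
    {Γ : ℝ → ℝ → M} {u : ℝ × ℝ → Plane} {s : ℝ} (hu : ContDiffAt ℝ 2 u (0, s))
    (hs : u (0, s) ∈ e.target) (hΓ : ∀ᶠ z in 𝓝 ((0 : ℝ), s), Γ z.1 z.2 = e.symm (u z))
    (hL : ∀ᶠ σ in 𝓝 s, DifferentiableAt ℝ (fun z => L (chartLift e z))
      (u (0, σ), fderiv ℝ u (0, σ) (0, 1))) :
    EulerLagrangeVariation L Γ s ↔
      HasDerivAt (fun σ => fderiv ℝ (fun y => L (chartLift e (u (0, σ), y)))
          (fderiv ℝ u (0, σ) (0, 1)) (fderiv ℝ u (0, σ) (1, 0)))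
        (fderiv ℝ (fun z => L (chartLift e (z, fderiv ℝ u (0, s) (0, 1)))) (u (0, s))
            (fderiv ℝ u (0, s) (1, 0)) +
          fderiv ℝ (fun y => L (chartLift e (u (0, s), y))) (fderiv ℝ u (0, s) (0, 1))
            (fderiv ℝ (fderiv ℝ u) (0, s) (1, 0) (0, 1))) s := by
  have hgood : ∀ᶠ z in 𝓝 ((0 : ℝ), s),
      velocity (Γ z.1) z.2 = chartLift e (u z, fderiv ℝ u z (0, 1)) ∧
      velocity (fun t => Γ t z.2) z.1 = chartLift e (u z, fderiv ℝ u z (1, 0)) := by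
    filter_upwards [hΓ.eventually_nhds, hu.eventually (by simp),
      hu.continuousAt.eventually (e.open_target.mem_nhds hs)] with z h1 h2 h3
    exact velocity_eq_of_eventuallyEq he (h2.differentiableAt (by simp)) h3 h1
  have hfun : (fun σ => fiberDeriv L (velocity (Γ 0) σ).2 (velocity (fun t => Γ t σ) 0).2)
      =ᶠ[𝓝 s] fun σ => fderiv ℝ (fun y => L (chartLift e (u (0, σ), y)))
          (fderiv ℝ u (0, σ) (0, 1)) (fderiv ℝ u (0, σ) (1, 0)) := by
    filter_upwards [eventually_snd_of_eventually hgood, hL] with σ h1 h2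
    exact fiberDeriv_eq_of_chartLift h1.1 h1.2
      (h2.comp (fderiv ℝ u (0, σ) (0, 1)) (by fun_prop))
  have hder : deriv (fun t => L (velocity (Γ t) s)) 0 =
      fderiv ℝ (fun z => L (chartLift e (z, fderiv ℝ u (0, s) (0, 1)))) (u (0, s))
            (fderiv ℝ u (0, s) (1, 0)) +
          fderiv ℝ (fun y => L (chartLift e (u (0, s), y))) (fderiv ℝ u (0, s) (0, 1))
            (fderiv ℝ (fderiv ℝ u) (0, s) (1, 0) (0, 1)) := by
    have h1 : (fun t => L (velocity (Γ t) s)) =ᶠ[𝓝 0]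
        fun t => L (chartLift e (u (t, s), fderiv ℝ u (t, s) (0, 1))) := by
      filter_upwards [eventually_fst_of_eventually hgood] with t h1
      rw [h1.1]
    have h2 := hL.self_of_nhds.hasFDerivAt
    have h3 : HasDerivAt (fun t => u (t, s)) (fderiv ℝ u (0, s) (1, 0)) 0 :=
      hasDerivAt_fst_of_hasFDerivAt (hu.differentiableAt (by simp)).hasFDerivAt
    have h4 : HasDerivAt (fun t => fderiv ℝ u (t, s)) (fderiv ℝ (fderiv ℝ u) (0, s) (1, 0)) 0 :=
      hasDerivAt_fst_of_hasFDerivAt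
        ((hu.fderiv_right (m := 1) (by norm_num)).differentiableAt (by simp)).hasFDerivAt
    have h5 := h4.clm_apply (hasDerivAt_const (0 : ℝ) ((0 : ℝ), (1 : ℝ)))
    simp only [map_zero, add_zero] at h5
    have h8 := (h2.comp_hasDerivAt (f := fun t => (u (t, s), fderiv ℝ u (t, s) (0, 1)))
      (0 : ℝ) (h3.prodMk h5)).deriv
    rw [Function.comp_def] at h8
    rw [h1.deriv_eq, h8]
    have h6 := (HasFDerivAt.comp (u (0, s)) (f := fun z => (z, fderiv ℝ u (0, s) (0, 1))) h2
      ((hasFDerivAt_id (𝕜 := ℝ) _).prodMk (hasFDerivAt_const _ _))).fderiv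
    have h7 := (HasFDerivAt.comp (fderiv ℝ u (0, s) (0, 1)) (f := fun y => (u (0, s), y)) h2
      ((hasFDerivAt_const _ _).prodMk (hasFDerivAt_id (𝕜 := ℝ) _))).fderiv
    simp only [Function.comp_def] at h6 h7
    rw [h6, h7]
    rw [ContinuousLinearMap.comp_apply, ContinuousLinearMap.comp_apply, ← map_add]
    simp
  unfold EulerLagrangeVariation
  rw [hder]
  exact hfun.hasDerivAt_iff

/-- The mixed derivative term is exactly what the product rule contributes to the derivative of
momentum paired with variation field, so it cancels. Since the right side mentions no chart,
checking the Euler-Lagrange equation in one chart around a point settles it in all of them. -/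
theorem euler_lagrange_iff_isStationaryAt {e : OpenPartialHomeomorph M Plane}
    (he : e ∈ IsManifold.maximalAtlas (𝓡 2) ∞ M) {L : TangentBundle (𝓡 2) M → ℝ} {γ : ℝ → M}
    {s : ℝ} (hγ : ContMDiffAt 𝓘(ℝ, ℝ) (𝓡 2) 2 γ s) (hs : γ s ∈ e.source)
    (hL : ∀ᶠ σ in 𝓝 s, DifferentiableAt ℝ (fun z => L (chartLift e z))
      (e (γ σ), deriv (fun τ => e (γ τ)) σ)) :
    (∀ w : Plane, HasDerivAt
        (fun σ => fderiv ℝ (fun y => L (chartLift e (e (γ σ), y))) (deriv (fun τ => e (γ τ)) σ) w)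
        (fderiv ℝ (fun z => L (chartLift e (z, deriv (fun τ => e (γ τ)) s))) (e (γ s)) w) s) ↔
      IsStationaryAt L γ s := by
  have heM : ContMDiffAt (𝓡 2) (𝓡 2) 2 e (γ s) :=
    ((contMDiffOn_of_mem_maximalAtlas he).contMDiffAt (e.open_source.mem_nhds hs)).of_le
      (by norm_cast)
  constructor
  · intro h Γ hΓ h0
    set u : ℝ × ℝ → Plane := fun z => e (Γ z.1 z.2) with hu_def
    have h00 : Γ 0 s = γ s := h0.self_of_nhds
    have hu : ContDiffAt ℝ 2 u (0, s) := by
      rw [← contMDiffAt_iff_contDiffAt]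
      exact ContMDiffAt.comp (0, s) (h00 ▸ heM) hΓ
    have hsrc : ∀ᶠ z in 𝓝 ((0 : ℝ), s), Γ z.1 z.2 = e.symm (u z) := by
      filter_upwards [hΓ.continuousAt.eventually
        (e.open_source.mem_nhds (by simpa [h00] using hs))] with z hz
      exact (e.left_inv hz).symm
    have hd : ∀ᶠ σ in 𝓝 s, e (γ σ) = u (0, σ) ∧
        deriv (fun τ => e (γ τ)) σ = fderiv ℝ u (0, σ) (0, 1) := by
      filter_upwards [h0.eventually_nhds, eventually_snd_of_eventually (hu.eventually (by simp))]
        with σ h1 h2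
      refine ⟨by rw [hu_def]; simp only; rw [h1.self_of_nhds], ?_⟩
      rw [← (hasDerivAt_snd_of_hasFDerivAt (h2.differentiableAt (by simp)).hasFDerivAt).deriv]
      refine EventuallyEq.deriv_eq ?_
      filter_upwards [h1] with τ hτ
      simp only [hu_def, hτ]
    rw [eulerLagrangeVariation_iff he hu (by simpa [hu_def, h00] using e.map_source hs) hsrc]
    · have hds := hd.self_of_nhds
      rw [hds.1, hds.2] at h
      set p : ℝ → Plane →L[ℝ] ℝ := fun σ => fderiv ℝ (fun y => L (chartLift e (u (0, σ), y)))
          (fderiv ℝ u (0, σ) (0, 1)) with hp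
      set q : Plane →L[ℝ] ℝ := fderiv ℝ (fun z => L (chartLift e (z, fderiv ℝ u (0, s) (0, 1))))
        (u (0, s)) with hq
      have hpw : ∀ w, HasDerivAt (fun σ => p σ w) (q w) s := by
        intro w
        refine (h w).congr_of_eventuallyEq ?_
        filter_upwards [hd] with σ hσ
        rw [hp, hσ.1, hσ.2]
      have hj : HasDerivAt (fun σ => fderiv ℝ u (0, σ) (1, 0))
          (fderiv ℝ (fderiv ℝ u) (0, s) (1, 0) (0, 1)) s := by
        have h4 : HasDerivAt (fun σ => fderiv ℝ u (0, σ))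
            (fderiv ℝ (fderiv ℝ u) (0, s) (0, 1)) s :=
          hasDerivAt_snd_of_hasFDerivAt
            ((hu.fderiv_right (m := 1) (by norm_num)).differentiableAt (by simp)).hasFDerivAt
        have h5 := h4.clm_apply (hasDerivAt_const s ((1 : ℝ), (0 : ℝ)))
        simp only [map_zero, add_zero] at h5
        -- Symmetry of second derivatives: the `s`-derivative of the variation field is the
        -- `t`-derivative of the velocity.
        rwa [(hu.isSymmSndFDerivAt (by simp)) (0, 1) (1, 0)] at h5
      set j := fun σ => fderiv ℝ u (0, σ) (1, 0)
      set j' := fderiv ℝ (fderiv ℝ u) (0, s) (1, 0) (0, 1)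
      -- The momentum is known to be differentiable only when applied to a fixed vector, so the
      -- product rule is used one coordinate at a time.
      have hdec : ∀ w : Plane, w = w 0 • EuclideanSpace.single 0 1 +
          w 1 • EuclideanSpace.single 1 1 := by
        intro w; ext i; fin_cases i <;> simp
      have hji : ∀ i, HasDerivAt (fun σ => j σ i) (j' i) s := fun i =>
        (EuclideanSpace.proj (𝕜 := ℝ) i).hasFDerivAt.comp_hasDerivAt s hj
      have hpe : ∀ (T : Plane →L[ℝ] ℝ) (w : Plane), T w = w 0 * T (EuclideanSpace.single 0 1) +
          w 1 * T (EuclideanSpace.single 1 1) := by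
        intro T w
        conv_lhs => rw [hdec w]
        simp
      have := ((hji 0).mul (hpw (EuclideanSpace.single 0 1))).add
        ((hji 1).mul (hpw (EuclideanSpace.single 1 1)))
      refine (this.congr_of_eventuallyEq (.of_forall fun σ => hpe (p σ) (j σ))).congr_deriv ?_
      change _ = q (j s) + p s j'
      rw [hpe q (j s), hpe (p s) j']
      ring
    · filter_upwards [hd, hL] with σ h1 h2
      rwa [← h1.1, ← h1.2]
  · intro h w
    -- Translating the curve in the chart along the constant vector `w` gives a family without mixed
    -- derivative, whose equation is the `w`-component of the Euler-Lagrange equation.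
    set u : ℝ × ℝ → Plane := fun z => e (γ z.2) + z.1 • w with hu_def
    have hγe : ContDiffAt ℝ 2 (fun τ => e (γ τ)) s := by
      rw [← contMDiffAt_iff_contDiffAt]
      exact heM.comp s hγ
    have hu2 : ∀ z : ℝ × ℝ, ContDiffAt ℝ 2 (fun τ => e (γ τ)) z.2 → ContDiffAt ℝ 2 u z :=
      fun z hz => (ContDiffAt.comp z (f := Prod.snd) hz contDiffAt_snd).add
        (contDiffAt_fst.smul contDiffAt_const)
    have hus : u (0, s) ∈ e.target := by simpa [hu_def] using e.map_source hs
    have hd : ∀ z : ℝ × ℝ, DifferentiableAt ℝ (fun τ => e (γ τ)) z.2 → fderiv ℝ u z =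
        (ContinuousLinearMap.snd ℝ ℝ ℝ).smulRight (deriv (fun τ => e (γ τ)) z.2) +
          (ContinuousLinearMap.fst ℝ ℝ ℝ).smulRight w := by
      intro z hz
      have h1 := HasFDerivAt.comp z (f := Prod.snd) hz.hasDerivAt.hasFDerivAt
        (hasFDerivAt_snd (𝕜 := ℝ) (E := ℝ) (F := ℝ))
      have h2 : HasFDerivAt (fun z : ℝ × ℝ => z.1 • w)
          ((ContinuousLinearMap.fst ℝ ℝ ℝ).smulRight w) z :=
        ((ContinuousLinearMap.fst ℝ ℝ ℝ).smulRight w).hasFDerivAt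
      rw [show u = (fun τ => e (γ τ)) ∘ Prod.snd + fun z => z.1 • w from rfl, (h1.add h2).fderiv]
      ext x <;> simp
    have hev : ∀ᶠ z in 𝓝 ((0 : ℝ), s), DifferentiableAt ℝ (fun τ => e (γ τ)) z.2 :=
      continuousAt_snd.eventually ((hγe.eventually (by simp)).mono
        fun z hz => hz.differentiableAt (by simp))
    have h2d : fderiv ℝ (fderiv ℝ u) (0, s) (1, 0) (0, 1) = 0 := by
      have h4 := hasDerivAt_fst_of_hasFDerivAt
        (((hu2 (0, s) hγe).fderiv_right (m := 1) (by norm_num)).differentiableAt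
          (by simp)).hasFDerivAt
      have h5 : (fun t => fderiv ℝ u (t, s)) =ᶠ[𝓝 0] fun _ => 
          (ContinuousLinearMap.snd ℝ ℝ ℝ).smulRight (deriv (fun τ => e (γ τ)) s) +
          (ContinuousLinearMap.fst ℝ ℝ ℝ).smulRight w := by
        filter_upwards [eventually_fst_of_eventually hev] with t ht
        exact hd (t, s) ht
      have h6 := h4.unique ((hasDerivAt_const (0 : ℝ) _).congr_of_eventuallyEq h5)
      rw [h6]; simp
    have h1 := h (fun t σ => e.symm (u (t, σ))) ?_ ?_
    · rw [eulerLagrangeVariation_iff he (hu2 _ hγe) hus (.of_forall fun z => rfl)] at h1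
      · rw [h2d, hd _ hev.self_of_nhds] at h1
        simp only [hu_def] at h1
        simp only [_root_.add_apply, ContinuousLinearMap.smulRight_apply,
          ContinuousLinearMap.coe_snd', ContinuousLinearMap.coe_fst', zero_smul, one_smul,
          add_zero, zero_add, map_zero] at h1
        refine h1.congr_of_eventuallyEq ?_
        filter_upwards [eventually_snd_of_eventually hev] with σ hσ
        rw [hd _ hσ]
        simp
      · filter_upwards [eventually_snd_of_eventually hev, hL] with σ h1 h2
        rw [hd _ h1]
        simpa [hu_def] using h2
    · refine ContMDiffAt.comp (0, s) (((contMDiffOn_symm_of_mem_maximalAtlas he).contMDiffAt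
        (e.open_target.mem_nhds hus)).of_le (by norm_cast)) ?_
      exact (hu2 _ hγe).contMDiffAt
    · filter_upwards [hγ.continuousAt.eventually (e.open_source.mem_nhds hs)] with σ hσ
      simpa [hu_def] using e.left_inv hσ

end VariationalEulerLagrange

/-! ### Algebra and smoothness of the Randers norm. -/

section Randers

variable {M : Type*} [MetricSpace M] [ChartedSpace Plane M]
  [RiemannianBundle (fun x : M => TangentSpace (𝓡 2) x)]

theorem one_sub_norm_sq_pos {V : Type*} [NormedAddCommGroup V] {w : V} (hw : ‖w‖ < 1) :
    0 < 1 - ‖w‖ ^ 2 := by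
  nlinarith [norm_nonneg w]

theorem randersNorm_radicand_nonneg {V : Type*} [NormedAddCommGroup V] [InnerProductSpace ℝ V]
    {w : V} (hw : ‖w‖ < 1) (y : V) : 0 ≤ (1 - ‖w‖ ^ 2) * ‖y‖ ^ 2 + inner ℝ w y ^ 2 := by
  have := one_sub_norm_sq_pos hw
  positivity

theorem norm_sub_smul_sq {V : Type*} [NormedAddCommGroup V] [InnerProductSpace ℝ V] (y w : V)
    (f : ℝ) : ‖y - f • w‖ ^ 2 = ‖y‖ ^ 2 - 2 * f * inner ℝ w y + f ^ 2 * ‖w‖ ^ 2 := by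
  rw [norm_sub_sq_real, inner_smul_right, norm_smul, real_inner_comm, mul_pow, Real.norm_eq_abs,
    sq_abs]
  ring

/-- The indicatrix of the Randers norm is the unit sphere of the Riemannian metric, translated by
the wind. -/
theorem randersNorm_eq_iff {W : ∀ x : M, TangentSpace (𝓡 2) x} {x : M} (hW : ‖W x‖ < 1)
    (y : TangentSpace (𝓡 2) x) (f : ℝ) :
    randersNorm W x y = f ↔ 0 ≤ f ∧ ‖y - f • W x‖ = f := by
  have hl := one_sub_norm_sq_pos hW
  have hr := randersNorm_radicand_nonneg hW y
  have hsq := Real.sq_sqrt hr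
  have hs0 := Real.sqrt_nonneg ((1 - ‖W x‖ ^ 2) * ‖y‖ ^ 2 + inner ℝ (W x) y ^ 2)
  set S := Real.sqrt ((1 - ‖W x‖ ^ 2) * ‖y‖ ^ 2 + inner ℝ (W x) y ^ 2)
  have hF : randersNorm W x y = f ↔ S = (1 - ‖W x‖ ^ 2) * f + inner ℝ (W x) y := by
    unfold randersNorm
    rw [← sub_div, div_eq_iff hl.ne']
    constructor <;> intro h <;> linarith
  have hcs := abs_le.1 (abs_real_inner_le_norm (W x) y)
  rw [hF]
  constructor
  · intro h
    have hf : 0 ≤ f := by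
      have h1 : inner ℝ (W x) y ≤ S := by
        refine Real.le_sqrt_of_sq_le ?_
        nlinarith [mul_nonneg hl.le (sq_nonneg ‖y‖)]
      nlinarith
    refine ⟨hf, ?_⟩
    rw [← sq_eq_sq₀ (norm_nonneg _) hf, norm_sub_smul_sq]
    rw [h] at hsq
    have : (1 - ‖W x‖ ^ 2) * ((‖y‖ ^ 2 - 2 * f * inner ℝ (W x) y + f ^ 2 * ‖W x‖ ^ 2) - f ^ 2) = 0 := by
      linarith
    rcases mul_eq_zero.1 this with h1 | h1
    · exact absurd h1 hl.ne'
    · linarith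
  · rintro ⟨hf, h⟩
    have h1 : ‖y - f • W x‖ ^ 2 = f ^ 2 := by rw [h]
    rw [norm_sub_smul_sq] at h1
    -- The sign that selects the non-negative root: the expression equals `f + h (W, y - f W)`,
    -- which is at least `f (1 - ‖W‖)`.
    have h2 : 0 ≤ (1 - ‖W x‖ ^ 2) * f + inner ℝ (W x) y := by
      have h3 := (abs_le.1 (abs_real_inner_le_norm (W x) (y - f • W x))).1
      rw [inner_sub_right, inner_smul_right, real_inner_self_eq_norm_sq, h] at h3
      nlinarith [norm_nonneg (W x)]
    rw [← sq_eq_sq₀ hs0 h2, hsq]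
    nlinarith

theorem randersNorm_nonneg {W : ∀ x : M, TangentSpace (𝓡 2) x} {x : M} (hW : ‖W x‖ < 1)
    (y : TangentSpace (𝓡 2) x) : 0 ≤ randersNorm W x y :=
  ((randersNorm_eq_iff hW y _).1 rfl).1

theorem norm_sub_randersNorm_smul {W : ∀ x : M, TangentSpace (𝓡 2) x} {x : M} (hW : ‖W x‖ < 1)
    (y : TangentSpace (𝓡 2) x) : ‖y - randersNorm W x y • W x‖ = randersNorm W x y :=
  ((randersNorm_eq_iff hW y _).1 rfl).2

theorem randersNorm_pos_iff {W : ∀ x : M, TangentSpace (𝓡 2) x} {x : M} (hW : ‖W x‖ < 1)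
    {y : TangentSpace (𝓡 2) x} : 0 < randersNorm W x y ↔ y ≠ 0 := by
  rw [(randersNorm_nonneg hW y).lt_iff_ne', not_iff_not, randersNorm_eq_iff hW]
  simp

theorem randersNorm_smul {W : ∀ x : M, TangentSpace (𝓡 2) x} {x : M} (hW : ‖W x‖ < 1)
    (y : TangentSpace (𝓡 2) x) {r : ℝ} (hr : 0 ≤ r) :
    randersNorm W x (r • y) = r * randersNorm W x y := by
  rw [randersNorm_eq_iff hW, mul_smul, ← smul_sub, norm_smul, norm_sub_randersNorm_smul hW,
    Real.norm_of_nonneg hr]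
  exact ⟨mul_nonneg hr (randersNorm_nonneg hW y), rfl⟩

theorem randersNorm_mul_le {W : ∀ x : M, TangentSpace (𝓡 2) x} {x : M} (hW : ‖W x‖ < 1)
    (y : TangentSpace (𝓡 2) x) : randersNorm W x y * (1 - ‖W x‖) ≤ ‖y‖ := by
  have h1 := norm_sub_le y (randersNorm W x y • W x)
  rw [norm_sub_randersNorm_smul hW, norm_smul,
    Real.norm_of_nonneg (randersNorm_nonneg hW y)] at h1
  linarith

/-- The Randers norm of the wind `μ A`, as a function on the tangent bundle. -/
def randersSpeed (A : ∀ x : M, TangentSpace (𝓡 2) x) (μ : ℝ) (X : TangentBundle (𝓡 2) M) : ℝ :=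
  randersNorm (fun x => μ • A x) X.1 X.2

/-- The Randers energy `F² / 2` of the wind `μ A`. -/
def randersEnergy (A : ∀ x : M, TangentSpace (𝓡 2) x) (μ : ℝ) (X : TangentBundle (𝓡 2) M) : ℝ :=
  randersSpeed A μ X ^ 2 / 2

/-- The Riemannian energy of the velocity relative to the wind `b A`. -/
def windEnergy (A : ∀ x : M, TangentSpace (𝓡 2) x) (b : ℝ) (X : TangentBundle (𝓡 2) M) : ℝ :=
  ‖X.2 - b • A X.1‖ ^ 2 / 2

variable [IsManifold (𝓡 2) ∞ M]
  [IsContMDiffRiemannianBundle (𝓡 2) ∞ Plane (fun x : M => TangentSpace (𝓡 2) x)]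

theorem contMDiff_norm_sq :
    ContMDiff (𝓡 2).tangent 𝓘(ℝ, ℝ) ∞ (fun X : TangentBundle (𝓡 2) M => ‖X.2‖ ^ 2) := by
  have h : ContMDiff (𝓡 2).tangent (𝓡 2).tangent ∞
      (fun X : TangentBundle (𝓡 2) M => (⟨X.1, X.2⟩ : TangentBundle (𝓡 2) M)) := contMDiff_id
  have := ContMDiff.inner_bundle (b := fun X : TangentBundle (𝓡 2) M => X.1) h h
  simpa only [real_inner_self_eq_norm_sq] using this

variable {A : ∀ x : M, TangentSpace (𝓡 2) x}

theorem contMDiff_inner_field (hA : ContMDiff (𝓡 2) (𝓡 2).tangent ∞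
      (fun x : M => (⟨x, A x⟩ : TangentBundle (𝓡 2) M))) :
    ContMDiff (𝓡 2).tangent 𝓘(ℝ, ℝ) ∞
      (fun X : TangentBundle (𝓡 2) M => inner ℝ (A X.1) X.2) := by
  have h : ContMDiff (𝓡 2).tangent (𝓡 2).tangent ∞
      (fun X : TangentBundle (𝓡 2) M => (⟨X.1, X.2⟩ : TangentBundle (𝓡 2) M)) := contMDiff_id
  exact ContMDiff.inner_bundle (b := fun X : TangentBundle (𝓡 2) M => X.1)
    (hA.comp (contMDiff_proj (TangentSpace (𝓡 2)))) h

theorem contMDiff_norm_sq_field (hA : ContMDiff (𝓡 2) (𝓡 2).tangent ∞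
      (fun x : M => (⟨x, A x⟩ : TangentBundle (𝓡 2) M))) :
    ContMDiff (𝓡 2).tangent 𝓘(ℝ, ℝ) ∞
      (fun X : TangentBundle (𝓡 2) M => ‖A X.1‖ ^ 2) := by
  have h : ContMDiff (𝓡 2).tangent (𝓡 2).tangent ∞
      (fun X : TangentBundle (𝓡 2) M => (⟨X.1, A X.1⟩ : TangentBundle (𝓡 2) M)) :=
    hA.comp (contMDiff_proj (TangentSpace (𝓡 2)))
  have := ContMDiff.inner_bundle (b := fun X : TangentBundle (𝓡 2) M => X.1) h h
  simpa only [real_inner_self_eq_norm_sq] using this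

/-- The norm is a function of the three smooth quantities `‖y‖²`, `h (A, y)` and `‖A‖²`, and its
radicand is positive for `y ≠ 0`. -/
theorem contMDiffAt_randersSpeed {μ : ℝ} (hμ : ∀ x, |μ| * ‖A x‖ < 1)
    (hA : ContMDiff (𝓡 2) (𝓡 2).tangent ∞
      (fun x : M => (⟨x, A x⟩ : TangentBundle (𝓡 2) M)))
    {X : TangentBundle (𝓡 2) M} (hX : X.2 ≠ 0) :
    ContMDiffAt (𝓡 2).tangent 𝓘(ℝ, ℝ) ∞ (randersSpeed A μ) X := by
  have hW : ∀ x, ‖μ • A x‖ < 1 := fun x => by simpa [norm_smul] using hμ x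
  have hl := one_sub_norm_sq_pos (hW X.1)
  have hr : 0 < (1 - ‖μ • A X.1‖ ^ 2) * ‖X.2‖ ^ 2 + inner ℝ (μ • A X.1) X.2 ^ 2 := by
    have : 0 < ‖X.2‖ := norm_pos_iff.2 hX
    positivity
  simp only [norm_smul, mul_pow, Real.norm_eq_abs, sq_abs, inner_smul_left, RCLike.conj_to_real]
    at hl hr
  have h : ContDiffAt ℝ ∞ (fun p : ℝ × ℝ × ℝ =>
      Real.sqrt ((1 - μ ^ 2 * p.2.2) * p.1 + μ ^ 2 * p.2.1 ^ 2) / (1 - μ ^ 2 * p.2.2)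
        - μ * p.2.1 / (1 - μ ^ 2 * p.2.2)) (‖X.2‖ ^ 2, inner ℝ (A X.1) X.2, ‖A X.1‖ ^ 2) := by
    refine ContDiffAt.sub (ContDiffAt.div (ContDiffAt.sqrt (by fun_prop) hr.ne') (by fun_prop)
      hl.ne') (ContDiffAt.div (by fun_prop) (by fun_prop) hl.ne')
  have := ContMDiffAt.comp X
    (f := fun X : TangentBundle (𝓡 2) M => (‖X.2‖ ^ 2, inner ℝ (A X.1) X.2, ‖A X.1‖ ^ 2))
    h.contMDiffAt (contMDiff_norm_sq.contMDiffAt.prodMk_space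
      ((contMDiff_inner_field hA).contMDiffAt.prodMk_space
        (contMDiff_norm_sq_field hA).contMDiffAt))
  refine this.congr_of_eventuallyEq (.of_forall fun X => ?_)
  simp [randersSpeed, randersNorm, norm_smul, mul_pow, inner_smul_left]

end Randers

/-! ### Differentiability of fibre lines and of velocities in a family. -/

section ChartLift

variable {M : Type*} [TopologicalSpace M] [ChartedSpace Plane M]

theorem mdifferentiable_of_mem_maximalAtlas {e : OpenPartialHomeomorph M Plane}
    (he : e ∈ IsManifold.maximalAtlas (𝓡 2) ∞ M) : e.MDifferentiable (𝓡 2) (𝓡 2) :=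
  ⟨(contMDiffOn_of_mem_maximalAtlas he).mdifferentiableOn (by simp),
    (contMDiffOn_symm_of_mem_maximalAtlas he).mdifferentiableOn (by simp)⟩

theorem exists_eq_chartLift {e : OpenPartialHomeomorph M Plane}
    (he : e ∈ IsManifold.maximalAtlas (𝓡 2) ∞ M) {x : M} (hx : x ∈ e.source)
    (v : TangentSpace (𝓡 2) x) :
    ∃ y, (⟨x, v⟩ : TangentBundle (𝓡 2) M) = chartLift e (e x, y) := by
  obtain ⟨y, hy⟩ := ((mdifferentiable_of_mem_maximalAtlas he).symm.mfderiv_surjective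
    (e.map_source hx)) v
  exact ⟨y, tangentBundle_mk_congr (e.left_inv hx).symm hy.symm⟩

variable [IsManifold (𝓡 2) ∞ M]

theorem mdifferentiableAt_chartLift_comp {e : OpenPartialHomeomorph M Plane}
    (he : e ∈ IsManifold.maximalAtlas (𝓡 2) ∞ M) {z y : ℝ → Plane} {t : ℝ}
    (hz : DifferentiableAt ℝ z t) (hy : DifferentiableAt ℝ y t) (ht : z t ∈ e.target) :
    MDifferentiableAt 𝓘(ℝ, ℝ) (𝓡 2).tangent (fun t => chartLift e (z t, y t)) t := by
  have h1 := ((contMDiffOn_chartLift he).contMDiffAt (x := (z t, y t))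
    ((e.open_target.prod isOpen_univ).mem_nhds ⟨ht, mem_univ _⟩)).mdifferentiableAt (by simp)
  exact MDifferentiableAt.comp t (f := fun t => (z t, y t)) h1
    (hz.prodMk hy).mdifferentiableAt

/-- Makes fibre derivatives a special case of derivatives along curves in the tangent bundle, so
that one computation serves both sides of the Euler-Lagrange equation. -/
theorem mdifferentiableAt_fiberLine {x : M} (v w : TangentSpace (𝓡 2) x) :
    MDifferentiableAt 𝓘(ℝ, ℝ) (𝓡 2).tangent
      (fun τ : ℝ => (⟨x, v + τ • w⟩ : TangentBundle (𝓡 2) M)) 0 := by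
  have he : chartAt Plane x ∈ IsManifold.maximalAtlas (𝓡 2) ∞ M :=
    IsManifold.chart_mem_maximalAtlas x
  have hx := mem_chart_source Plane x
  set e := chartAt Plane x
  obtain ⟨y, hy⟩ := exists_eq_chartLift he hx v
  obtain ⟨y', hy'⟩ := exists_eq_chartLift he hx w
  have key : ∀ (x' : M) (z : Plane) (v w : TangentSpace (𝓡 2) x'),
      (⟨x', v⟩ : TangentBundle (𝓡 2) M) = chartLift e (z, y) →
      (⟨x', w⟩ : TangentBundle (𝓡 2) M) = chartLift e (z, y') → ∀ τ : ℝ,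
      (⟨x', v + τ • w⟩ : TangentBundle (𝓡 2) M) = chartLift e (z, y + τ • y') := by
    intro x' z v w hv hw τ
    obtain rfl : x' = e.symm z := congrArg TotalSpace.proj hv
    obtain rfl : v = mfderiv (𝓡 2) (𝓡 2) e.symm z y := TotalSpace.mk_injective _ hv
    obtain rfl : w = mfderiv (𝓡 2) (𝓡 2) e.symm z y' := TotalSpace.mk_injective _ hw
    refine tangentBundle_mk_congr rfl ?_
    exact ((map_add (mfderiv (𝓡 2) (𝓡 2) e.symm z) y (τ • y')).trans
      (congrArg _ (map_smul (mfderiv (𝓡 2) (𝓡 2) e.symm z) τ y'))).symm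
  simp_rw [key x (e x) v w hy hy']
  exact mdifferentiableAt_chartLift_comp he (by fun_prop) (by fun_prop) (e.map_source hx)

theorem mdifferentiableAt_velocity_family {Γ : ℝ → ℝ → M} {t s : ℝ}
    (hΓ : ContMDiffAt 𝓘(ℝ, ℝ × ℝ) (𝓡 2) 2 (fun z : ℝ × ℝ => Γ z.1 z.2) (t, s)) :
    MDifferentiableAt 𝓘(ℝ, ℝ) (𝓡 2).tangent (fun t => velocity (Γ t) s) t := by
  have he : chartAt Plane (Γ t s) ∈ IsManifold.maximalAtlas (𝓡 2) ∞ M :=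
    IsManifold.chart_mem_maximalAtlas _
  have hx := mem_chart_source Plane (Γ t s)
  set e := chartAt Plane (Γ t s)
  have hu : ContDiffAt ℝ 2 (fun z : ℝ × ℝ => e (Γ z.1 z.2)) (t, s) := by
    rw [← contMDiffAt_iff_contDiffAt]
    exact ContMDiffAt.comp (t, s) (((contMDiffOn_of_mem_maximalAtlas he).contMDiffAt
      (e.open_source.mem_nhds hx)).of_le (by norm_cast)) hΓ
  set u := fun z : ℝ × ℝ => e (Γ z.1 z.2) with hu_def
  have hsrc : ∀ᶠ z in 𝓝 (t, s), Γ z.1 z.2 ∈ e.source :=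
    hΓ.continuousAt.eventually (e.open_source.mem_nhds hx)
  have h1 : (fun t => velocity (Γ t) s) =ᶠ[𝓝 t]
      fun t => chartLift e (u (t, s), fderiv ℝ u (t, s) (0, 1)) := by
    refine eventually_fst_of_eventually (p := fun z => velocity (Γ z.1) z.2 =
      chartLift e (u z, fderiv ℝ u z (0, 1))) ?_
    filter_upwards [hsrc.eventually_nhds, hu.eventually (by simp)] with z h1 h2
    refine (velocity_eq_of_eventuallyEq he (h2.differentiableAt (by simp))
      (e.map_source h1.self_of_nhds) ?_).1
    filter_upwards [h1] with z' hz'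
    exact (e.left_inv hz').symm
  refine MDifferentiableAt.congr_of_eventuallyEq ?_ h1
  have h4 := hasDerivAt_fst_of_hasFDerivAt
        ((hu.fderiv_right (m := 1) (by norm_num)).differentiableAt (by simp)).hasFDerivAt
  exact mdifferentiableAt_chartLift_comp he
    (hasDerivAt_fst_of_hasFDerivAt (hu.differentiableAt (by simp)).hasFDerivAt).differentiableAt
    (h4.clm_apply (hasDerivAt_const t ((0 : ℝ), (1 : ℝ)))).differentiableAt (e.map_source hx)

theorem differentiableAt_comp_tangentBundle {g : TangentBundle (𝓡 2) M → ℝ}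
    {X : ℝ → TangentBundle (𝓡 2) M} {t : ℝ}
    (hg : MDifferentiableAt (𝓡 2).tangent 𝓘(ℝ, ℝ) g (X t))
    (hX : MDifferentiableAt 𝓘(ℝ, ℝ) (𝓡 2).tangent X t) :
    DifferentiableAt ℝ (fun t => g (X t)) t :=
  (hg.comp t hX).differentiableAt

end ChartLift

/-! ### Killing flows and their generators. -/

section KillingFlow

variable {M : Type*} [MetricSpace M] [ChartedSpace Plane M]
  [RiemannianBundle (fun x : M => TangentSpace (𝓡 2) x)]

/-- `φ` is a smooth one-parameter group of isometries, generated by the vector field `A`. -/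
structure IsKillingFlow (φ : ℝ → M → M) (A : ∀ x : M, TangentSpace (𝓡 2) x) : Prop where
  contMDiff : ContMDiff (𝓘(ℝ, ℝ).prod (𝓡 2)) (𝓡 2) ∞ (fun z : ℝ × M => φ z.1 z.2)
  zero : ∀ x, φ 0 x = x
  add : ∀ s t x, φ (s + t) x = φ s (φ t x)
  generator : ∀ s x, mfderiv 𝓘(ℝ, ℝ) (𝓡 2) (fun s => φ s x) s (1 : ℝ) = A (φ s x)
  norm_map : ∀ s x (v : TangentSpace (𝓡 2) x), ‖mfderiv (𝓡 2) (𝓡 2) (φ s) x v‖ = ‖v‖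

namespace IsKillingFlow

variable {φ : ℝ → M → M} {A : ∀ x : M, TangentSpace (𝓡 2) x}

theorem inner_map (h : IsKillingFlow φ A) (s : ℝ) (x : M) (v w : TangentSpace (𝓡 2) x) :
    inner ℝ (mfderiv (𝓡 2) (𝓡 2) (φ s) x v) (mfderiv (𝓡 2) (𝓡 2) (φ s) x w) = inner ℝ v w := by
  rw [real_inner_eq_norm_add_mul_self_sub_norm_mul_self_sub_norm_mul_self_div_two,
    real_inner_eq_norm_add_mul_self_sub_norm_mul_self_sub_norm_mul_self_div_two, ← map_add,
    h.norm_map, h.norm_map, h.norm_map]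

theorem neg_apply (h : IsKillingFlow φ A) (s : ℝ) (x : M) : φ (-s) (φ s x) = x := by
  rw [← h.add, neg_add_cancel, h.zero]

theorem apply_neg (h : IsKillingFlow φ A) (s : ℝ) (x : M) : φ s (φ (-s) x) = x := by
  rw [← h.add, add_neg_cancel, h.zero]

/-- The chain rule for a flow whose time varies along the curve. It gives both the velocity of a
navigated curve and, with the variation parameter as the variable, the variation field of a
navigated family. -/
theorem velocity_comp (h : IsKillingFlow φ A) {a : ℝ → ℝ} {β : ℝ → M} {a' s : ℝ} (ha : HasDerivAt a a' s)
    (hβ : MDifferentiableAt 𝓘(ℝ, ℝ) (𝓡 2) β s) :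
    velocity (fun σ => φ (a σ) (β σ)) s = ⟨φ (a s) (β s),
      mfderiv (𝓡 2) (𝓡 2) (φ (a s)) (β s) (velocity β s).2 + a' • A (φ (a s) (β s))⟩ := by
  have hφ : MDifferentiableAt (𝓘(ℝ, ℝ).prod (𝓡 2)) (𝓡 2) (fun z : ℝ × M => φ z.1 z.2)
    (a s, β s) := h.contMDiff.mdifferentiableAt (by simp)
  have h1 := ha.hasFDerivAt.hasMFDerivAt.prodMk hβ.hasMFDerivAt
  have h2 := (HasMFDerivAt.comp s hφ.hasMFDerivAt h1).mfderiv
  refine tangentBundle_mk_congr rfl ?_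
  refine (congrArg (fun T : ℝ →L[ℝ] Plane => T 1) h2).trans ?_
  refine (mfderiv_prod_eq_add_apply hφ).trans ?_
  rw [add_comm]
  have h3 : mfderiv 𝓘(ℝ, ℝ) (𝓡 2) (fun z => φ z (β s)) (a s) a' = a' • A (φ (a s) (β s)) := by
    rw [← h.generator]
    refine Eq.trans ?_ (map_smul (mfderiv 𝓘(ℝ, ℝ) (𝓡 2) (fun z => φ z (β s)) (a s)) a' (1 : ℝ))
    exact congrArg (mfderiv 𝓘(ℝ, ℝ) (𝓡 2) (fun z => φ z (β s)) (a s)) (mul_one a').symm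
  refine congrArg₂ (fun v w : Plane => v + w) rfl ?_
  refine Eq.trans ?_ h3
  refine congrArg (mfderiv 𝓘(ℝ, ℝ) (𝓡 2) (fun z => φ z (β s)) (a s)) ?_
  exact one_smul ℝ a'

theorem velocity_apply (h : IsKillingFlow φ A) (s : ℝ) {β : ℝ → M} {t : ℝ} (hβ : MDifferentiableAt 𝓘(ℝ, ℝ) (𝓡 2) β t) :
    velocity (fun σ => φ s (β σ)) t =
      ⟨φ s (β t), mfderiv (𝓡 2) (𝓡 2) (φ s) (β t) (velocity β t).2⟩ := by
  rw [h.velocity_comp (hasDerivAt_const t s) hβ, zero_smul, add_zero]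

theorem velocity_orbit (h : IsKillingFlow φ A) (x : M) (s : ℝ) : velocity (fun s => φ s x) s = ⟨φ s x, A (φ s x)⟩ :=
  tangentBundle_mk_congr rfl (h.generator s x)

/-- Differentiate `φ s (φ t x) = φ t (φ s x)` in `t` at `0`. -/
theorem map_field (h : IsKillingFlow φ A) (s : ℝ) (x : M) : mfderiv (𝓡 2) (𝓡 2) (φ s) x (A x) = A (φ s x) := by
  have h1 := h.velocity_apply s (β := fun t => φ t x) (t := 0)
    (h.contMDiff.comp (contMDiff_id.prodMk contMDiff_const) |>.mdifferentiableAt (by simp))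
  have h2 : (fun σ => φ s (φ σ x)) = fun σ => φ σ (φ s x) := by
    funext σ; rw [← h.add, add_comm, h.add]
  rw [h2, h.velocity_orbit, h.velocity_orbit, h.zero, h.zero] at h1
  exact (TotalSpace.mk_injective _ h1).symm

/-- The generator is the tangent map of the flow applied to the smooth field `(∂/∂s, 0)` along `{0}
× M`. -/
theorem contMDiff_field [IsManifold (𝓡 2) ∞ M] (h : IsKillingFlow φ A) :
    ContMDiff (𝓡 2) (𝓡 2).tangent ∞ (fun x : M => (⟨x, A x⟩ : TangentBundle (𝓡 2) M)) := by
  have h1 := h.contMDiff.contMDiff_tangentMap (m := ∞) (by simp)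
  have h2 : ContMDiff (𝓡 2) 𝓘(ℝ, ℝ).tangent ∞
      (fun _ : M => (⟨0, (1 : ℝ)⟩ : TangentBundle 𝓘(ℝ, ℝ) ℝ)) := contMDiff_const
  have h3 : ContMDiff (𝓡 2) (𝓡 2).tangent ∞
      (fun x : M => (⟨x, 0⟩ : TangentBundle (𝓡 2) M)) :=
    Bundle.contMDiff_zeroSection ℝ (TangentSpace (𝓡 2))
  have h4 := h1.comp (contMDiff_equivTangentBundleProd_symm.comp (h2.prodMk h3))
  refine h4.congr fun x => ?_
  refine tangentBundle_mk_congr (h.zero x).symm ?_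
  have hφ : MDifferentiableAt (𝓘(ℝ, ℝ).prod (𝓡 2)) (𝓡 2) (fun z : ℝ × M => φ z.1 z.2)
    (0, x) := h.contMDiff.mdifferentiableAt (by simp)
  refine Eq.trans ?_ (mfderiv_prod_eq_add_apply (v := ((1 : ℝ), (0 : Plane))) hφ).symm
  refine Eq.trans ?_ (congrArg₂ (fun v w : Plane => v + w) (h.generator 0 x).symm
    (map_zero (mfderiv (𝓡 2) (𝓡 2) (φ 0) x)).symm)
  refine Eq.trans ?_ (add_zero _).symm
  exact congrArg (fun y => (A y : Plane)) (h.zero x).symm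

end IsKillingFlow

end KillingFlow

/-! ### The Randers energy compared with the energy relative to the wind. -/

section Navigation

variable {M : Type*} [MetricSpace M] [ChartedSpace Plane M]
  [RiemannianBundle (fun x : M => TangentSpace (𝓡 2) x)]

/-- The momentum along `A` of the velocity relative to the wind `b A`. -/
def windMomentum (A : ∀ x : M, TangentSpace (𝓡 2) x) (b : ℝ) (X : TangentBundle (𝓡 2) M) : ℝ :=
  inner ℝ (A X.1) (X.2 - b • A X.1)

theorem fiberDeriv_windEnergy (A : ∀ x : M, TangentSpace (𝓡 2) x) (b : ℝ) {x : M}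
    (v w : TangentSpace (𝓡 2) x) :
    fiberDeriv (windEnergy A b) v w = inner ℝ (v - b • A x) w := by
  have h1 : ∀ τ : ℝ, windEnergy A b ⟨x, v + τ • w⟩ =
      ‖v - b • A x‖ ^ 2 / 2 + τ * inner ℝ (v - b • A x) w + τ ^ 2 * (‖w‖ ^ 2 / 2) := by
    intro τ
    simp only [windEnergy]
    rw [show v + τ • w - b • A x = (v - b • A x) + τ • w by abel, norm_add_sq_real,
      inner_smul_right, norm_smul, mul_pow, Real.norm_eq_abs, sq_abs]
    ring
  unfold fiberDeriv
  simp_rw [h1]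
  have h2 := ((((hasDerivAt_id (0 : ℝ)).mul_const (inner ℝ (v - b • A x) w)).const_add
    (‖v - b • A x‖ ^ 2 / 2)).add (((hasDerivAt_id (0 : ℝ)).pow 2).mul_const (‖w‖ ^ 2 / 2)))
  refine h2.deriv.trans ?_
  simp

/-- The relative velocity has length `c` and the wind is shorter than `1`, so Cauchy-Schwarz
applies. This is the denominator of the proportionality factor of the two energies. -/
theorem add_mul_windMomentum_pos {A : ∀ x : M, TangentSpace (𝓡 2) x} {μ : ℝ}
    (hμ : ∀ x, |μ| * ‖A x‖ < 1) {c : ℝ} (hc : 0 < c) {X : TangentBundle (𝓡 2) M}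
    (hX : randersSpeed A μ X = c) : 0 < c + μ * windMomentum A (c * μ) X := by
  have hW : ‖μ • A X.1‖ < 1 := by simpa [norm_smul] using hμ X.1
  have h1 := ((randersNorm_eq_iff hW _ _).1 hX).2
  have h2 := (abs_le.1 (abs_real_inner_le_norm (μ • A X.1) (X.2 - c • μ • A X.1))).1
  rw [h1, inner_smul_left, smul_smul] at h2
  simp only [RCLike.conj_to_real] at h2
  unfold windMomentum
  nlinarith

/-- The added `c A` is absorbed by the change of wind, since `dφ` is isometric and preserves `A`. -/
theorem windEnergy_flow {A : ∀ x : M, TangentSpace (𝓡 2) x} {φ : ℝ → M → M} (h : IsKillingFlow φ A) (b c s : ℝ) (X : TangentBundle (𝓡 2) M) :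
    windEnergy A (b + c) ⟨φ s X.1, mfderiv (𝓡 2) (𝓡 2) (φ s) X.1 X.2 + c • A (φ s X.1)⟩ =
      windEnergy A b X := by
  simp only [windEnergy]
  rw [← h.norm_map s X.1 (X.2 - b • A X.1), map_sub, map_smul, h.map_field, add_smul]
  congr 3
  abel

variable [IsManifold (𝓡 2) ∞ M]

variable [IsContMDiffRiemannianBundle (𝓡 2) ∞ Plane (fun x : M => TangentSpace (𝓡 2) x)]
  {A : ∀ x : M, TangentSpace (𝓡 2) x} {φ : ℝ → M → M} {μ : ℝ}

/-- On the indicatrix of radius `c` the differentials of the Randers energy and of the energy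
relative to the wind are proportional. -/
theorem deriv_randersEnergy_comp (hμ : ∀ x, |μ| * ‖A x‖ < 1)
    (hA : ContMDiff (𝓡 2) (𝓡 2).tangent ∞ (fun x : M => (⟨x, A x⟩ : TangentBundle (𝓡 2) M)))
    {c : ℝ} (hc : 0 < c) {X : ℝ → TangentBundle (𝓡 2) M} {t : ℝ}
    (hX : MDifferentiableAt 𝓘(ℝ, ℝ) (𝓡 2).tangent X t)
    (hXc : randersSpeed A μ (X t) = c) :
    deriv (fun t => randersEnergy A μ (X t)) t =
      c / (c + μ * windMomentum A (c * μ) (X t)) * deriv (fun t => windEnergy A (c * μ) (X t)) t := by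
  have hW : ∀ x, ‖μ • A x‖ < 1 := fun x => by simpa [norm_smul] using hμ x
  have hk := add_mul_windMomentum_pos hμ hc hXc
  have hne : (X t).2 ≠ 0 :=
    (randersNorm_pos_iff (W := fun x => μ • A x) (hW (X t).1)).1 (hc.trans_eq hXc.symm)
  have hf : DifferentiableAt ℝ (fun t => randersSpeed A μ (X t)) t :=
    differentiableAt_comp_tangentBundle
      ((contMDiffAt_randersSpeed hμ hA hne).mdifferentiableAt (by simp)) hX
  have hN : DifferentiableAt ℝ (fun t => ‖(X t).2‖ ^ 2) t :=
    differentiableAt_comp_tangentBundle (contMDiff_norm_sq.mdifferentiableAt (by simp)) hX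
  have hB : DifferentiableAt ℝ (fun t => inner ℝ (A (X t).1) (X t).2) t :=
    differentiableAt_comp_tangentBundle ((contMDiff_inner_field hA).mdifferentiableAt (by simp)) hX
  have hw : DifferentiableAt ℝ (fun t => ‖A (X t).1‖ ^ 2) t :=
    differentiableAt_comp_tangentBundle ((contMDiff_norm_sq_field hA).mdifferentiableAt (by simp)) hX
  -- The equation of the indicatrix, `‖y - F μ A‖² = F²`, expanded. Differentiating it at `F = c`
  -- gives `(c + μ m) F'` as the derivative of the relative energy, while that of `F² / 2` is `c
  -- F'`.
  have hrel : ∀ t, ‖(X t).2‖ ^ 2 - 2 * randersSpeed A μ (X t) *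
        (μ * inner ℝ (A (X t).1) (X t).2) +
      randersSpeed A μ (X t) ^ 2 * (μ ^ 2 * ‖A (X t).1‖ ^ 2) =
      randersSpeed A μ (X t) ^ 2 := by
    intro t
    have := congrArg (· ^ 2) (norm_sub_randersNorm_smul (W := fun x => μ • A x) (hW (X t).1) (X t).2)
    simp only [norm_sub_smul_sq, inner_smul_left, norm_smul, mul_pow, Real.norm_eq_abs, sq_abs,
      RCLike.conj_to_real] at this
    exact this
  have hE : ∀ t, windEnergy A (c * μ) (X t) = (‖(X t).2‖ ^ 2 -
      2 * (c * μ) * inner ℝ (A (X t).1) (X t).2 + (c * μ) ^ 2 * ‖A (X t).1‖ ^ 2) / 2 := fun t => by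
    simp only [windEnergy, norm_sub_smul_sq]
  have hm : windMomentum A (c * μ) (X t) =
      inner ℝ (A (X t).1) (X t).2 - c * μ * ‖A (X t).1‖ ^ 2 := by
    simp only [windMomentum, inner_sub_right, inner_smul_right, real_inner_self_eq_norm_sq]
  simp_rw [hE]
  simp only [randersEnergy]
  rw [hm] at hk ⊢
  set f := fun t => randersSpeed A μ (X t)
  set N := fun t => ‖(X t).2‖ ^ 2
  set B := fun t => inner ℝ (A (X t).1) (X t).2
  set w := fun t => ‖A (X t).1‖ ^ 2
  change f t = c at hXc
  change 0 < c + μ * (B t - c * μ * w t) at hk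
  have hf' := hf.hasDerivAt
  have hN' := hN.hasDerivAt
  have hB' := hB.hasDerivAt
  have hw' := hw.hasDerivAt
  have h1 := (hf'.pow 2).div_const 2
  have h2 := ((hN'.sub (hB'.const_mul (2 * (c * μ)))).add (hw'.const_mul ((c * μ) ^ 2))).div_const 2
  have h3 := ((hN'.sub ((hf'.const_mul 2).mul (hB'.const_mul μ))).add
    ((hf'.pow 2).mul (hw'.const_mul (μ ^ 2)))).unique
      ((hf'.pow 2).congr_of_eventuallyEq (.of_forall hrel))
  have e1 := h1.deriv
  have e2 := h2.deriv
  simp only [hXc] at h3 e1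
  change deriv (fun t => f t ^ 2 / 2) t = c / (c + μ * (B t - c * μ * w t)) *
    deriv (fun t => (N t - 2 * (c * μ) * B t + (c * μ) ^ 2 * w t) / 2) t
  refine e1.trans ?_
  refine Eq.trans ?_ (congrArg (c / (c + μ * (B t - c * μ * w t)) * ·) e2.symm)
  rw [div_mul_eq_mul_div, eq_div_iff hk.ne']
  simp at h3 ⊢
  simp only [hXc] at h3 ⊢
  linear_combination (-c / 2) * h3

theorem fiberDeriv_randersEnergy (hμ : ∀ x, |μ| * ‖A x‖ < 1)
    (hA : ContMDiff (𝓡 2) (𝓡 2).tangent ∞ (fun x : M => (⟨x, A x⟩ : TangentBundle (𝓡 2) M)))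
    {c : ℝ} (hc : 0 < c) {x : M} {v : TangentSpace (𝓡 2) x} (w : TangentSpace (𝓡 2) x)
    (hv : randersSpeed A μ ⟨x, v⟩ = c) :
    fiberDeriv (randersEnergy A μ) v w =
      c / (c + μ * windMomentum A (c * μ) ⟨x, v⟩) * inner ℝ (v - (c * μ) • A x) w := by
  have h1 := deriv_randersEnergy_comp hμ hA hc (mdifferentiableAt_fiberLine v w)
    (by simpa using hv)
  rw [← fiberDeriv_windEnergy]
  simpa only [fiberDeriv, zero_smul, add_zero] using h1

/-- Along a curve of speed `c` and constant momentum, the Randers energy and the energy relative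
to the wind have the same Euler-Lagrange equation. -/
theorem isStationaryAt_randersEnergy_iff (hμ : ∀ x, |μ| * ‖A x‖ < 1)
    (hA : ContMDiff (𝓡 2) (𝓡 2).tangent ∞ (fun x : M => (⟨x, A x⟩ : TangentBundle (𝓡 2) M)))
    {c : ℝ} (hc : 0 < c) {γ : ℝ → M} {s n : ℝ}
    (hγc : ∀ᶠ σ in 𝓝 s, randersSpeed A μ (velocity γ σ) = c)
    (hγn : ∀ᶠ σ in 𝓝 s, windMomentum A (c * μ) (velocity γ σ) = n) :
    IsStationaryAt (randersEnergy A μ) γ s ↔ IsStationaryAt (windEnergy A (c * μ)) γ s := by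
  have hs := add_mul_windMomentum_pos hμ hc (X := velocity γ s) hγc.self_of_nhds
  rw [hγn.self_of_nhds] at hs
  refine forall_congr' fun Γ => forall_congr' fun hΓ => forall_congr' fun h0 => ?_
  have hvel : ∀ᶠ σ in 𝓝 s, velocity (Γ 0) σ = velocity γ σ :=
    h0.eventually_nhds.mono fun σ hσ => velocity_congr hσ
  have hc0 : ∀ᶠ σ in 𝓝 s, randersSpeed A μ (velocity (Γ 0) σ) = c := by
    filter_upwards [hvel, hγc] with σ h1 h2
    rw [h1, h2]
  have hfun : (fun σ => fiberDeriv (randersEnergy A μ) (velocity (Γ 0) σ).2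
      (velocity (fun t => Γ t σ) 0).2) =ᶠ[𝓝 s] fun σ => c / (c + μ * n) *
        fiberDeriv (windEnergy A (c * μ)) (velocity (Γ 0) σ).2 (velocity (fun t => Γ t σ) 0).2 := by
    filter_upwards [hc0, hγn, hvel] with σ h1 h2 h3
    rw [fiberDeriv_windEnergy, fiberDeriv_randersEnergy hμ hA hc _ h1, ← h2, ← h3]
  have hder := deriv_randersEnergy_comp hμ hA hc (mdifferentiableAt_velocity_family hΓ)
    hc0.self_of_nhds
  unfold EulerLagrangeVariation
  rw [hder, hvel.self_of_nhds, hγn.self_of_nhds, hfun.hasDerivAt_iff]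
  -- Both sides of one equation are those of the other times this constant, which is nonzero and can
  -- be divided out.
  have hk : c / (c + μ * n) ≠ 0 := (div_pos hc hs).ne'
  refine ⟨fun h => ?_, fun h => h.const_mul _⟩
  have h1 := h.const_mul (c / (c + μ * n))⁻¹
  simpa only [inv_mul_cancel_left₀ hk] using h1

end Navigation

/-! ### Slices and time shifts of families of curves. -/

section Slices

variable {M : Type*} [TopologicalSpace M] [ChartedSpace Plane M]

theorem mdifferentiableAt_slices {Γ : ℝ → ℝ → M} {t s : ℝ} {n : WithTop ℕ∞} (hn : n ≠ 0)
    (hΓ : ContMDiffAt 𝓘(ℝ, ℝ × ℝ) (𝓡 2) n (fun z : ℝ × ℝ => Γ z.1 z.2) (t, s)) :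
    MDifferentiableAt 𝓘(ℝ, ℝ) (𝓡 2) (Γ t) s ∧
      MDifferentiableAt 𝓘(ℝ, ℝ) (𝓡 2) (fun t => Γ t s) t := by
  have h := hΓ.mdifferentiableAt hn
  constructor
  · exact MDifferentiableAt.comp s (f := fun s : ℝ => (t, s)) h
      (show DifferentiableAt ℝ (fun s : ℝ => (t, s)) s by fun_prop).mdifferentiableAt
  · exact MDifferentiableAt.comp t (f := fun t : ℝ => (t, s)) h
      (show DifferentiableAt ℝ (fun t : ℝ => (t, s)) t by fun_prop).mdifferentiableAt

theorem velocity_comp_add_left {γ : ℝ → M} {t s : ℝ}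
    (h : MDifferentiableAt 𝓘(ℝ, ℝ) (𝓡 2) γ (t + s)) :
    velocity (fun σ => γ (t + σ)) s = velocity γ (t + s) := by
  have h1 := (HasMFDerivAt.comp s (f := fun σ : ℝ => t + σ) h.hasMFDerivAt
    ((hasDerivAt_id s).const_add t).hasFDerivAt.hasMFDerivAt).mfderiv
  refine tangentBundle_mk_congr rfl ((congrArg (fun T : ℝ →L[ℝ] Plane => T 1) h1).trans ?_)
  exact congrArg (mfderiv 𝓘(ℝ, ℝ) (𝓡 2) γ (t + s)) (one_smul ℝ (1 : ℝ))

theorem velocity_comp_add_right {γ : ℝ → M} {t s : ℝ}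
    (h : MDifferentiableAt 𝓘(ℝ, ℝ) (𝓡 2) γ (t + s)) :
    velocity (fun τ => γ (τ + s)) t = velocity γ (t + s) := by
  have h1 := (HasMFDerivAt.comp t (f := fun τ : ℝ => τ + s) h.hasMFDerivAt
    ((hasDerivAt_id t).add_const s).hasFDerivAt.hasMFDerivAt).mfderiv
  refine tangentBundle_mk_congr rfl ((congrArg (fun T : ℝ →L[ℝ] Plane => T 1) h1).trans ?_)
  exact congrArg (mfderiv 𝓘(ℝ, ℝ) (𝓡 2) γ (t + s)) (one_smul ℝ (1 : ℝ))

theorem contMDiffAt_comp_add {γ : ℝ → M} {t s : ℝ} {n : WithTop ℕ∞}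
    (h : ContMDiffAt 𝓘(ℝ, ℝ) (𝓡 2) n γ (t + s)) :
    ContMDiffAt 𝓘(ℝ, ℝ × ℝ) (𝓡 2) n (fun z : ℝ × ℝ => γ (z.1 + z.2)) (t, s) :=
  ContMDiffAt.comp (t, s) (f := fun z : ℝ × ℝ => z.1 + z.2) h
    (show ContDiffAt ℝ n (fun z : ℝ × ℝ => z.1 + z.2) (t, s) by fun_prop).contMDiffAt

theorem _root_.ContMDiffAt.eventually_nhds {E : Type*} [NormedAddCommGroup E] [NormedSpace ℝ E]
    {f : E → M} {z : E} {n : WithTop ℕ∞} [IsManifold (𝓡 2) n M] (hn : n ≠ ∞)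
    (h : ContMDiffAt 𝓘(ℝ, E) (𝓡 2) n f z) :
    ∀ᶠ z in 𝓝 z, ContMDiffAt 𝓘(ℝ, E) (𝓡 2) n f z :=
  contMDiffAt_iff_contMDiffAt_nhds hn |>.1 h

variable [IsManifold (𝓡 2) ∞ M]

theorem mdifferentiableAt_velocity {γ : ℝ → M} {s : ℝ} (h : ContMDiffAt 𝓘(ℝ, ℝ) (𝓡 2) 2 γ s) :
    MDifferentiableAt 𝓘(ℝ, ℝ) (𝓡 2).tangent (velocity γ) s := by
  have h1 := mdifferentiableAt_velocity_family (Γ := fun t σ => γ (t + σ)) (t := s) (s := 0)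
    (contMDiffAt_comp_add (by simpa using h))
  refine h1.congr_of_eventuallyEq ?_
  filter_upwards [h.eventually_nhds (by simp)] with t ht
  have := velocity_comp_add_left (γ := γ) (t := t) (s := 0)
    (by simpa using ht.mdifferentiableAt (by simp))
  rw [add_zero] at this
  exact this.symm

end Slices

/-! ### Stationary curves under the flow. -/

section Stationary

variable {M : Type*} [MetricSpace M] [ChartedSpace Plane M]
  [RiemannianBundle (fun x : M => TangentSpace (𝓡 2) x)]
  {A : ∀ x : M, TangentSpace (𝓡 2) x} {φ : ℝ → M → M} {μ : ℝ}

theorem norm_smul_lt_one (hμ : ∀ x, |μ| * ‖A x‖ < 1) (x : M) : ‖μ • A x‖ < 1 := by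
  simpa [norm_smul] using hμ x

theorem randersSpeed_nonneg (hμ : ∀ x, |μ| * ‖A x‖ < 1) (X : TangentBundle (𝓡 2) M) :
    0 ≤ randersSpeed A μ X :=
  randersNorm_nonneg (W := fun x => μ • A x) (norm_smul_lt_one hμ X.1) _

theorem randersSpeed_pos_iff (hμ : ∀ x, |μ| * ‖A x‖ < 1) {X : TangentBundle (𝓡 2) M} :
    0 < randersSpeed A μ X ↔ X.2 ≠ 0 :=
  randersNorm_pos_iff (W := fun x => μ • A x) (norm_smul_lt_one hμ X.1)

theorem randersSpeed_eq_iff (hμ : ∀ x, |μ| * ‖A x‖ < 1) {X : TangentBundle (𝓡 2) M} {f : ℝ} :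
    randersSpeed A μ X = f ↔ 0 ≤ f ∧ ‖X.2 - (f * μ) • A X.1‖ = f := by
  rw [mul_smul]
  exact randersNorm_eq_iff (W := fun x => μ • A x) (norm_smul_lt_one hμ X.1) _ _

/-- Navigation: adding the wind `ν A` to the vectors of the indicatrix of radius `c`. -/
theorem randersSpeed_flow (h : IsKillingFlow φ A) (hμ : ∀ x, |μ| * ‖A x‖ < 1) {ν c : ℝ}
    (hμν : ∀ x, |μ + ν| * ‖A x‖ < 1) (s : ℝ) {X : TangentBundle (𝓡 2) M}
    (hX : randersSpeed A μ X = c) :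
    randersSpeed A (μ + ν) ⟨φ s X.1,
      mfderiv (𝓡 2) (𝓡 2) (φ s) X.1 X.2 + (c * ν) • A (φ s X.1)⟩ = c := by
  rw [randersSpeed_eq_iff hμ] at hX
  rw [randersSpeed_eq_iff hμν]
  refine ⟨hX.1, Eq.trans ?_ hX.2⟩
  rw [← h.norm_map s X.1 (X.2 - (c * μ) • A X.1), map_sub, map_smul, h.map_field, mul_add, add_smul]
  congr 1
  module

theorem contMDiffAt_flow (h : IsKillingFlow φ A) {E : Type*} [NormedAddCommGroup E]
    [NormedSpace ℝ E] {n : WithTop ℕ∞} (hn : n ≤ ∞) {a : E → ℝ} {β : E → M} {S : Set E} {z : E}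
    (ha : ContMDiffWithinAt 𝓘(ℝ, E) 𝓘(ℝ, ℝ) n a S z)
    (hβ : ContMDiffWithinAt 𝓘(ℝ, E) (𝓡 2) n β S z) :
    ContMDiffWithinAt 𝓘(ℝ, E) (𝓡 2) n (fun z => φ (a z) (β z)) S z :=
  ContMDiffAt.comp_contMDiffWithinAt z (f := fun z => (a z, β z))
    ((h.contMDiff.of_le hn).contMDiffAt) (ha.prodMk hβ)

/-- The map `φ (c σ)` acts bijectively on test families and changes neither the relative energy nor
the momentum pairing, since these are built from `h` and `A`, which it preserves. -/
theorem isStationaryAt_windEnergy_flow [IsManifold (𝓡 2) ∞ M] (h : IsKillingFlow φ A) {b c s : ℝ} {γ : ℝ → M}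
    (hγ : IsStationaryAt (windEnergy A b) γ s) :
    IsStationaryAt (windEnergy A (b + c)) (fun σ => φ (c * σ) (γ σ)) s := by
  have key : ∀ Γ : ℝ → ℝ → M,
      ContMDiffAt 𝓘(ℝ, ℝ × ℝ) (𝓡 2) 2 (fun z : ℝ × ℝ => Γ z.1 z.2) (0, s) →
      EulerLagrangeVariation (windEnergy A b) Γ s →
      EulerLagrangeVariation (windEnergy A (b + c)) (fun t σ => φ (c * σ) (Γ t σ)) s := by
    intro Γ hΓ hEL
    have hd : ∀ᶠ z in 𝓝 ((0 : ℝ), s), MDifferentiableAt 𝓘(ℝ, ℝ) (𝓡 2) (Γ z.1) z.2 ∧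
        MDifferentiableAt 𝓘(ℝ, ℝ) (𝓡 2) (fun t => Γ t z.2) z.1 :=
      (hΓ.eventually_nhds (by simp)).mono fun z hz => mdifferentiableAt_slices (by simp) hz
    have hv : ∀ t σ, MDifferentiableAt 𝓘(ℝ, ℝ) (𝓡 2) (Γ t) σ →
        velocity (fun σ => φ (c * σ) (Γ t σ)) σ = ⟨φ (c * σ) (Γ t σ),
          mfderiv (𝓡 2) (𝓡 2) (φ (c * σ)) (Γ t σ) (velocity (Γ t) σ).2 +
            c • A (φ (c * σ) (Γ t σ))⟩ := fun t σ ht =>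
      h.velocity_comp (a := fun σ => c * σ) (by simpa using (hasDerivAt_id σ).const_mul c) ht
    have hder : deriv (fun t => windEnergy A (b + c) (velocity (fun σ => φ (c * σ) (Γ t σ)) s)) 0 =
        deriv (fun t => windEnergy A b (velocity (Γ t) s)) 0 := by
      refine EventuallyEq.deriv_eq ?_
      filter_upwards [eventually_fst_of_eventually hd] with t ht
      rw [hv t s ht.1]
      exact windEnergy_flow h b c (c * s) (velocity (Γ t) s)
    unfold EulerLagrangeVariation
    rw [hder]
    refine HasDerivAt.congr_of_eventuallyEq hEL ?_
    filter_upwards [eventually_snd_of_eventually hd] with σ hσ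
    have e1 := TotalSpace.mk_injective _ (hv 0 σ hσ.1)
    have e2 := TotalSpace.mk_injective _ (h.velocity_apply (c * σ) hσ.2)
    refine (fiberDeriv_windEnergy A (b + c) (x := φ (c * σ) (Γ 0 σ)) _ _).trans ?_
    refine Eq.trans ?_ (fiberDeriv_windEnergy A b (x := Γ 0 σ) _ _).symm
    rw [e1, e2, ← h.inner_map (c * σ) (Γ 0 σ) ((velocity (Γ 0) σ).2 - b • A (Γ 0 σ)), map_sub, map_smul, h.map_field, add_smul]
    refine congrArg₂ (inner ℝ) ?_ rfl
    module
  intro Γ hΓ h0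
  have hs : ContMDiffAt 𝓘(ℝ, ℝ × ℝ) (𝓡 2) 2
      (fun z : ℝ × ℝ => φ (-(c * z.2)) (Γ z.1 z.2)) (0, s) :=
    contMDiffAt_flow h (by norm_cast) (S := univ) (a := fun z : ℝ × ℝ => -(c * z.2))
      (show ContDiffAt ℝ 2 (fun z : ℝ × ℝ => -(c * z.2)) (0, s) by fun_prop).contMDiffAt hΓ
  -- An arbitrary test family around the new curve is pulled back to one around `γ`, where the
  -- hypothesis can be used.
  have h1 := key (fun t σ => φ (-(c * σ)) (Γ t σ)) hs (hγ _ hs ?_)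
  · simpa only [h.apply_neg] using h1
  · filter_upwards [h0] with σ hσ
    rw [hσ, h.neg_apply]

end Stationary

/-! ### Conservation of energy and of momentum. -/

section Conservation

variable {M : Type*} [MetricSpace M] [ChartedSpace Plane M] [IsManifold (𝓡 2) ∞ M]
  [RiemannianBundle (fun x : M => TangentSpace (𝓡 2) x)]
  {A : ∀ x : M, TangentSpace (𝓡 2) x} {φ : ℝ → M → M} {μ : ℝ}

/-- Conservation of energy at a time of non-zero velocity. -/
theorem hasDerivAt_randersEnergy_velocity (hμ : ∀ x, |μ| * ‖A x‖ < 1) {s : ℝ} {γ : ℝ → M}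
    (hγ : ContMDiffAt 𝓘(ℝ, ℝ) (𝓡 2) 2 γ s) (hst : IsStationaryAt (randersEnergy A μ) γ s) :
    HasDerivAt (fun σ => randersEnergy A μ (velocity γ σ)) 0 s := by
  have hγ0 : ContMDiffAt 𝓘(ℝ, ℝ) (𝓡 2) 2 γ (0 + s) := by simpa using hγ
  -- The test family is time translation, with variation field `γ'`. By Euler's identity the pairing
  -- is twice the energy `E`, so the equation reads `(2 E)' = E'` and forces `E' = 0`.
  have h1 := hst (fun t σ => γ (t + σ)) (contMDiffAt_comp_add hγ0) (.of_forall fun σ => by simp)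
  have hd : ∀ᶠ σ in 𝓝 s, MDifferentiableAt 𝓘(ℝ, ℝ) (𝓡 2) γ σ :=
    (hγ.eventually_nhds (by simp)).mono fun σ hσ => hσ.mdifferentiableAt (by simp)
  have hder : deriv (fun t => randersEnergy A μ (velocity (fun σ => γ (t + σ)) s)) 0 =
      deriv (fun σ => randersEnergy A μ (velocity γ σ)) s := by
    have : (fun t => randersEnergy A μ (velocity (fun σ => γ (t + σ)) s)) =ᶠ[𝓝 0]
        fun t => randersEnergy A μ (velocity γ (t + s)) := by
      have hcont : Tendsto (fun t : ℝ => t + s) (𝓝 0) (𝓝 s) := by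
        have : ContinuousAt (fun t : ℝ => t + s) 0 := by fun_prop
        simpa [ContinuousAt] using this
      filter_upwards [hcont.eventually hd] with t ht
      rw [velocity_comp_add_left ht]
    rw [this.deriv_eq, deriv_comp_add_const (f := fun σ => randersEnergy A μ (velocity γ σ)),
      zero_add]
  unfold EulerLagrangeVariation at h1
  rw [hder] at h1
  have h2 : HasDerivAt (fun σ => 2 * randersEnergy A μ (velocity γ σ))
      (deriv (fun σ => randersEnergy A μ (velocity γ σ)) s) s := by
    refine h1.congr_of_eventuallyEq ?_
    filter_upwards [hd] with σ hσ
    have hσ0 : MDifferentiableAt 𝓘(ℝ, ℝ) (𝓡 2) γ (0 + σ) := by simpa using hσ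
    have e1 := TotalSpace.mk_injective _ (velocity_comp_add_left hσ0)
    have e2 := TotalSpace.mk_injective _ (velocity_comp_add_right hσ0)
    have e3 : ∀ X : TangentBundle (𝓡 2) M,
        fiberDeriv (randersEnergy A μ) X.2 X.2 = 2 * randersEnergy A μ X := by
      intro X
      have e4 : (fun τ : ℝ => randersEnergy A μ ⟨X.1, X.2 + τ • X.2⟩) =ᶠ[𝓝 0]
          fun τ => (1 + τ) ^ 2 * randersEnergy A μ X := by
        -- The Randers norm is only positively homogeneous, so `1 + τ` has to stay non-negative.
        filter_upwards [Ioi_mem_nhds (show (-1 : ℝ) < 0 by norm_num)] with τ hτ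
        have h3 := randersNorm_smul (W := fun x => μ • A x) (norm_smul_lt_one hμ X.1) X.2
          (r := 1 + τ) (by linarith [mem_Ioi.1 hτ])
        rw [add_smul, one_smul] at h3
        simp only [randersEnergy, randersSpeed, h3]
        ring
      rw [fiberDeriv, e4.deriv_eq]
      have h5 := ((((hasDerivAt_id (0 : ℝ)).const_add 1).pow 2).mul_const
        (randersEnergy A μ X)).deriv
      refine h5.trans ?_
      simp
    have e5 := e3 (velocity γ (0 + σ))
    have e6 : velocity γ (0 + σ) = velocity γ σ := by rw [zero_add]
    rw [← e6, ← e5]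
    refine (congrArg₂ (fun v w : TangentSpace (𝓡 2) (γ (0 + σ)) =>
      fiberDeriv (randersEnergy A μ) v w) e1 e2).symm
  have h3 := (h2.const_mul (1 / 2 : ℝ))
  simp only [one_div, inv_mul_cancel_left₀ (two_ne_zero' ℝ)] at h3
  have h4 := h3.deriv
  have h5 : deriv (fun σ => randersEnergy A μ (velocity γ σ)) s = 0 := by linarith
  rw [h5, mul_zero] at h3
  exact h3

variable [IsContMDiffRiemannianBundle (𝓡 2) ∞ Plane (fun x : M => TangentSpace (𝓡 2) x)]

/-- Noether's theorem for the flow of the wind. -/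
theorem hasDerivAt_windMomentum (h : IsKillingFlow φ A) (hμ : ∀ x, |μ| * ‖A x‖ < 1) {c s : ℝ}
    (hc : 0 < c) {γ : ℝ → M} (hγ : ContMDiffAt 𝓘(ℝ, ℝ) (𝓡 2) 2 γ s)
    (hγc : ∀ᶠ σ in 𝓝 s, randersSpeed A μ (velocity γ σ) = c)
    (hst : IsStationaryAt (randersEnergy A μ) γ s) :
    HasDerivAt (fun σ => c / (c + μ * windMomentum A (c * μ) (velocity γ σ)) *
      windMomentum A (c * μ) (velocity γ σ)) 0 s := by
  have h0 : (fun σ => φ 0 (γ σ)) = γ := funext fun σ => h.zero _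
  -- The test family moves the curve by the flow. Its variation field is `A`, and the energy is
  -- constant in `t` because `φ t` preserves `F`.
  have h1 := hst (fun t σ => φ t (γ σ)) ?_ (.of_eq h0)
  · have hder : deriv (fun t => randersEnergy A μ (velocity (fun σ => φ t (γ σ)) s)) 0 = 0 := by
      have : (fun t => randersEnergy A μ (velocity (fun σ => φ t (γ σ)) s)) =
          fun _ => randersEnergy A μ (velocity γ s) := by
        funext t
        have h2 := randersSpeed_flow h hμ (ν := 0) (by simpa using hμ) t
          (X := velocity γ s) rfl
        rw [mul_zero, zero_smul, add_zero, add_zero] at h2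
        rw [h.velocity_apply t (hγ.mdifferentiableAt (by simp)), randersEnergy, h2, randersEnergy]
      rw [this, deriv_const]
    unfold EulerLagrangeVariation at h1
    rw [hder] at h1
    refine h1.congr_of_eventuallyEq ?_
    filter_upwards [hγc] with σ hσ
    have e1 : randersSpeed A μ (velocity (fun σ => φ 0 (γ σ)) σ) = c := by rw [h0, hσ]
    have e2 := TotalSpace.mk_injective _ (h.velocity_orbit (γ σ) 0)
    refine Eq.trans ?_ (fiberDeriv_randersEnergy hμ h.contMDiff_field hc (x := φ 0 (γ σ))
      (v := (velocity (fun σ => φ 0 (γ σ)) σ).2) _ e1).symm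
    rw [e2, real_inner_comm]
    change _ = c / (c + μ * windMomentum A (c * μ) (velocity (fun σ => φ 0 (γ σ)) σ)) *
      windMomentum A (c * μ) (velocity (fun σ => φ 0 (γ σ)) σ)
    rw [h0]
  · exact contMDiffAt_flow h (by norm_cast) (S := univ) (a := Prod.fst) (β := fun z => γ z.2)
      contDiffAt_fst.contMDiffAt (ContMDiffAt.comp ((0 : ℝ), s) (f := Prod.snd) hγ
        contDiffAt_snd.contMDiffAt)

end Conservation

/-! ### Randers geodesics: constant speed, constant momentum, navigation. -/

section Geodesics

variable {M : Type*} [MetricSpace M] [ChartedSpace Plane M] [IsManifold (𝓡 2) ∞ M]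
  [RiemannianBundle (fun x : M => TangentSpace (𝓡 2) x)]
  [IsContMDiffRiemannianBundle (𝓡 2) ∞ Plane (fun x : M => TangentSpace (𝓡 2) x)]
  {A : ∀ x : M, TangentSpace (𝓡 2) x} {φ : ℝ → M → M} {μ : ℝ}

theorem mdifferentiableAt_randersSpeed (hμ : ∀ x, |μ| * ‖A x‖ < 1)
    (hA : ContMDiff (𝓡 2) (𝓡 2).tangent ∞ (fun x : M => (⟨x, A x⟩ : TangentBundle (𝓡 2) M)))
    {X : TangentBundle (𝓡 2) M} (hX : 0 < randersSpeed A μ X) :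
    MDifferentiableAt (𝓡 2).tangent 𝓘(ℝ, ℝ) (randersSpeed A μ) X :=
  (contMDiffAt_randersSpeed hμ hA ((randersSpeed_pos_iff hμ).1 hX)).mdifferentiableAt (by simp)

theorem mdifferentiableAt_randersEnergy (hμ : ∀ x, |μ| * ‖A x‖ < 1)
    (hA : ContMDiff (𝓡 2) (𝓡 2).tangent ∞ (fun x : M => (⟨x, A x⟩ : TangentBundle (𝓡 2) M)))
    {X : TangentBundle (𝓡 2) M} (hX : 0 < randersSpeed A μ X) :
    MDifferentiableAt (𝓡 2).tangent 𝓘(ℝ, ℝ) (randersEnergy A μ) X :=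
  MDifferentiableAt.comp X (g := fun r : ℝ => r ^ 2 / 2)
    (show DifferentiableAt ℝ (fun r : ℝ => r ^ 2 / 2) _ by fun_prop).mdifferentiableAt
    (mdifferentiableAt_randersSpeed hμ hA hX)

theorem eventually_randersSpeed_pos (hμ : ∀ x, |μ| * ‖A x‖ < 1)
    (hA : ContMDiff (𝓡 2) (𝓡 2).tangent ∞ (fun x : M => (⟨x, A x⟩ : TangentBundle (𝓡 2) M)))
    {γ : ℝ → M} {s : ℝ} (hγ : ContMDiffAt 𝓘(ℝ, ℝ) (𝓡 2) 2 γ s)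
    (hs : 0 < randersSpeed A μ (velocity γ s)) :
    ∀ᶠ σ in 𝓝 s, 0 < randersSpeed A μ (velocity γ σ) :=
  (differentiableAt_comp_tangentBundle (mdifferentiableAt_randersSpeed hμ hA hs)
    (mdifferentiableAt_velocity hγ)).continuousAt.eventually (lt_mem_nhds hs)

theorem eventually_differentiableAt_chartLift {e : OpenPartialHomeomorph M Plane}
    (he : e ∈ IsManifold.maximalAtlas (𝓡 2) ∞ M) (hμ : ∀ x, |μ| * ‖A x‖ < 1)
    (hA : ContMDiff (𝓡 2) (𝓡 2).tangent ∞ (fun x : M => (⟨x, A x⟩ : TangentBundle (𝓡 2) M)))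
    {γ : ℝ → M} {s : ℝ} (hγ : ContMDiffAt 𝓘(ℝ, ℝ) (𝓡 2) 2 γ s) (hes : γ s ∈ e.source)
    (hs : 0 < randersSpeed A μ (velocity γ s)) :
    ∀ᶠ σ in 𝓝 s, DifferentiableAt ℝ (fun z => randersEnergy A μ (chartLift e z))
      (e (γ σ), deriv (fun τ => e (γ τ)) σ) := by
  filter_upwards [eventually_randersSpeed_pos hμ hA hγ hs, hγ.eventually_nhds (by simp),
    hγ.continuousAt.eventually (e.open_source.mem_nhds hes)] with σ h1 h2 h3
  have hd : MDifferentiableAt 𝓘(ℝ, ℝ) (𝓡 2) (fun τ => e (γ τ)) σ :=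
    MDifferentiableAt.comp σ (((contMDiffOn_of_mem_maximalAtlas he).contMDiffAt
      (e.open_source.mem_nhds h3)).mdifferentiableAt (by simp)) (h2.mdifferentiableAt (by simp))
  have h4 := velocity_eq_chartLift he h2.continuousAt h3 hd.differentiableAt.hasDerivAt
  rw [h4] at h1
  exact (MDifferentiableAt.comp (e (γ σ), deriv (fun τ => e (γ τ)) σ)
    (mdifferentiableAt_randersEnergy hμ hA h1)
    (((contMDiffOn_chartLift he).contMDiffAt ((e.open_target.prod isOpen_univ).mem_nhds
      ⟨e.map_source h3, mem_univ _⟩)).mdifferentiableAt (by simp))).differentiableAt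

omit [RiemannianBundle (fun x : M => TangentSpace (𝓡 2) x)]
  [IsContMDiffRiemannianBundle (𝓡 2) ∞ Plane (fun x : M => TangentSpace (𝓡 2) x)] 
  [IsManifold (𝓡 2) ∞ M] in
theorem IsGeodesicOn.contMDiffAt {F : ∀ x : M, TangentSpace (𝓡 2) x → ℝ} {γ : ℝ → M} {S : Set ℝ}
    (hγ : IsGeodesicOn F γ S) {s : ℝ} (hs : s ∈ interior S) {n : WithTop ℕ∞} (hn : n ≤ ∞) :
    ContMDiffAt 𝓘(ℝ, ℝ) (𝓡 2) n γ s :=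
  (hγ.smooth.contMDiffAt (mem_interior_iff_mem_nhds.1 hs)).of_le hn

/-- This and `isGeodesicOn_of_isStationaryAt` pass between geodesics and the chart-free equation at
times of positive speed. -/
theorem IsGeodesicOn.isStationaryAt {γ : ℝ → M} {S : Set ℝ} {s : ℝ}
    (hγ : IsGeodesicOn (randersNorm (fun x => μ • A x)) γ S) (hμ : ∀ x, |μ| * ‖A x‖ < 1)
    (hA : ContMDiff (𝓡 2) (𝓡 2).tangent ∞ (fun x : M => (⟨x, A x⟩ : TangentBundle (𝓡 2) M)))
    (hs : s ∈ interior S) (hpos : 0 < randersSpeed A μ (velocity γ s)) :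
    IsStationaryAt (randersEnergy A μ) γ s := by
  have h2 := hγ.contMDiffAt hs (n := 2) (by norm_cast)
  have he : chartAt Plane (γ s) ∈ IsManifold.maximalAtlas (𝓡 2) ∞ M :=
    IsManifold.chart_mem_maximalAtlas _
  exact (euler_lagrange_iff_isStationaryAt he h2 (mem_chart_source Plane (γ s))
    (eventually_differentiableAt_chartLift he hμ hA h2 (mem_chart_source Plane (γ s)) hpos)).1
    (hγ.euler_lagrange _ he s hs (mem_chart_source Plane (γ s)))

theorem isGeodesicOn_of_isStationaryAt {γ : ℝ → M} {S : Set ℝ} (hμ : ∀ x, |μ| * ‖A x‖ < 1)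
    (hA : ContMDiff (𝓡 2) (𝓡 2).tangent ∞ (fun x : M => (⟨x, A x⟩ : TangentBundle (𝓡 2) M)))
    (hγ : ContMDiffOn 𝓘(ℝ, ℝ) (𝓡 2) ∞ γ S)
    (hpos : ∀ s ∈ interior S, 0 < randersSpeed A μ (velocity γ s))
    (hst : ∀ s ∈ interior S, IsStationaryAt (randersEnergy A μ) γ s) :
    IsGeodesicOn (randersNorm (fun x => μ • A x)) γ S := by
  refine ⟨hγ, fun e he s hs hes => ?_⟩
  have h2 : ContMDiffAt 𝓘(ℝ, ℝ) (𝓡 2) 2 γ s :=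
    (hγ.contMDiffAt (mem_interior_iff_mem_nhds.1 hs)).of_le (by norm_cast)
  exact (euler_lagrange_iff_isStationaryAt he h2 hes
    (eventually_differentiableAt_chartLift he hμ hA h2 hes (hpos s hs))).2 (hst s hs)

/-- Where the velocity vanishes `F` is not smooth, but `F² / 2` is squeezed between `0` and a
multiple of `‖γ'‖²`, which has a minimum there. With this case constancy of speed needs no
assumption that the speed is nonzero. -/
theorem hasDerivAt_randersEnergy_velocity_of_eq_zero (hμ : ∀ x, |μ| * ‖A x‖ < 1)
    (hA : ContMDiff (𝓡 2) (𝓡 2).tangent ∞ (fun x : M => (⟨x, A x⟩ : TangentBundle (𝓡 2) M)))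
    {γ : ℝ → M} {s : ℝ} (hγ : ContMDiffAt 𝓘(ℝ, ℝ) (𝓡 2) 2 γ s)
    (hs : randersSpeed A μ (velocity γ s) = 0) :
    HasDerivAt (fun σ => randersEnergy A μ (velocity γ σ)) 0 s := by
  have hv := mdifferentiableAt_velocity hγ
  have hN := (differentiableAt_comp_tangentBundle
    (contMDiff_norm_sq.mdifferentiableAt (by simp)) hv).hasDerivAt
  have hw := (differentiableAt_comp_tangentBundle
    ((contMDiff_norm_sq_field hA).mdifferentiableAt (by simp)) hv).hasDerivAt
  set N := fun σ => ‖(velocity γ σ).2‖ ^ 2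
  set w := fun σ => ‖A (velocity γ σ).1‖ ^ 2
  have hNs : N s = 0 := by
    have := ((randersSpeed_eq_iff hμ).1 hs).2
    simpa [N] using this
  have hN' : deriv N s = 0 :=
    (show IsLocalMin N s from .of_forall fun σ => hNs.trans_le (sq_nonneg _)).deriv_eq_zero
  have hl : ∀ σ, 0 < 1 - μ ^ 2 * w σ := fun σ => by
    have := one_sub_norm_sq_pos (norm_smul_lt_one hμ (γ σ))
    rwa [norm_smul, mul_pow, Real.norm_eq_abs, sq_abs] at this
  have hG := (hN.const_mul 2).div (((hw.const_mul (μ ^ 2)).const_sub 1).pow 2)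
    (pow_pos (hl s) 2).ne'
  have hG0 : HasDerivAt (fun σ => 2 * N σ / (1 - μ ^ 2 * w σ) ^ 2) 0 s := by
    refine hG.congr_deriv ?_
    simp [hNs, hN']
  -- From `F (1 - ‖W‖) ≤ ‖y‖` and `1 + ‖W‖ ≤ 2` follows `F (1 - ‖W‖²) ≤ 2 ‖y‖`; then square.
  have hbound : ∀ σ, ‖randersEnergy A μ (velocity γ σ)‖ ≤
      ‖2 * N σ / (1 - μ ^ 2 * w σ) ^ 2‖ := by
    intro σ
    have hF := randersSpeed_nonneg hμ (velocity γ σ)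
    have h1 := randersNorm_mul_le (W := fun x => μ • A x) (norm_smul_lt_one hμ (γ σ))
      (velocity γ σ).2
    have h2 := norm_smul_lt_one hμ (γ σ)
    have h3 : 1 - μ ^ 2 * w σ = (1 - ‖μ • A (γ σ)‖) * (1 + ‖μ • A (γ σ)‖) := by
      have : ‖μ • A (γ σ)‖ ^ 2 = μ ^ 2 * w σ := by
        rw [norm_smul, mul_pow, Real.norm_eq_abs, sq_abs]
      linear_combination this
    have h4 : randersSpeed A μ (velocity γ σ) * (1 - μ ^ 2 * w σ) ≤ 2 * ‖(velocity γ σ).2‖ := by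
      rw [h3, ← mul_assoc, mul_comm 2]
      refine mul_le_mul h1 (by linarith) (by positivity) (norm_nonneg _)
    rw [randersEnergy, Real.norm_of_nonneg (div_nonneg (sq_nonneg _) zero_le_two),
      Real.norm_of_nonneg (div_nonneg (mul_nonneg zero_le_two (sq_nonneg _)) (sq_nonneg _)),
      le_div_iff₀ (pow_pos (hl σ) 2)]
    have h5 := pow_le_pow_left₀ (mul_nonneg hF (hl σ).le) h4 2
    change _ ≤ 2 * ‖(velocity γ σ).2‖ ^ 2
    nlinarith
  rw [hasDerivAt_iff_isLittleO] at hG0 ⊢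
  refine Asymptotics.IsBigO.trans_isLittleO (.of_bound 1 (.of_forall fun σ => ?_)) hG0
  have hs0 : randersEnergy A μ (velocity γ s) = 0 := by simp [randersEnergy, hs]
  simp only [hs0, hNs, smul_zero, sub_zero, mul_zero, zero_div, one_mul]
  exact hbound σ

/-- Geodesics have constant speed. -/
theorem IsGeodesicOn.randersSpeed_eq {γ : ℝ → M} {S : Set ℝ}
    (hγ : IsGeodesicOn (randersNorm (fun x => μ • A x)) γ S) (hμ : ∀ x, |μ| * ‖A x‖ < 1)
    (hA : ContMDiff (𝓡 2) (𝓡 2).tangent ∞ (fun x : M => (⟨x, A x⟩ : TangentBundle (𝓡 2) M)))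
    (hS : IsPreconnected (interior S)) {s s' : ℝ} (hs : s ∈ interior S) (hs' : s' ∈ interior S) :
    randersSpeed A μ (velocity γ s) = randersSpeed A μ (velocity γ s') := by
  have hd : ∀ σ ∈ interior S, HasDerivAt (fun σ => randersEnergy A μ (velocity γ σ)) 0 σ := by
    intro σ hσ
    have h2 := hγ.contMDiffAt hσ (n := 2) (by norm_cast)
    rcases (randersSpeed_nonneg hμ (velocity γ σ)).eq_or_lt with h | h
    · exact hasDerivAt_randersEnergy_velocity_of_eq_zero hμ hA h2 h.symm
    · exact hasDerivAt_randersEnergy_velocity hμ h2 (hγ.isStationaryAt hμ hA hσ h)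
  have h1 := isOpen_interior.is_const_of_deriv_eq_zero hS
    (fun σ hσ => (hd σ hσ).differentiableAt.differentiableWithinAt)
    (fun σ hσ => (hd σ hσ).deriv) hs hs'
  simp only [randersEnergy] at h1
  rw [← sq_eq_sq₀ (randersSpeed_nonneg hμ _) (randersSpeed_nonneg hμ _)]
  linarith

/-- Geodesics have constant momentum along the wind. -/
theorem IsGeodesicOn.windMomentum_eq (h : IsKillingFlow φ A) {γ : ℝ → M} {S : Set ℝ}
    (hγ : IsGeodesicOn (randersNorm (fun x => μ • A x)) γ S) (hμ : ∀ x, |μ| * ‖A x‖ < 1)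
    (hS : IsPreconnected (interior S)) {c : ℝ} (hc : 0 < c)
    (hγc : ∀ s ∈ interior S, randersSpeed A μ (velocity γ s) = c)
    {s s' : ℝ} (hs : s ∈ interior S) (hs' : s' ∈ interior S) :
    windMomentum A (c * μ) (velocity γ s) = windMomentum A (c * μ) (velocity γ s') := by
  have hd : ∀ σ ∈ interior S, HasDerivAt (fun σ =>
      c / (c + μ * windMomentum A (c * μ) (velocity γ σ)) *
        windMomentum A (c * μ) (velocity γ σ)) 0 σ := by
    intro σ hσ
    refine hasDerivAt_windMomentum h hμ hc (hγ.contMDiffAt hσ (by norm_cast)) ?_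
      (hγ.isStationaryAt hμ h.contMDiff_field hσ (hc.trans_eq (hγc σ hσ).symm))
    filter_upwards [isOpen_interior.mem_nhds hσ] with τ hτ using hγc τ hτ
  have h1 := isOpen_interior.is_const_of_deriv_eq_zero hS
    (fun σ hσ => (hd σ hσ).differentiableAt.differentiableWithinAt)
    (fun σ hσ => (hd σ hσ).deriv) hs hs'
  have p1 := add_mul_windMomentum_pos hμ hc (hγc s hs)
  have p2 := add_mul_windMomentum_pos hμ hc (hγc s' hs')
  -- The conserved quantity is `c m / (c + μ m)`, an injective function of `m` where the denominator
  -- is positive.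
  rw [div_mul_eq_mul_div, div_mul_eq_mul_div, div_eq_div_iff p1.ne' p2.ne'] at h1
  have h2 : c ^ 2 * (windMomentum A (c * μ) (velocity γ s) -
      windMomentum A (c * μ) (velocity γ s')) = 0 := by linear_combination h1
  rcases mul_eq_zero.1 h2 with h3 | h3
  · exact absurd h3 (pow_pos hc 2).ne'
  · linarith

/-- Navigation takes geodesics of speed `c` of one wind to geodesics of speed `c` of another. -/
theorem IsGeodesicOn.flow (h : IsKillingFlow φ A) {γ : ℝ → M} {S : Set ℝ}
    (hγ : IsGeodesicOn (randersNorm (fun x => μ • A x)) γ S) (hμ : ∀ x, |μ| * ‖A x‖ < 1)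
    {ν : ℝ} (hμν : ∀ x, |μ + ν| * ‖A x‖ < 1)
    (hS : IsPreconnected (interior S)) {c : ℝ} (hc : 0 < c)
    (hγc : ∀ s ∈ interior S, randersSpeed A μ (velocity γ s) = c) :
    IsGeodesicOn (randersNorm (fun x => (μ + ν) • A x)) (fun s => φ (c * ν * s) (γ s)) S ∧
      ∀ s ∈ interior S, randersSpeed A (μ + ν) (velocity (fun s => φ (c * ν * s) (γ s)) s) = c := by
  have hvel : ∀ s ∈ interior S, velocity (fun s => φ (c * ν * s) (γ s)) s =
      ⟨φ (c * ν * s) (γ s), mfderiv (𝓡 2) (𝓡 2) (φ (c * ν * s)) (γ s) (velocity γ s).2 +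
        (c * ν) • A (φ (c * ν * s) (γ s))⟩ := fun s hs =>
    h.velocity_comp (a := fun s => c * ν * s) (by simpa using (hasDerivAt_id s).const_mul (c * ν))
      ((hγ.contMDiffAt hs le_rfl).mdifferentiableAt (by simp))
  have hspeed : ∀ s ∈ interior S,
      randersSpeed A (μ + ν) (velocity (fun s => φ (c * ν * s) (γ s)) s) = c := fun s hs => by
    rw [hvel s hs]
    exact randersSpeed_flow h hμ hμν (c * ν * s) (X := velocity γ s) (hγc s hs)
  refine ⟨isGeodesicOn_of_isStationaryAt hμν h.contMDiff_field ?_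
    (fun s hs => hc.trans_eq (hspeed s hs).symm) fun s hs => ?_, hspeed⟩
  · intro s hs
    exact contMDiffAt_flow h le_rfl (a := fun s => c * ν * s) (β := γ)
      (show ContDiffAt ℝ ∞ (fun s : ℝ => c * ν * s) s by fun_prop).contMDiffAt.contMDiffWithinAt
      (hγ.smooth s hs)
  · have hS' := isOpen_interior.mem_nhds hs
    have hst := hγ.isStationaryAt hμ h.contMDiff_field hs (hc.trans_eq (hγc s hs).symm)
    -- Pass to the relative energy, move by the flow, and return to the Randers energy of the new
    -- wind. The return needs the momentum of the moved curve, which equals that of `γ`.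
    rw [isStationaryAt_randersEnergy_iff hμ h.contMDiff_field hc
      (n := windMomentum A (c * μ) (velocity γ s))
      (by filter_upwards [hS'] with σ hσ using hγc σ hσ)
      (by filter_upwards [hS'] with σ hσ using hγ.windMomentum_eq h hμ hS hc hγc hσ hs)] at hst
    have hst' := isStationaryAt_windEnergy_flow h (c := c * ν) hst
    rw [← mul_add] at hst'
    refine (isStationaryAt_randersEnergy_iff hμν h.contMDiff_field hc
      (n := windMomentum A (c * μ) (velocity γ s))
      (by filter_upwards [hS'] with σ hσ using hspeed σ hσ) ?_).2 hst'
    filter_upwards [hS'] with σ hσ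
    rw [← hγ.windMomentum_eq h hμ hS hc hγc hσ hs, hvel σ hσ]
    simp only [windMomentum]
    rw [← h.inner_map (c * ν * σ) (γ σ), h.map_field, map_sub, map_smul, h.map_field]
    congr 1
    module

end Geodesics

/-! ### Variation fields of families on a closed strip. -/

section Family

variable {M : Type*} [TopologicalSpace M] [ChartedSpace Plane M]

theorem mfderivWithin_prod_slice {Γ : ℝ → ℝ → M} {ε l σ : ℝ} (hε : 0 < ε)
    (hΓ : ContMDiffOn 𝓘(ℝ, ℝ × ℝ) (𝓡 2) ∞ (fun z : ℝ × ℝ => Γ z.1 z.2) (Ioo (-ε) ε ×ˢ Icc 0 l))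
    (hσ : σ ∈ Icc 0 l) :
    (mfderivWithin 𝓘(ℝ, ℝ × ℝ) (𝓡 2) (fun z : ℝ × ℝ => Γ z.1 z.2) (Ioo (-ε) ε ×ˢ Icc 0 l) (0, σ)
      ((1 : ℝ), (0 : ℝ)) : Plane) = (velocity (fun t => Γ t σ) 0).2 := by
  have h0 : ((0 : ℝ), σ) ∈ Ioo (-ε) ε ×ˢ Icc 0 l := ⟨⟨by linarith, hε⟩, hσ⟩
  have h1 := ((hΓ _ h0).mdifferentiableWithinAt (by simp)).hasMFDerivWithinAt
  have h2 : HasFDerivAt (fun t : ℝ => (t, σ))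
      ((ContinuousLinearMap.id ℝ ℝ).prod (0 : ℝ →L[ℝ] ℝ)) 0 :=
    (hasFDerivAt_id (0 : ℝ)).prodMk (hasFDerivAt_const σ (0 : ℝ))
  have h3 := HasMFDerivWithinAt.comp (0 : ℝ) (f := fun t : ℝ => (t, σ)) (s := Ioo (-ε) ε) h1
    h2.hasMFDerivAt.hasMFDerivWithinAt (fun t ht => ⟨ht, hσ⟩)
  have h4 := (h3.hasMFDerivAt (Ioo_mem_nhds (by linarith) hε)).mfderiv
  refine Eq.symm ((congrArg (fun T : ℝ →L[ℝ] Plane => T 1) h4).trans ?_)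
  rfl

theorem contDiffAt_comp_tangentBundle [IsManifold (𝓡 2) ∞ M] {g : TangentBundle (𝓡 2) M → ℝ}
    {X : ℝ → TangentBundle (𝓡 2) M} {t : ℝ}
    (hg : ContMDiffAt (𝓡 2).tangent 𝓘(ℝ, ℝ) ∞ g (X t))
    (hX : ContMDiffAt 𝓘(ℝ, ℝ) (𝓡 2).tangent ∞ X t) :
    ContDiffAt ℝ ∞ (fun t => g (X t)) t :=
  (hg.comp t hX).contDiffAt

end Family

/-! ### First variation of the speed and transport of Jacobi fields. -/

section Jacobi

variable {M : Type*} [MetricSpace M] [ChartedSpace Plane M] [IsManifold (𝓡 2) ∞ M]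
  [RiemannianBundle (fun x : M => TangentSpace (𝓡 2) x)]
  [IsContMDiffRiemannianBundle (𝓡 2) ∞ Plane (fun x : M => TangentSpace (𝓡 2) x)]
  {A : ∀ x : M, TangentSpace (𝓡 2) x} {φ : ℝ → M → M} {μ : ℝ}

/-- Derivatives are taken within the strip, where the family is smooth up to `s = 0` and `s = l`.
This lets the vanishing of the field at the ends pass to limits from inside. -/
theorem continuousOn_norm_variationField {Γ : ℝ → ℝ → M} {ε l : ℝ} (hε : 0 < ε) (hl : 0 < l)
    (hΓ : ContMDiffOn 𝓘(ℝ, ℝ × ℝ) (𝓡 2) ∞ (fun z : ℝ × ℝ => Γ z.1 z.2)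
      (Ioo (-ε) ε ×ˢ Icc 0 l)) :
    ContinuousOn (fun σ => ‖(velocity (fun t => Γ t σ) 0).2‖) (Icc 0 l) := by
  have h1 := contMDiffOn_mfderivWithin_apply (n := ∞) hΓ (by simp)
    ((isOpen_Ioo.uniqueDiffOn.prod (uniqueDiffOn_Icc hl)).uniqueMDiffOn)
    (a := fun σ : ℝ => (0, σ)) (b := fun _ : ℝ => ((1 : ℝ), (0 : ℝ))) (t := Icc 0 l)
    (by fun_prop) contDiffOn_const (fun σ hσ => ⟨⟨by linarith, hε⟩, hσ⟩)
  have h2 := (contMDiff_norm_sq.continuous.comp_continuousOn h1.continuousOn).sqrt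
  refine h2.congr fun σ hσ => ?_
  have h3 : velocity (fun t => Γ t σ) 0 = ⟨Γ 0 σ, mfderivWithin 𝓘(ℝ, ℝ × ℝ) (𝓡 2)
      (fun z : ℝ × ℝ => Γ z.1 z.2) (Ioo (-ε) ε ×ˢ Icc 0 l) (0, σ) ((1 : ℝ), (0 : ℝ))⟩ :=
    tangentBundle_mk_congr rfl (mfderivWithin_prod_slice hε hΓ hσ).symm
  have h4 : ∀ X : TangentBundle (𝓡 2) M, ‖X.2‖ = Real.sqrt (‖X.2‖ ^ 2) := fun X =>
    (Real.sqrt_sq (norm_nonneg _)).symm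
  refine (h4 (velocity (fun t => Γ t σ) 0)).trans ?_
  rw [h3]
  rfl

omit [IsManifold (𝓡 2) ∞ M] [RiemannianBundle (fun x : M => TangentSpace (𝓡 2) x)]
  [IsContMDiffRiemannianBundle (𝓡 2) ∞ Plane (fun x : M => TangentSpace (𝓡 2) x)] in
theorem contMDiffAt_family {Γ : ℝ → ℝ → M} {ε l t s : ℝ}
    (hΓ : ContMDiffOn 𝓘(ℝ, ℝ × ℝ) (𝓡 2) ∞ (fun z : ℝ × ℝ => Γ z.1 z.2)
      (Ioo (-ε) ε ×ˢ Icc 0 l)) (ht : t ∈ Ioo (-ε) ε) (hs : s ∈ Ioo 0 l) :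
    ContMDiffAt 𝓘(ℝ, ℝ × ℝ) (𝓡 2) ∞ (fun z : ℝ × ℝ => Γ z.1 z.2) (t, s) :=
  hΓ.contMDiffAt (prod_mem_nhds (isOpen_Ioo.mem_nhds ht) (Icc_mem_nhds hs.1 hs.2))

omit [RiemannianBundle (fun x : M => TangentSpace (𝓡 2) x)]
  [IsContMDiffRiemannianBundle (𝓡 2) ∞ Plane (fun x : M => TangentSpace (𝓡 2) x)] in
theorem contMDiffOn_velocity_family {Γ : ℝ → ℝ → M} {ε l s : ℝ}
    (hΓ : ContMDiffOn 𝓘(ℝ, ℝ × ℝ) (𝓡 2) ∞ (fun z : ℝ × ℝ => Γ z.1 z.2)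
      (Ioo (-ε) ε ×ˢ Icc 0 l)) (hs : s ∈ Ioo 0 l) :
    ContMDiffOn 𝓘(ℝ, ℝ) (𝓡 2).tangent ∞ (fun t => velocity (Γ t) s) (Ioo (-ε) ε) := by
  have hO : IsOpen (Ioo (-ε) ε ×ˢ Ioo 0 l) := isOpen_Ioo.prod isOpen_Ioo
  have h1 := contMDiffOn_mfderivWithin_apply (n := ∞)
    (hΓ.mono (prod_mono_right Ioo_subset_Icc_self)) (by simp) hO.uniqueMDiffOn
    (a := fun t : ℝ => (t, s)) (b := fun _ : ℝ => ((0 : ℝ), (1 : ℝ))) (t := Ioo (-ε) ε)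
    (by fun_prop) contDiffOn_const (fun t ht => ⟨ht, hs⟩)
  refine h1.congr fun t ht => ?_
  refine tangentBundle_mk_congr rfl ?_
  rw [mfderivWithin_of_isOpen hO ⟨ht, hs⟩]
  have h2 : HasFDerivAt (fun s : ℝ => (t, s))
      ((0 : ℝ →L[ℝ] ℝ).prod (ContinuousLinearMap.id ℝ ℝ)) s :=
    (hasFDerivAt_const t s).prodMk (hasFDerivAt_id s)
  have h3 := (HasMFDerivAt.comp s (f := fun s : ℝ => (t, s))
    ((contMDiffAt_family hΓ ht hs).mdifferentiableAt (by simp)).hasMFDerivAt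
    h2.hasMFDerivAt).mfderiv
  exact congrArg (fun T : ℝ →L[ℝ] Plane => T 1) h3

/-- A function on `(0, l)` with constant derivative that tends to zero at both ends has zero
derivative. -/
theorem eq_zero_of_hasDerivAt_const {g : ℝ → ℝ} {b l : ℝ} (hl : 0 < l)
    (hg : ∀ s ∈ Ioo 0 l, HasDerivAt g b s) (h0 : Tendsto g (𝓝[>] 0) (𝓝 0))
    (h1 : Tendsto g (𝓝[<] l) (𝓝 0)) : b = 0 := by
  have hd : ∀ s ∈ Ioo 0 l, HasDerivAt (fun s => g s - b * s) 0 s := fun s hs => by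
    have := (hg s hs).sub ((hasDerivAt_id s).const_mul b)
    rw [mul_one, sub_self] at this
    exact this
  have hm : l / 2 ∈ Ioo 0 l := ⟨by linarith, by linarith⟩
  have hconst : ∀ s ∈ Ioo 0 l, g s = g (l / 2) - b * (l / 2) + b * s := fun s hs => by
    have := isOpen_Ioo.is_const_of_deriv_eq_zero isPreconnected_Ioo
      (fun σ hσ => (hd σ hσ).differentiableAt.differentiableWithinAt)
      (fun σ hσ => (hd σ hσ).deriv) hs hm
    linarith
  have hlim : ∀ x, Tendsto (fun s => g (l / 2) - b * (l / 2) + b * s) (𝓝 x)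
      (𝓝 (g (l / 2) - b * (l / 2) + b * x)) := fun x =>
    (show Continuous fun s => g (l / 2) - b * (l / 2) + b * s by fun_prop).tendsto x
  have e0 := tendsto_nhds_unique h0 (((hlim 0).mono_left nhdsWithin_le_nhds).congr' (by
    filter_upwards [Ioo_mem_nhdsGT hl] with s hs using (hconst s hs).symm))
  have e1 := tendsto_nhds_unique h1 (((hlim l).mono_left nhdsWithin_le_nhds).congr' (by
    filter_upwards [Ioo_mem_nhdsLT hl] with s hs using (hconst s hs).symm))
  have : b * l = 0 := by linarith
  exact (mul_eq_zero.1 this).resolve_right hl.ne'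

/-- The first variation of arc length: the speed of a family of geodesics is stationary if the
variation field vanishes at both ends. -/
theorem hasDerivAt_speed_zero (h : IsKillingFlow φ A) (hμ : ∀ x, |μ| * ‖A x‖ < 1) {Γ : ℝ → ℝ → M}
    {ε l : ℝ} (hε : 0 < ε) (hl : 0 < l)
    (hΓ : ContMDiffOn 𝓘(ℝ, ℝ × ℝ) (𝓡 2) ∞ (fun z : ℝ × ℝ => Γ z.1 z.2) (Ioo (-ε) ε ×ˢ Icc 0 l))
    {c : ℝ → ℝ} (hc : 0 < c 0) (hcd : DifferentiableAt ℝ c 0)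
    (hgeo : ∀ t ∈ Ioo (-ε) ε, IsGeodesicOn (randersNorm (fun x => μ • A x)) (Γ t) (Icc 0 l))
    (hΓc : ∀ t ∈ Ioo (-ε) ε, ∀ s ∈ Ioo 0 l, randersSpeed A μ (velocity (Γ t) s) = c t)
    (hJ0 : (velocity (fun t => Γ t 0) 0).2 = 0) (hJl : (velocity (fun t => Γ t l) 0).2 = 0) :
    HasDerivAt c 0 0 := by
  have h0 : (0 : ℝ) ∈ Ioo (-ε) ε := ⟨by linarith, hε⟩
  have hint : interior (Icc 0 l) = Ioo 0 l := interior_Icc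
  have hm : l / 2 ∈ Ioo 0 l := ⟨by linarith, by linarith⟩
  have hγc : ∀ s ∈ interior (Icc 0 l), randersSpeed A μ (velocity (Γ 0) s) = c 0 := fun s hs =>
    hΓc 0 h0 s (hint ▸ hs)
  set n := windMomentum A (c 0 * μ) (velocity (Γ 0) (l / 2))
  have hn : ∀ s ∈ Ioo 0 l, windMomentum A (c 0 * μ) (velocity (Γ 0) s) = n := fun s hs =>
    (hgeo 0 h0).windMomentum_eq h hμ (hint ▸ isPreconnected_Ioo) hc hγc (hint ▸ hs) (hint ▸ hm)
  set g : ℝ → ℝ := fun σ => fiberDeriv (randersEnergy A μ) (velocity (Γ 0) σ).2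
    (velocity (fun t => Γ t σ) 0).2 with hg
  have hder : ∀ s ∈ Ioo 0 l, deriv (fun t => randersEnergy A μ (velocity (Γ t) s)) 0 =
      c 0 * deriv c 0 := by
    intro s hs
    have h1 : (fun t => randersEnergy A μ (velocity (Γ t) s)) =ᶠ[𝓝 0] fun t => c t ^ 2 / 2 := by
      filter_upwards [isOpen_Ioo.mem_nhds h0] with t ht
      rw [randersEnergy, hΓc t ht s hs]
    rw [h1.deriv_eq]
    refine ((hcd.hasDerivAt.pow 2).div_const 2).deriv.trans ?_
    simp
    ring
  -- The momentum paired with the variation field grows at the constant rate `c (0) c' (0)`, since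
  -- all of `Γ t` has energy `(c t)² / 2`.
  have hgd : ∀ s ∈ Ioo 0 l, HasDerivAt g (c 0 * deriv c 0) s := by
    intro s hs
    rw [← hder s hs]
    exact (hgeo 0 h0).isStationaryAt hμ h.contMDiff_field (hint ▸ hs)
      (hc.trans_eq (hΓc 0 h0 s hs).symm) Γ
      ((contMDiffAt_family hΓ h0 hs).of_le (by norm_cast)) .rfl
  -- The momentum is a constant multiple of the relative velocity, of length `c 0`, so the pairing
  -- tends to zero with the variation field.
  have hbound : ∀ s ∈ Ioo 0 l, ‖g s‖ ≤ |c 0 / (c 0 + μ * n)| * c 0 *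
      ‖(velocity (fun t => Γ t s) 0).2‖ := by
    intro s hs
    have h1 := ((randersSpeed_eq_iff hμ).1 (hΓc 0 h0 s hs)).2
    have h2 := fiberDeriv_randersEnergy hμ h.contMDiff_field hc (x := Γ 0 s)
      (v := (velocity (Γ 0) s).2) (velocity (fun t => Γ t s) 0).2 (hΓc 0 h0 s hs)
    have h3 : windMomentum A (c 0 * μ) ⟨Γ 0 s, (velocity (Γ 0) s).2⟩ = n := hn s hs
    rw [h3] at h2
    rw [hg]
    refine (congrArg norm h2).trans_le ?_
    rw [norm_mul, Real.norm_eq_abs, mul_assoc]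
    refine mul_le_mul_of_nonneg_left ?_ (abs_nonneg _)
    refine (norm_inner_le_norm _ _).trans ?_
    exact mul_le_mul_of_nonneg_right h1.le (norm_nonneg _)
  have hJ := continuousOn_norm_variationField hε hl hΓ
  have hlim : ∀ x ∈ Icc 0 l, ‖(velocity (fun t => Γ t x) 0).2‖ = 0 →
      Tendsto g (𝓝[Ioo 0 l] x) (𝓝 0) := by
    intro x hx hx0
    have h1 := ((hJ x hx).mono Ioo_subset_Icc_self).tendsto.const_mul
      (|c 0 / (c 0 + μ * n)| * c 0)
    rw [hx0, mul_zero] at h1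
    refine squeeze_zero_norm' ?_ h1
    filter_upwards [self_mem_nhdsWithin] with s hs using hbound s hs
  have hb := eq_zero_of_hasDerivAt_const hl hgd
    ((hlim 0 ⟨le_rfl, hl.le⟩ (by rw [hJ0, norm_zero])).mono_left
      (by rw [nhdsWithin_Ioo_eq_nhdsGT hl]))
    ((hlim l ⟨hl.le, le_rfl⟩ (by rw [hJl, norm_zero])).mono_left
      (by rw [nhdsWithin_Ioo_eq_nhdsLT hl]))
  have h2 := hcd.hasDerivAt
  rwa [(mul_eq_zero.1 hb).resolve_left hc.ne'] at h2

/-- Navigation preserves conjugate points. -/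
theorem IsConjugateAlong.flow (h : IsKillingFlow φ A) (hμ : ∀ x, |μ| * ‖A x‖ < 1) {ν : ℝ}
    (hμν : ∀ x, |μ + ν| * ‖A x‖ < 1) {l : ℝ} (hl : 0 < l) {γ : ℝ → M}
    (hγ : ∀ s ∈ Ioo 0 l, randersSpeed A μ (velocity γ s) = 1)
    (hconj : IsConjugateAlong (randersNorm (fun x => μ • A x)) γ l) :
    IsConjugateAlong (randersNorm (fun x => (μ + ν) • A x)) (fun s => φ (ν * s) (γ s)) l := by
  obtain ⟨J, ⟨ε, hε, Γ, hΓ, hgeo, hJ⟩, hJ0, hJl, s₁, hs₁, hJs₁⟩ := hconj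
  have hint : interior (Icc 0 l) = Ioo 0 l := interior_Icc
  have h0 : (0 : ℝ) ∈ Ioo (-ε) ε := ⟨by linarith, hε⟩
  have hm : l / 2 ∈ Ioo 0 l := ⟨by linarith, by linarith⟩
  have hbase : ∀ s ∈ Icc 0 l, γ s = Γ 0 s := fun s hs => congrArg TotalSpace.proj (hJ s hs)
  have hnormJ : ∀ s ∈ Icc 0 l, ‖J s‖ = ‖(velocity (fun t => Γ t s) 0).2‖ := fun s hs =>
    congrArg (fun X : TangentBundle (𝓡 2) M => ‖X.2‖) (hJ s hs)
  set c : ℝ → ℝ := fun t => randersSpeed A μ (velocity (Γ t) (l / 2)) with hc_def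
  have hc0 : c 0 = 1 := by
    rw [← hγ _ hm, hc_def]
    refine congrArg (randersSpeed A μ) (velocity_congr ?_)
    filter_upwards [isOpen_Ioo.mem_nhds hm] with s hs
    exact (hbase s (Ioo_subset_Icc_self hs)).symm
  have hvel := contMDiffOn_velocity_family hΓ hm
  have hcd : ∀ t ∈ Ioo (-ε) ε, 0 < c t → ContDiffAt ℝ ∞ c t := fun t ht hct =>
    contDiffAt_comp_tangentBundle (contMDiffAt_randersSpeed hμ h.contMDiff_field
      ((randersSpeed_pos_iff hμ (X := velocity (Γ t) (l / 2))).1 hct))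
      (hvel.contMDiffAt (isOpen_Ioo.mem_nhds ht))
  have hcd0 := hcd 0 h0 (by rw [hc0]; exact one_pos)
  -- The parameter interval is shrunk so that every geodesic of the family has positive speed; there
  -- `c` is smooth and navigation applies.
  obtain ⟨δ, hδ, hδc⟩ : ∃ δ > 0, ∀ t ∈ Ioo (-δ) δ, 0 < c t ∧ t ∈ Ioo (-ε) ε := by
    have h1 : ∀ᶠ t in 𝓝 (0 : ℝ), 0 < c t ∧ t ∈ Ioo (-ε) ε :=
      (hcd0.continuousAt.eventually (lt_mem_nhds (by rw [hc0]; exact one_pos))).and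
        (isOpen_Ioo.mem_nhds h0)
    obtain ⟨δ, hδ, h2⟩ := Metric.eventually_nhds_iff_ball.1 h1
    refine ⟨δ, hδ, fun t ht => h2 t ?_⟩
    rwa [Real.ball_eq_Ioo, zero_sub, zero_add]
  have hsub : Ioo (-δ) δ ⊆ Ioo (-ε) ε := fun t ht => (hδc t ht).2
  have hspeed : ∀ t ∈ Ioo (-ε) ε, ∀ s ∈ Ioo 0 l, randersSpeed A μ (velocity (Γ t) s) = c t :=
    fun t ht s hs => (hgeo t ht).randersSpeed_eq hμ h.contMDiff_field
      (hint ▸ isPreconnected_Ioo) (hint ▸ hs) (hint ▸ hm)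
  have hzero : ∀ s ∈ Icc 0 l, J s = 0 → (velocity (fun t => Γ t s) 0).2 = 0 := fun s hs hs0 => by
    rw [← norm_eq_zero, ← hnormJ s hs, hs0, norm_zero]
  have hc' : HasDerivAt c 0 0 := hasDerivAt_speed_zero h hμ hε hl hΓ (by rw [hc0]; exact one_pos)
    (hcd0.differentiableAt (by simp)) hgeo hspeed (hzero 0 ⟨le_rfl, hl.le⟩ hJ0)
    (hzero l ⟨hl.le, le_rfl⟩ hJl)
  -- Each geodesic is navigated at its own speed `c t`. Since `c' (0) = 0`, the flow time
  -- contributes nothing to the variation field at `t = 0`.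
  set Γ' : ℝ → ℝ → M := fun t s => φ (c t * ν * s) (Γ t s) with hΓ'
  have hfield : ∀ s ∈ Icc 0 l, velocity (fun t => Γ' t s) 0 = ⟨Γ' 0 s,
      mfderiv (𝓡 2) (𝓡 2) (φ (c 0 * ν * s)) (Γ 0 s) (velocity (fun t => Γ t s) 0).2⟩ := by
    intro s hs
    have h1 : HasDerivAt (fun t => c t * ν * s) 0 0 := by
      simpa using (hc'.mul_const ν).mul_const s
    have h2 : MDifferentiableAt 𝓘(ℝ, ℝ) (𝓡 2) (fun t => Γ t s) 0 := by
      have h3 := ((hΓ (0, s) ⟨h0, hs⟩).mdifferentiableWithinAt (by simp))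
      have h4 := MDifferentiableWithinAt.comp (0 : ℝ) (f := fun t : ℝ => (t, s))
        (s := Ioo (-ε) ε) h3 (show DifferentiableAt ℝ (fun t : ℝ => (t, s)) 0 by
          fun_prop).mdifferentiableAt.mdifferentiableWithinAt (fun t ht => ⟨ht, hs⟩)
      exact h4.mdifferentiableAt (isOpen_Ioo.mem_nhds h0)
    have h3 := h.velocity_comp (a := fun t => c t * ν * s) h1 h2
    rwa [zero_smul, add_zero] at h3
  have hbase' : ∀ s ∈ Icc 0 l, φ (ν * s) (γ s) = Γ' 0 s := fun s hs => by
    simp only [hΓ', hc0, one_mul, hbase s hs]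
  -- The base points agree with `Γ' 0 s` only for `s ∈ [0, l]`. All tangent spaces being copies of
  -- `Plane`, the field is carried over as a vector of the plane.
  obtain ⟨K, hK⟩ : ∃ K : ∀ s, TangentSpace (𝓡 2) (φ (ν * s) (γ s)),
      ∀ s, (K s : Plane) = (velocity (fun t => Γ' t s) 0).2 := ⟨fun s => _, fun s => rfl⟩
  have hK' : ∀ s ∈ Icc 0 l, (⟨φ (ν * s) (γ s), K s⟩ : TangentBundle (𝓡 2) M) =
      velocity (fun t => Γ' t s) 0 := fun s hs => tangentBundle_mk_congr (hbase' s hs) (hK s)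
  have hnorm' : ∀ s ∈ Icc 0 l, ‖K s‖ = ‖J s‖ := by
    intro s hs
    have h1 := congrArg (fun X : TangentBundle (𝓡 2) M => ‖X.2‖) ((hK' s hs).trans (hfield s hs))
    refine h1.trans ?_
    rw [hnormJ s hs]
    exact h.norm_map _ _ _
  refine ⟨K, ⟨δ, hδ, Γ', ?_, fun t ht => ?_, hK'⟩, ?_, ?_, s₁, hs₁, ?_⟩
  · intro z hz
    refine contMDiffAt_flow h le_rfl (a := fun z : ℝ × ℝ => c z.1 * ν * z.2)
      (β := fun z => Γ z.1 z.2) ?_ ((hΓ z ⟨hsub hz.1, hz.2⟩).mono (prod_mono_left hsub))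
    have h1 : ContDiffAt ℝ ∞ (fun z : ℝ × ℝ => c z.1) z :=
      ContDiffAt.comp z (f := Prod.fst) (hcd z.1 (hsub hz.1) (hδc z.1 hz.1).1) contDiffAt_fst
    exact ((h1.mul contDiffAt_const).mul contDiffAt_snd).contMDiffAt.contMDiffWithinAt
  · exact ((hgeo t (hsub ht)).flow h hμ hμν (hint ▸ isPreconnected_Ioo) (hδc t ht).1
      (fun s hs => hspeed t (hsub ht) s (hint ▸ hs))).1
  · rw [← norm_eq_zero, hnorm' 0 ⟨le_rfl, hl.le⟩, hJ0, norm_zero]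
  · rw [← norm_eq_zero, hnorm' l ⟨hl.le, le_rfl⟩, hJl, norm_zero]
  · rw [← norm_ne_zero_iff, hnorm' s₁ hs₁]
    exact norm_ne_zero_iff.2 hJs₁

end Jacobi

/-- Puts `h` among the Randers metrics, so that results on Randers geodesics apply to it. -/
theorem riemannianNorm_eq_randersNorm {M : Type*} [MetricSpace M] [ChartedSpace Plane M]
    [RiemannianBundle (fun x : M => TangentSpace (𝓡 2) x)] (A : ∀ x : M, TangentSpace (𝓡 2) x) :
    (riemannianNorm : ∀ x : M, TangentSpace (𝓡 2) x → ℝ) =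
      randersNorm (fun x => (0 : ℝ) • A x) := by
  funext x y
  simp [riemannianNorm, randersNorm]

/-! ### Riemannian isometries and the distance. -/

section RiemannianDistance

variable {M : Type*} [MetricSpace M] [ChartedSpace Plane M]
  [RiemannianBundle (fun x : M => TangentSpace (𝓡 2) x)]

/-- `f` is a smooth map preserving the Riemannian metric and the distance. -/
structure IsRiemannianIsometry (f : M → M) : Prop where
  contMDiff : ContMDiff (𝓡 2) (𝓡 2) ∞ f
  norm_map : ∀ (x : M) (v : TangentSpace (𝓡 2) x), ‖mfderiv (𝓡 2) (𝓡 2) f x v‖ = ‖v‖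
  dist_map : ∀ x y, dist (f x) (f y) = dist x y

theorem IsRiemannianIsometry.comp {f g : M → M} (hf : IsRiemannianIsometry f)
    (hg : IsRiemannianIsometry g) : IsRiemannianIsometry (f ∘ g) where
  contMDiff := hf.contMDiff.comp hg.contMDiff
  norm_map x v := by
    rw [mfderiv_comp x (hf.contMDiff.mdifferentiableAt (by simp))
      (hg.contMDiff.mdifferentiableAt (by simp))]
    exact (hf.norm_map _ _).trans (hg.norm_map _ _)
  dist_map x y := (hf.dist_map _ _).trans (hg.dist_map _ _)

variable [IsRiemannianManifold (𝓡 2) M]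

theorem dist_le_of_norm_velocity_le {γ : ℝ → M} {a b K : ℝ} (hab : a ≤ b)
    (hγ : ContMDiffOn 𝓘(ℝ, ℝ) (𝓡 2) 1 γ (Icc a b)) (hK : 0 ≤ K)
    (h : ∀ t ∈ Ioo a b, ‖(velocity γ t).2‖ ≤ K) : dist (γ a) (γ b) ≤ K * (b - a) := by
  have h1 := riemannianEDist_le_pathELength hγ rfl rfl hab
  rw [← IsRiemannianManifold.out (I := 𝓡 2), pathELength_eq_lintegral_mfderiv_Ioo] at h1
  have h2 : ∫⁻ t in Ioo a b, ‖mfderiv 𝓘(ℝ, ℝ) (𝓡 2) γ t 1‖ₑ ≤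
      ∫⁻ _ in Ioo a b, ENNReal.ofReal K := by
    refine MeasureTheory.setLIntegral_mono' measurableSet_Ioo fun t ht => ?_
    rw [← ofReal_norm]
    exact ENNReal.ofReal_le_ofReal (h t ht)
  rw [MeasureTheory.setLIntegral_const, Real.volume_Ioo, ← ENNReal.ofReal_mul hK] at h2
  rw [dist_edist]
  exact ENNReal.toReal_le_of_le_ofReal (mul_nonneg hK (sub_nonneg.2 hab)) (h1.trans h2)

/-- A nearly shortest path is mapped to a path of the same length. -/
theorem edist_map_le {f : M → M} (hf : ContMDiff (𝓡 2) (𝓡 2) ∞ f)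
    (h : ∀ (x : M) (v : TangentSpace (𝓡 2) x), ‖mfderiv (𝓡 2) (𝓡 2) f x v‖ = ‖v‖) (x y : M) :
    edist (f x) (f y) ≤ edist x y := by
  refine le_of_forall_gt fun r hr => ?_
  rw [IsRiemannianManifold.out (I := 𝓡 2)] at hr ⊢
  obtain ⟨γ, h0, h1, hγ, hlen⟩ := exists_lt_of_riemannianEDist_lt hr
  refine (riemannianEDist_le_pathELength (γ := f ∘ γ)
    ((hf.of_le (by norm_cast)).comp_contMDiffOn hγ) (by simp [h0]) (by simp [h1])
    zero_le_one).trans_lt (lt_of_eq_of_lt ?_ hlen)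
  rw [pathELength_eq_lintegral_mfderiv_Ioo, pathELength_eq_lintegral_mfderiv_Ioo]
  refine MeasureTheory.setLIntegral_congr_fun measurableSet_Ioo fun t ht => ?_
  have h2 : MDifferentiableAt 𝓘(ℝ, ℝ) (𝓡 2) γ t :=
    (hγ.contMDiffAt (Icc_mem_nhds ht.1 ht.2)).mdifferentiableAt (by simp)
  rw [← ofReal_norm, ← ofReal_norm,
    mfderiv_comp t (hf.mdifferentiableAt (by simp)) h2]
  exact congrArg ENNReal.ofReal (h _ _)

/-- Both `f` and its inverse preserve norms, hence neither increases distances. -/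
theorem isRiemannianIsometry_of_diffeomorph (f : M ≃ₘ^∞⟮𝓡 2, 𝓡 2⟯ M)
    (h : ∀ (x : M) (v w : TangentSpace (𝓡 2) x),
        inner ℝ (mfderiv (𝓡 2) (𝓡 2) f x v) (mfderiv (𝓡 2) (𝓡 2) f x w) = inner ℝ v w) :
    IsRiemannianIsometry f := by
  have h1 : ∀ (x : M) (v : TangentSpace (𝓡 2) x), ‖mfderiv (𝓡 2) (𝓡 2) f x v‖ = ‖v‖ := by
    intro x v
    rw [← sq_eq_sq₀ (norm_nonneg _) (norm_nonneg _), ← real_inner_self_eq_norm_sq, h,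
      real_inner_self_eq_norm_sq]
  have h2 : ∀ (x : M) (v : TangentSpace (𝓡 2) x), ‖mfderiv (𝓡 2) (𝓡 2) f.symm x v‖ = ‖v‖ := by
    intro x v
    rw [← h1]
    have h3 := mfderiv_comp x (f.contMDiff.mdifferentiableAt (by simp))
      (f.symm.contMDiff.mdifferentiableAt (x := x) (by simp))
    have h4 : (f : M → M) ∘ f.symm = id := funext f.apply_symm_apply
    rw [h4, mfderiv_id] at h3
    have h5 : (⟨f (f.symm x), mfderiv (𝓡 2) (𝓡 2) f (f.symm x)
        (mfderiv (𝓡 2) (𝓡 2) f.symm x v)⟩ : TangentBundle (𝓡 2) M) = ⟨x, v⟩ :=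
      tangentBundle_mk_congr (f.apply_symm_apply x)
        (congrArg (fun T : Plane →L[ℝ] Plane => T v) h3).symm
    exact congrArg (fun X : TangentBundle (𝓡 2) M => ‖X.2‖) h5
  refine ⟨f.contMDiff, h1, fun x y => ?_⟩
  rw [dist_edist, dist_edist]
  refine congrArg ENNReal.toReal (le_antisymm (edist_map_le f.contMDiff h1 x y) ?_)
  simpa using edist_map_le f.symm.contMDiff h2 (f x) (f y)

end RiemannianDistance

/-! ### Geodesic polar coordinates and the Gauss lemma. -/

section PolarChart

variable {M : Type*} [MetricSpace M] [ChartedSpace Plane M] [IsManifold (𝓡 2) ∞ M]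
  [RiemannianBundle (fun x : M => TangentSpace (𝓡 2) x)]
  {p q : M} {a : ℝ} {e : OpenPartialHomeomorph M Plane}

namespace IsGeodesicPolarChart

omit [IsManifold (𝓡 2) ∞ M] in
theorem center_mem (he : IsGeodesicPolarChart p q a e) : p ∈ e.source := by
  rw [he.source_eq]; exact he.center_ne

omit [IsManifold (𝓡 2) ∞ M] in
theorem zero_mem (he : IsGeodesicPolarChart p q a e) : (0 : Plane) ∈ e.target :=
  he.map_center ▸ e.map_source he.center_mem

omit [IsManifold (𝓡 2) ∞ M] in
theorem pos (he : IsGeodesicPolarChart p q a e) : 0 < a := by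
  have := he.zero_mem
  rw [he.target_eq, mem_ball_zero_iff, norm_zero] at this
  linarith

omit [IsManifold (𝓡 2) ∞ M] in
theorem mem_target_iff (he : IsGeodesicPolarChart p q a e) {z : Plane} :
    z ∈ e.target ↔ ‖z‖ < 2 * a := by
  rw [he.target_eq, mem_ball_zero_iff]

omit [IsManifold (𝓡 2) ∞ M] in
theorem dist_symm (he : IsGeodesicPolarChart p q a e) {z : Plane} (hz : z ∈ e.target) :
    dist p (e.symm z) = ‖z‖ := by
  rw [he.dist_eq _ (e.map_target hz), e.right_inv hz]

omit [IsManifold (𝓡 2) ∞ M] in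
/-- The cut point is the point farthest from the pole. -/
theorem dist_lt [CompactSpace M] (he : IsGeodesicPolarChart p q a e) {x : M} (hx : x ∈ e.source) :
    dist p x < dist p q := by
  obtain ⟨m, -, hm⟩ := isCompact_univ.exists_isMaxOn ⟨p, mem_univ p⟩
    (f := fun x => dist p x) (by fun_prop)
  have hm' : ∀ y, dist p y ≤ dist p m := fun y => hm (mem_univ y)
  have hgt : ∀ x ∈ e.source, ∃ y, dist p x < dist p y := by
    intro x hx
    have h1 := he.mem_target_iff.1 (e.map_source hx)
    -- A radius halfway between `‖e x‖` and `2a` gives a point farther from `p`, so the maximum of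
    -- the distance cannot lie in the chart domain.
    have h2 : ‖EuclideanSpace.single (0 : Fin 2) ((‖e x‖ + 2 * a) / 2)‖ =
        (‖e x‖ + 2 * a) / 2 := by
      rw [PiLp.norm_single, Real.norm_of_nonneg]
      linarith [norm_nonneg (e x)]
    refine ⟨e.symm (EuclideanSpace.single 0 ((‖e x‖ + 2 * a) / 2)), ?_⟩
    rw [he.dist_symm (he.mem_target_iff.2 (by rw [h2]; linarith)), he.dist_eq x hx, h2]
    linarith
  have hmq : m = q := by
    by_contra hne
    obtain ⟨y, hy⟩ := hgt m (by rw [he.source_eq]; exact hne)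
    exact absurd (hm' y) (not_le.2 hy)
  obtain ⟨y, hy⟩ := hgt x hx
  exact hmq ▸ hy.trans_le (hm' y)

variable [IsContMDiffRiemannianBundle (𝓡 2) ∞ Plane (fun x : M => TangentSpace (𝓡 2) x)]

/-- The rays from the pole have unit speed. -/
theorem norm_mfderiv_symm_ray (he : IsGeodesicPolarChart p q a e) {u : Plane} (hu : ‖u‖ = 1)
    {r : ℝ} (hr : r ∈ Ioo (-(2 * a)) (2 * a)) :
    ‖mfderiv (𝓡 2) (𝓡 2) e.symm (r • u) u‖ = 1 := by
  have hgeo := he.ray_isGeodesicOn u hu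
  rw [riemannianNorm_eq_randersNorm fun x => 0] at hgeo
  have hint : interior (Ioo (-(2 * a)) (2 * a)) = Ioo (-(2 * a)) (2 * a) := interior_Ioo
  have h0 : (0 : ℝ) ∈ Ioo (-(2 * a)) (2 * a) := ⟨by linarith [he.pos], by linarith [he.pos]⟩
  have h1 := hgeo.randersSpeed_eq (A := fun x : M => (0 : TangentSpace (𝓡 2) x)) (by simp)
    (Bundle.contMDiff_zeroSection ℝ (TangentSpace (𝓡 2))) (by rw [hint]; exact isPreconnected_Ioo)
    (s := r) (s' := 0) (by rwa [hint]) (by rwa [hint])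
  have hmem : ∀ r ∈ Ioo (-(2 * a)) (2 * a), r • u ∈ e.target := fun r hr => by
    rw [he.mem_target_iff, norm_smul, hu, mul_one, Real.norm_eq_abs, abs_lt]
    exact hr
  have h2 : ∀ r ∈ Ioo (-(2 * a)) (2 * a), velocity (fun r : ℝ => e.symm (r • u)) r =
      chartLift e (r • u, u) := fun r hr =>
    velocity_comp_symm he.mem_maximalAtlas (by simpa using (hasDerivAt_id r).smul_const u)
      (hmem r hr)
  have h3 : ∀ X : TangentBundle (𝓡 2) M,
      randersSpeed (fun x : M => (0 : TangentSpace (𝓡 2) x)) 0 X = ‖X.2‖ := fun X => by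
    simp [randersSpeed, randersNorm]
  rw [h3, h3, h2 r hr, h2 0 h0] at h1
  refine h1.trans ?_
  rw [zero_smul]
  exact (he.orthonormal_frame u).trans hu

variable [IsRiemannianManifold (𝓡 2) M]

/-- The distance from the pole has gradient of length at most one. -/
theorem inner_le_norm_mfderiv_symm (he : IsGeodesicPolarChart p q a e) {z : Plane}
    (hz : z ∈ e.target) (hz0 : z ≠ 0) (v : Plane) :
    inner ℝ z v / ‖z‖ ≤ ‖mfderiv (𝓡 2) (𝓡 2) e.symm z v‖ := by
  have hline : ContDiff ℝ ∞ fun t : ℝ => z + t • v := by fun_prop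
  have hmem : ∀ᶠ t in 𝓝 (0 : ℝ), z + t • v ∈ e.target :=
    hline.continuous.continuousAt.eventually (e.open_target.mem_nhds (by simpa using hz))
  have hN : ContinuousAt (fun t : ℝ => ‖(chartLift e (z + t • v, v)).2‖) 0 := by
    have h1 := (contMDiffOn_chartLift he.mem_maximalAtlas).continuousOn.continuousAt
      (x := (z + (0 : ℝ) • v, v)) ((e.open_target.prod isOpen_univ).mem_nhds
        ⟨by simpa using hz, mem_univ _⟩)
    have h2 := ((contMDiff_norm_sq (M := M)).continuous.sqrt.continuousAt).comp h1
    have h3 := ContinuousAt.comp (x := (0 : ℝ)) (f := fun t : ℝ => (z + t • v, v)) h2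
      (by fun_prop)
    refine h3.congr (.of_forall fun t => ?_)
    exact Real.sqrt_sq (norm_nonneg _)
  refine le_of_forall_pos_le_add fun ε hε => ?_
  set K := ‖mfderiv (𝓡 2) (𝓡 2) e.symm z v‖ + ε
  have hK : ‖(chartLift e (z + (0 : ℝ) • v, v)).2‖ < K := by
    rw [zero_smul, add_zero]
    exact lt_add_of_pos_right _ hε
  obtain ⟨δ, hδ, hball⟩ := Metric.eventually_nhds_iff_ball.1
    (hmem.and (hN.eventually (gt_mem_nhds hK)))
  have hd : HasDerivAt (fun t : ℝ => ‖z + t • v‖) (inner ℝ z v / ‖z‖) 0 := by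
    have h1 : HasDerivAt (fun t : ℝ => z + t • v) v 0 := by
      simpa using ((hasDerivAt_id (0 : ℝ)).smul_const v).const_add z
    have h2 := h1.norm_sq.sqrt (by simpa using hz0)
    simp only [zero_smul, add_zero, Real.sqrt_sq (norm_nonneg _)] at h2
    refine h2.congr_deriv ?_
    field_simp
  have hslope := (hasDerivAt_iff_tendsto_slope.1 hd).mono_left
    (nhdsWithin_mono (0 : ℝ) (show Ioi (0 : ℝ) ⊆ {0}ᶜ from fun t ht => (ne_of_gt ht)))
  -- For small `t > 0` the difference `‖z + t v‖ - ‖z‖` is one of distances from `p`. It is at most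
  -- the length of the image of the segment, hence at most `K t`.
  refine le_of_tendsto hslope ?_
  filter_upwards [Ioo_mem_nhdsGT hδ] with t ht
  have hin : ∀ τ ∈ Icc 0 t, τ ∈ Metric.ball (0 : ℝ) δ := fun τ hτ => by
    rw [Real.ball_eq_Ioo]; constructor <;> linarith [hτ.1, hτ.2, ht.2]
  have h1 := dist_le_of_norm_velocity_le (γ := fun t : ℝ => e.symm (z + t • v)) ht.1.le
    (K := K) (fun τ hτ => ?_) ((norm_nonneg _).trans hK.le) (fun τ hτ => ?_)
  · have h2 := dist_triangle p (e.symm (z + (0 : ℝ) • v)) (e.symm (z + t • v))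
    rw [he.dist_symm (hball t (hin t ⟨ht.1.le, le_rfl⟩)).1,
      he.dist_symm (hball 0 (hin 0 ⟨le_rfl, ht.1.le⟩)).1] at h2
    rw [slope_def_field, div_le_iff₀ (by linarith [ht.1])]
    linarith
  · exact (ContMDiffAt.comp τ ((contMDiffOn_symm_of_mem_maximalAtlas he.mem_maximalAtlas).contMDiffAt
      (e.open_target.mem_nhds (hball τ (hin τ hτ)).1)) hline.contDiffAt.contMDiffAt).of_le
      (by norm_cast) |>.contMDiffWithinAt
  · have h3 : HasDerivAt (fun t : ℝ => z + t • v) v τ := by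
      simpa using ((hasDerivAt_id τ).smul_const v).const_add z
    have h4 := hball τ (hin τ ⟨hτ.1.le, hτ.2.le⟩)
    rw [velocity_comp_symm he.mem_maximalAtlas h3 h4.1]
    exact h4.2.le

/-- The Gauss lemma: the radial direction is orthogonal to the circles around the pole. -/
theorem inner_mfderiv_symm_radial (he : IsGeodesicPolarChart p q a e) {u : Plane} (hu : ‖u‖ = 1)
    {r : ℝ} (hr : r ∈ Ioo 0 (2 * a)) (w : Plane) :
    inner ℝ (mfderiv (𝓡 2) (𝓡 2) e.symm (r • u) u) (mfderiv (𝓡 2) (𝓡 2) e.symm (r • u) w) =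
      inner ℝ u w := by
  have hmem : r • u ∈ e.target := by
    rw [he.mem_target_iff, norm_smul, hu, mul_one, Real.norm_of_nonneg hr.1.le]; exact hr.2
  have hne : r • u ≠ 0 := by
    rw [← norm_ne_zero_iff, norm_smul, hu, mul_one]; exact norm_ne_zero_iff.2 hr.1.ne'
  have hle : ∀ v, inner ℝ u v ≤ ‖mfderiv (𝓡 2) (𝓡 2) e.symm (r • u) v‖ := fun v => by
    have := he.inner_le_norm_mfderiv_symm hmem hne v
    rwa [norm_smul, hu, inner_smul_left, Real.norm_of_nonneg hr.1.le, mul_one,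
      RCLike.conj_to_real, mul_div_cancel_left₀ _ hr.1.ne'] at this
  have h1 := he.norm_mfderiv_symm_ray hu (r := r) ⟨by linarith [hr.1, hr.2], hr.2⟩
  set D := mfderiv (𝓡 2) (𝓡 2) e.symm (r • u)
  have hsq : ∀ v, inner ℝ u v ^ 2 ≤ ‖D v‖ ^ 2 := fun v => by
    rw [sq_le_sq, abs_norm]
    refine abs_le.2 ⟨?_, hle v⟩
    have h2 := hle (-v)
    have h3 : ‖D (-v)‖ = ‖D v‖ := (congrArg norm (map_neg D v)).trans (norm_neg _)
    rw [h3, inner_neg_right] at h2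
    linarith
  -- The quadratic form `‖D v‖² - ⟨u, v⟩²` is non-negative and vanishes at `u`. So its polar form
  -- with `u` vanishes, which is the claim; here this is the discriminant inequality along `u + τ
  -- w`.
  have hquad : ∀ τ : ℝ, 0 ≤ (‖D w‖ ^ 2 - inner ℝ u w ^ 2) * (τ * τ) +
      2 * (inner ℝ (D u) (D w) - inner ℝ u w) * τ + 0 := by
    intro τ
    have h2 := hsq (u + τ • w)
    have h3 : D (u + τ • w) = D u + τ • D w :=
      (map_add D u (τ • w)).trans (congrArg _ (map_smul D τ w))
    rw [h3, norm_add_sq_real, h1, inner_add_right, inner_smul_right, inner_smul_right,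
      real_inner_self_eq_norm_sq, hu, norm_smul, mul_pow, Real.norm_eq_abs, sq_abs] at h2
    linarith
  have h2 := discrim_le_zero hquad
  unfold discrim at h2
  nlinarith [sq_nonneg (inner ℝ (D u) (D w) - inner ℝ u w)]

end IsGeodesicPolarChart
end PolarChart

/-! ### Isometries fixing the pole in normal coordinates. -/

section LinearIsometries

variable {M : Type*} [MetricSpace M] [ChartedSpace Plane M] [IsManifold (𝓡 2) ∞ M]
  [RiemannianBundle (fun x : M => TangentSpace (𝓡 2) x)]
  [IsContMDiffRiemannianBundle (𝓡 2) ∞ Plane (fun x : M => TangentSpace (𝓡 2) x)]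
  [IsRiemannianManifold (𝓡 2) M] [CompactSpace M]
  {p q : M} {a : ℝ} {e : OpenPartialHomeomorph M Plane}

namespace IsGeodesicPolarChart

-- The cut point is the unique point at maximal distance from `p`, and distances from `p` are
-- preserved.
omit [IsManifold (𝓡 2) ∞ M]
  [IsContMDiffRiemannianBundle (𝓡 2) ∞ Plane (fun x : M => TangentSpace (𝓡 2) x)]
  [IsRiemannianManifold (𝓡 2) M] in
theorem map_mem_source (he : IsGeodesicPolarChart p q a e) {f : M → M}
    (hf : IsRiemannianIsometry f) (hfp : f p = p) {x : M} (hx : x ∈ e.source) :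
    f x ∈ e.source := by
  rw [he.source_eq]
  intro h
  have h1 := he.dist_lt hx
  have h2 := hf.dist_map p x
  rw [hfp, h] at h2
  linarith

omit [IsManifold (𝓡 2) ∞ M]
  [IsContMDiffRiemannianBundle (𝓡 2) ∞ Plane (fun x : M => TangentSpace (𝓡 2) x)]
  [IsRiemannianManifold (𝓡 2) M] in
theorem map_cut (he : IsGeodesicPolarChart p q a e) {f : M → M}
    (hf : IsRiemannianIsometry f) (hfp : f p = p) : f q = q := by
  by_contra h
  have h1 : f q ∈ e.source := by rw [he.source_eq]; exact h
  have h2 := he.dist_lt h1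
  have h3 := hf.dist_map p q
  rw [hfp] at h3
  linarith

omit [IsManifold (𝓡 2) ∞ M]
  [IsContMDiffRiemannianBundle (𝓡 2) ∞ Plane (fun x : M => TangentSpace (𝓡 2) x)]
  [IsRiemannianManifold (𝓡 2) M] in
theorem norm_chart_map (he : IsGeodesicPolarChart p q a e) {f : M → M}
    (hf : IsRiemannianIsometry f) (hfp : f p = p) {z : Plane} (hz : z ∈ e.target) :
    ‖e (f (e.symm z))‖ = ‖z‖ := by
  rw [← he.dist_eq _ (he.map_mem_source hf hfp (e.map_target hz)), ← he.dist_symm hz]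
  have := hf.dist_map p (e.symm z)
  rwa [hfp] at this

omit [IsManifold (𝓡 2) ∞ M]
  [IsContMDiffRiemannianBundle (𝓡 2) ∞ Plane (fun x : M => TangentSpace (𝓡 2) x)]
  [IsRiemannianManifold (𝓡 2) M] in
theorem differentiableAt_chart_map (he : IsGeodesicPolarChart p q a e) {f : M → M}
    (hf : IsRiemannianIsometry f) (hfp : f p = p) {z : Plane} (hz : z ∈ e.target) :
    DifferentiableAt ℝ (fun z => e (f (e.symm z))) z := by
  have h1 := (contMDiffOn_of_mem_maximalAtlas he.mem_maximalAtlas).contMDiffAt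
    (e.open_source.mem_nhds (he.map_mem_source hf hfp (e.map_target hz)))
  have h2 := (contMDiffOn_symm_of_mem_maximalAtlas he.mem_maximalAtlas).contMDiffAt
    (e.open_target.mem_nhds hz)
  have h3 := ContMDiffAt.comp z h1 ((hf.contMDiff.contMDiffAt (x := e.symm z)).comp z h2)
  exact (h3.mdifferentiableAt (by simp)).differentiableAt

/-- An isometry fixing the pole maps rays to rays. -/
theorem hasDerivAt_chart_map_ray (he : IsGeodesicPolarChart p q a e) {f : M → M}
    (hf : IsRiemannianIsometry f) (hfp : f p = p) {u : Plane} (hu : ‖u‖ = 1) {t : ℝ}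
    (ht : t ∈ Ioo 0 (2 * a)) :
    HasDerivAt (fun t : ℝ => e (f (e.symm (t • u)))) (t⁻¹ • e (f (e.symm (t • u)))) t := by
  have hnorm : ∀ τ ∈ Ioo 0 (2 * a), ‖τ • u‖ = τ := fun τ hτ => by
    rw [norm_smul, hu, mul_one, Real.norm_of_nonneg hτ.1.le]
  have hmem : ∀ τ ∈ Ioo 0 (2 * a), τ • u ∈ e.target := fun τ hτ => by
    rw [he.mem_target_iff, hnorm τ hτ]; exact hτ.2
  have hray : HasDerivAt (fun t : ℝ => t • u) u t := by
    simpa using (hasDerivAt_id t).smul_const u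
  have hy : HasDerivAt (fun t : ℝ => e (f (e.symm (t • u))))
      (fderiv ℝ (fun z => e (f (e.symm z))) (t • u) u) t :=
    HasFDerivAt.comp_hasDerivAt t (f := fun t : ℝ => t • u)
      (he.differentiableAt_chart_map hf hfp (hmem t ht)).hasFDerivAt hray
  set y : ℝ → Plane := fun t => e (f (e.symm (t • u))) with hy_def
  set y' := fderiv ℝ (fun z => e (f (e.symm z))) (t • u) u
  have hyn : ∀ τ ∈ Ioo 0 (2 * a), ‖y τ‖ = τ := fun τ hτ =>
    (he.norm_chart_map hf hfp (hmem τ hτ)).trans (hnorm τ hτ)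
  set u' : Plane := t⁻¹ • y t with hu'_def
  have hu' : ‖u'‖ = 1 := by
    rw [norm_smul, hyn t ht, norm_inv, Real.norm_of_nonneg ht.1.le, inv_mul_cancel₀ ht.1.ne']
  have htu' : t • u' = y t := smul_inv_smul₀ ht.1.ne' _
  -- From `‖y t‖ = t`, the radial component of the velocity is `1`.
  have hrad : inner ℝ u' y' = 1 := by
    have h1 := hy.norm_sq
    have h2 : HasDerivAt (fun t => ‖y t‖ ^ 2) (2 * t) t := by
      refine HasDerivAt.congr_of_eventuallyEq (f := fun t : ℝ => t ^ 2)
        (by simpa using hasDerivAt_pow 2 t) ?_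
      filter_upwards [isOpen_Ioo.mem_nhds ht] with τ hτ
      rw [hyn τ hτ]
    have h3 : inner ℝ (y t) y' = t := by linarith [h1.unique h2]
    rw [inner_smul_left, h3, RCLike.conj_to_real, inv_mul_cancel₀ ht.1.ne']
  have hsrc : ∀ τ ∈ Ioo 0 (2 * a), f (e.symm (τ • u)) ∈ e.source := fun τ hτ =>
    he.map_mem_source hf hfp (e.map_target (hmem τ hτ))
  have hspeed : ‖mfderiv (𝓡 2) (𝓡 2) e.symm (t • u') y'‖ = 1 := by
    have hs : MDifferentiableAt (𝓡 2) (𝓡 2) e.symm (t • u) :=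
      ((contMDiffOn_symm_of_mem_maximalAtlas he.mem_maximalAtlas).contMDiffAt
        (e.open_target.mem_nhds (hmem t ht))).mdifferentiableAt (by simp)
    have hc : MDifferentiableAt 𝓘(ℝ, ℝ) (𝓡 2) (fun t : ℝ => e.symm (t • u)) t :=
      MDifferentiableAt.comp t (f := fun t : ℝ => t • u) hs
        hray.differentiableAt.mdifferentiableAt
    have hfm : MDifferentiableAt (𝓡 2) (𝓡 2) f (e.symm (t • u)) :=
      hf.contMDiff.mdifferentiableAt (by simp)
    have h1 : velocity (fun t : ℝ => f (e.symm (t • u))) t =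
        ⟨f (e.symm (t • u)), mfderiv (𝓡 2) (𝓡 2) f (e.symm (t • u))
          (velocity (fun t : ℝ => e.symm (t • u)) t).2⟩ :=
      tangentBundle_mk_congr rfl (congrArg (fun T : ℝ →L[ℝ] Plane => T 1)
        (mfderiv_comp t (f := fun t : ℝ => e.symm (t • u)) hfm hc))
    have h2 := velocity_eq_chartLift he.mem_maximalAtlas
      (γ := fun t : ℝ => f (e.symm (t • u))) (s := t)
      (ContinuousAt.comp (f := fun t : ℝ => e.symm (t • u)) hfm.continuousAt hc.continuousAt)
      (hsrc t ht) hy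
    have h3 := velocity_comp_symm he.mem_maximalAtlas hray (hmem t ht)
    have h4 : ‖(velocity (fun t : ℝ => e.symm (t • u)) t).2‖ = 1 :=
      (congrArg (fun X : TangentBundle (𝓡 2) M => ‖X.2‖) h3).trans
        (he.norm_mfderiv_symm_ray hu ⟨by linarith [ht.1, ht.2], ht.2⟩)
    have h5 := congrArg (fun X : TangentBundle (𝓡 2) M => ‖X.2‖) (h2.symm.trans h1)
    rw [htu']
    exact h5.trans ((hf.norm_map _ _).trans h4)
  have hgauss := he.inner_mfderiv_symm_radial hu' ht y'
  have hspeed' := he.norm_mfderiv_symm_ray hu' (r := t) ⟨by linarith [ht.1, ht.2], ht.2⟩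
  -- The image curve has unit speed and, by the Gauss lemma, product `1` with the unit radial
  -- vector, so the two vectors coincide.
  have hzero : ‖mfderiv (𝓡 2) (𝓡 2) e.symm (t • u') y' -
      mfderiv (𝓡 2) (𝓡 2) e.symm (t • u') u'‖ ^ 2 = 0 := by
    rw [norm_sub_sq_real, real_inner_comm, hgauss, hrad, hspeed, hspeed']
    norm_num
  have hinj := ((mdifferentiable_of_mem_maximalAtlas he.mem_maximalAtlas).symm.mfderiv_injective
    (x := t • u') (by rw [htu']; exact e.map_source (hsrc t ht)))
    (sub_eq_zero.1 (norm_eq_zero.1 (pow_eq_zero_iff two_ne_zero |>.1 hzero)))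
  rw [hinj] at hy
  exact hy

/-- An isometry fixing the pole is linear in normal coordinates. -/
theorem exists_linear (he : IsGeodesicPolarChart p q a e) {f : M → M}
    (hf : IsRiemannianIsometry f) (hfp : f p = p) :
    ∃ L : Plane →L[ℝ] Plane, (∀ z ∈ e.target, f (e.symm z) = e.symm (L z)) ∧
      ∀ z, ‖L z‖ = ‖z‖ := by
  set Φ : Plane → Plane := fun z => e (f (e.symm z)) with hΦ
  have hp0 : e.symm 0 = p := by rw [← he.map_center, e.left_inv he.center_mem]
  have hΦ0 : Φ 0 = 0 := by simp only [hΦ]; rw [hp0, hfp, he.map_center]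
  have hd := (he.differentiableAt_chart_map hf hfp he.zero_mem).hasFDerivAt
  set L := fderiv ℝ Φ 0
  have hray : ∀ u : Plane, ‖u‖ = 1 → ∀ t ∈ Ioo 0 (2 * a), Φ (t • u) = t • L u := by
    intro u hu t ht
    -- The equation `y' = y / t` makes `y / t` constant; its limit at `0` is the differential there.
    have hconst : ∀ τ ∈ Ioo 0 (2 * a), τ⁻¹ • Φ (τ • u) = t⁻¹ • Φ (t • u) := by
      intro τ hτ
      have hder : ∀ σ ∈ Ioo 0 (2 * a), HasDerivAt (fun σ : ℝ => σ⁻¹ • Φ (σ • u)) 0 σ := by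
        intro σ hσ
        have h1 := (hasDerivAt_inv hσ.1.ne').smul (he.hasDerivAt_chart_map_ray hf hfp hu hσ)
        refine h1.congr_deriv ?_
        rw [smul_smul, ← add_smul]
        have : σ⁻¹ * σ⁻¹ + -(σ ^ 2)⁻¹ = 0 := by rw [sq, mul_inv]; ring
        rw [this, zero_smul]
      exact isOpen_Ioo.is_const_of_deriv_eq_zero isPreconnected_Ioo
        (fun σ hσ => (hder σ hσ).differentiableAt.differentiableWithinAt)
        (fun σ hσ => (hder σ hσ).deriv) hτ ht
    have h1 : HasDerivAt (fun τ : ℝ => Φ (τ • u)) (L u) 0 := by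
      have h2 : HasDerivAt (fun τ : ℝ => τ • u) u 0 := by
        simpa using (hasDerivAt_id (0 : ℝ)).smul_const u
      have h3 : HasFDerivAt Φ L ((0 : ℝ) • u) := by rw [zero_smul]; exact hd
      exact h3.comp_hasDerivAt 0 h2
    have h2 := (hasDerivAt_iff_tendsto_slope.1 h1).mono_left
      (nhdsWithin_mono (0 : ℝ) (show Ioi (0 : ℝ) ⊆ {0}ᶜ from fun t ht => (ne_of_gt ht)))
    have h3 : L u = t⁻¹ • Φ (t • u) := by
      refine tendsto_nhds_unique h2 (tendsto_const_nhds.congr' ?_)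
      filter_upwards [Ioo_mem_nhdsGT (show (0 : ℝ) < 2 * a by linarith [he.pos])] with τ hτ
      rw [slope_def_module, zero_smul, hΦ0, sub_zero, sub_zero, hconst τ hτ]
    rw [h3, smul_inv_smul₀ ht.1.ne']
  have hall : ∀ z ∈ e.target, Φ z = L z := by
    intro z hz
    rcases eq_or_ne z 0 with rfl | hz0
    · rw [hΦ0, map_zero]
    · have hzn : 0 < ‖z‖ := norm_pos_iff.2 hz0
      have h1 := hray (‖z‖⁻¹ • z) (by
        rw [norm_smul, norm_inv, norm_norm, inv_mul_cancel₀ hzn.ne']) ‖z‖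
        ⟨hzn, he.mem_target_iff.1 hz⟩
      rwa [← map_smul, smul_inv_smul₀ hzn.ne'] at h1
  refine ⟨L, fun z hz => ?_, fun z => ?_⟩
  · rw [← hall z hz]
    exact (e.left_inv (he.map_mem_source hf hfp (e.map_target hz))).symm
  · have hpos : 0 < a / (‖z‖ + 1) := div_pos he.pos (by positivity)
    have hmem : (a / (‖z‖ + 1)) • z ∈ e.target := by
      rw [he.mem_target_iff, norm_smul, Real.norm_of_nonneg hpos.le, div_mul_eq_mul_div,
        div_lt_iff₀ (by positivity)]
      nlinarith [he.pos, norm_nonneg z]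
    have h1 := he.norm_chart_map hf hfp hmem
    change ‖Φ _‖ = _ at h1
    rw [hall _ hmem, map_smul, norm_smul, norm_smul] at h1
    exact mul_left_cancel₀ (norm_ne_zero_iff.2 hpos.ne') h1

end IsGeodesicPolarChart

end LinearIsometries

/-! ### Linear isometries of the plane. -/

section PlaneRotations

/-- Reflection of the plane in the first axis. -/
def planeConj (z : Plane) : Plane := !₂[z 0, -z 1]

theorem planeRot_add (α β : ℝ) (z : Plane) :
    planeRot (α + β) z = planeRot α (planeRot β z) := by
  ext i
  fin_cases i <;> simp [planeRot, Real.cos_add, Real.sin_add] <;> ring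

theorem planeConj_planeRot (α : ℝ) (z : Plane) :
    planeConj (planeRot α z) = planeRot (-α) (planeConj z) := by
  ext i
  fin_cases i <;> (simp [planeRot, planeConj]; try ring)

theorem planeConj_planeConj (z : Plane) : planeConj (planeConj z) = z := by
  ext i
  fin_cases i <;> simp [planeConj]

theorem norm_planeConj (z : Plane) : ‖planeConj z‖ = ‖z‖ := by
  rw [EuclideanSpace.norm_eq, EuclideanSpace.norm_eq]
  simp [planeConj, Fin.sum_univ_two]

theorem planeRot_smul (α c : ℝ) (z : Plane) : planeRot α (c • z) = c • planeRot α z := by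
  ext i
  fin_cases i <;> simp [planeRot] <;> ring

theorem contDiff_planeRot : ContDiff ℝ ∞ fun w : ℝ × Plane => planeRot w.1 w.2 := by
  rw [contDiff_euclidean]
  intro i
  fin_cases i
  · simp only [planeRot]
    simp
    fun_prop
  · simp only [planeRot]
    simp
    fun_prop

/-- A linear isometry of the plane is a rotation or a reflection. -/
theorem eq_planeRot_or_eq_planeRot_planeConj {L : Plane →L[ℝ] Plane} (hL : ∀ z, ‖L z‖ = ‖z‖)
    {β : ℝ} (hβ : L (EuclideanSpace.single 0 1) = planeRot β (EuclideanSpace.single 0 1)) :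
    (∀ z, L z = planeRot β z) ∨ ∀ z, L z = planeRot β (planeConj z) := by
  have hsq : ∀ z, L z 0 ^ 2 + L z 1 ^ 2 = z 0 ^ 2 + z 1 ^ 2 := by
    intro z
    have := congrArg (· ^ 2) (hL z)
    simpa [EuclideanSpace.norm_sq_eq, Fin.sum_univ_two] using this
  set b : Plane := L (EuclideanSpace.single 1 1) with hb
  have hlin : ∀ z : Plane, L z = z 0 • planeRot β (EuclideanSpace.single 0 1) + z 1 • b := by
    intro z
    have hz : z = z 0 • EuclideanSpace.single 0 1 + z 1 • EuclideanSpace.single 1 1 := by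
      ext i; fin_cases i <;> simp
    conv_lhs => rw [hz]
    rw [map_add, map_smul, map_smul, hβ]
  have h1 := hsq (EuclideanSpace.single 1 1)
  have h2 := hsq !₂[1, 1]
  rw [← hb] at h1
  rw [hlin] at h2
  simp [planeRot] at h1 h2
  have hcs := Real.sin_sq_add_cos_sq β
  -- The norm of the image of `(1, 1)` makes the images of the basis vectors orthogonal, and the
  -- next line says that the determinant is `±1`; its sign separates the two cases.
  have horth : b 0 * Real.cos β + b 1 * Real.sin β = 0 := by nlinarith
  have ht : (b 1 * Real.cos β - b 0 * Real.sin β) ^ 2 = 1 := by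
    linear_combination h1 + (b 0 ^ 2 + b 1 ^ 2) * hcs -
      (b 0 * Real.cos β + b 1 * Real.sin β) * horth
  have hb0 : b 0 = -(b 1 * Real.cos β - b 0 * Real.sin β) * Real.sin β := by
    linear_combination Real.cos β * horth - b 0 * hcs
  have hb1 : b 1 = (b 1 * Real.cos β - b 0 * Real.sin β) * Real.cos β := by
    linear_combination Real.sin β * horth - b 1 * hcs
  rcases (sq_eq_sq_iff_eq_or_eq_neg (b := (1 : ℝ))).1 (ht.trans (one_pow 2).symm) with h | h
  · left
    intro z
    rw [h] at hb0 hb1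
    rw [hlin]
    ext i
    fin_cases i <;> simp [planeRot, hb0, hb1] <;> ring
  · right
    intro z
    rw [h] at hb0 hb1
    rw [hlin]
    ext i
    fin_cases i <;> simp [planeRot, planeConj, hb0, hb1] <;> ring

end PlaneRotations

/-! ### The rotation flow in the polar chart. -/

theorem windFlow_eq_windFlow_one {M : Type*} [TopologicalSpace M] [ChartedSpace Plane M]
    (e : OpenPartialHomeomorph M Plane) (μ s : ℝ) (x : M) :
    windFlow e μ s x = windFlow e 1 (μ * s) x := by
  unfold windFlow
  rw [one_mul]

theorem windFlow_symm {M : Type*} [TopologicalSpace M] [ChartedSpace Plane M]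
    {e : OpenPartialHomeomorph M Plane} (s : ℝ) {z : Plane}
    (hz : z ∈ e.target) : windFlow e 1 s (e.symm z) = e.symm (planeRot s z) := by
  rw [windFlow, if_pos (e.map_target hz), one_mul, e.right_inv hz]

theorem IsGeodesicPolarChart.planeRot_mem_target
    {M : Type*} [MetricSpace M] [ChartedSpace Plane M]
    [RiemannianBundle (fun x : M => TangentSpace (𝓡 2) x)]
    {p q : M} {a : ℝ} {e : OpenPartialHomeomorph M Plane}
    (he : IsGeodesicPolarChart p q a e) (α : ℝ) {z : Plane}
    (hz : z ∈ e.target) : planeRot α z ∈ e.target := by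
  rw [he.mem_target_iff, norm_planeRot]; exact he.mem_target_iff.1 hz

theorem IsGeodesicPolarChart.windFlow_cut
    {M : Type*} [MetricSpace M] [ChartedSpace Plane M]
    [RiemannianBundle (fun x : M => TangentSpace (𝓡 2) x)]
    {p q : M} {a : ℝ} {e : OpenPartialHomeomorph M Plane}
    (he : IsGeodesicPolarChart p q a e) (s : ℝ) : windFlow e 1 s q = q := by
  rw [windFlow, if_neg]
  rw [he.source_eq]
  exact fun h => h rfl

theorem IsGeodesicPolarChart.windFlow_add
    {M : Type*} [MetricSpace M] [ChartedSpace Plane M]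
    [RiemannianBundle (fun x : M => TangentSpace (𝓡 2) x)]
    {p q : M} {a : ℝ} {e : OpenPartialHomeomorph M Plane}
    (he : IsGeodesicPolarChart p q a e) (s t : ℝ) (x : M) :
    windFlow e 1 (s + t) x = windFlow e 1 s (windFlow e 1 t x) := by
  by_cases hx : x ∈ e.source
  · have hz := e.map_source hx
    rw [← e.left_inv hx, windFlow_symm _ hz, windFlow_symm _ hz,
      windFlow_symm _ (he.planeRot_mem_target t hz), planeRot_add]
  · simp [windFlow, hx]

theorem IsGeodesicPolarChart.contMDiffOn_windFlow
    {M : Type*} [MetricSpace M] [ChartedSpace Plane M]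
    [RiemannianBundle (fun x : M => TangentSpace (𝓡 2) x)]
    {p q : M} {a : ℝ} {e : OpenPartialHomeomorph M Plane}
    (he : IsGeodesicPolarChart p q a e) :
    ContMDiffOn (𝓘(ℝ, ℝ).prod (𝓡 2)) (𝓡 2) ∞ (fun z : ℝ × M => windFlow e 1 z.1 z.2)
      (univ ×ˢ e.source) := by
  have h1 : ContMDiffOn (𝓘(ℝ, ℝ).prod (𝓡 2)) 𝓘(ℝ, ℝ × Plane) ∞
      (fun z : ℝ × M => (z.1, e z.2)) (univ ×ˢ e.source) :=
    contMDiffOn_fst.prodMk_space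
      ((contMDiffOn_of_mem_maximalAtlas he.mem_maximalAtlas).comp contMDiffOn_snd fun z hz => hz.2)
  have h2 := contDiff_planeRot.contMDiff.comp_contMDiffOn h1
  refine ((contMDiffOn_symm_of_mem_maximalAtlas he.mem_maximalAtlas).comp h2 fun z hz =>
    he.planeRot_mem_target _ (e.map_source hz.2)).congr fun z hz => ?_
  simp [windFlow, hz.2]

/-! ### Rotations of a sphere of revolution as a Killing flow. -/

section WindFlow

variable {M : Type*} [MetricSpace M] [ChartedSpace Plane M] [IsManifold (𝓡 2) ∞ M]
  [RiemannianBundle (fun x : M => TangentSpace (𝓡 2) x)]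
  [IsContMDiffRiemannianBundle (𝓡 2) ∞ Plane (fun x : M => TangentSpace (𝓡 2) x)]
  [IsRiemannianManifold (𝓡 2) M]
  {p q : M} {a : ℝ} {e : OpenPartialHomeomorph M Plane}

namespace IsGeodesicPolarChart

/-- On a sphere of revolution every rotation around the pole is an isometry. -/
theorem exists_isometry_planeRot (hM : IsTwoSphereOfRevolution p)
    (he : IsGeodesicPolarChart p q a e) (α : ℝ) :
    ∃ f : M → M, IsRiemannianIsometry f ∧ f p = p ∧
      ∀ z ∈ e.target, f (e.symm z) = e.symm (planeRot α z) := by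
  have := hM.compact
  have hrot : ∀ (β : ℝ) {z : Plane}, z ∈ e.target → planeRot β z ∈ e.target := fun β _ hz =>
    he.planeRot_mem_target β hz
  have hconj : ∀ {z : Plane}, z ∈ e.target → planeConj z ∈ e.target := fun {z} hz => by
    rw [he.mem_target_iff, norm_planeConj]; exact he.mem_target_iff.1 hz
  have key : ∀ β : ℝ, ∃ f : M → M, IsRiemannianIsometry f ∧ f p = p ∧
      ((∀ z ∈ e.target, f (e.symm z) = e.symm (planeRot β z)) ∨
        ∀ z ∈ e.target, f (e.symm z) = e.symm (planeRot β (planeConj z))) := by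
    intro β
    have ha := he.pos
    set b : Plane := EuclideanSpace.single 0 a with hb
    have hbn : ‖b‖ = a := by rw [hb, PiLp.norm_single, Real.norm_of_nonneg ha.le]
    have hbm : b ∈ e.target := by rw [he.mem_target_iff, hbn]; linarith
    obtain ⟨f, hf, hfb, hfp⟩ := hM.exists_isometry (e.symm b) (e.symm (planeRot β b)) (by
      rw [he.dist_symm hbm, he.dist_symm (hrot β hbm), norm_planeRot])
    have hf' := isRiemannianIsometry_of_diffeomorph f hf
    obtain ⟨L, hL, hLn⟩ := he.exists_linear hf' hfp
    have hLm : L b ∈ e.target := by rw [he.mem_target_iff, hLn, hbn]; linarith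
    have h1 : L b = planeRot β b :=
      e.symm.injOn hLm (hrot β hbm) ((hL b hbm).symm.trans hfb)
    have hb1 : b = a • EuclideanSpace.single 0 1 := by
      ext i; fin_cases i <;> simp [hb]
    rw [hb1, map_smul, planeRot_smul] at h1
    refine ⟨f, hf', hfp, ?_⟩
    rcases eq_planeRot_or_eq_planeRot_planeConj hLn (smul_right_injective _ ha.ne' h1) with h | h
    · exact .inl fun z hz => by rw [hL z hz, h]
    · exact .inr fun z hz => by rw [hL z hz, h]
  -- Write `R` for rotations and `C` for the reflection. If `f = R (α/2)`, take `f ∘ f`. If `f = R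
  -- (α/2) C`, take `f g g f` when `g = R (-α/2)`, and `f g` when `g = R (-α/2) C`. All equal `R α`
  -- because `C R (β) = R (-β) C`.
  obtain ⟨f, hf, hfp, h | h⟩ := key (α / 2)
  · refine ⟨f ∘ f, hf.comp hf, by simp [hfp], fun z hz => ?_⟩
    rw [Function.comp_apply, h z hz, h _ (hrot _ hz), ← planeRot_add, add_halves]
  · obtain ⟨g, hg, hgp, h' | h'⟩ := key (-(α / 2))
    · refine ⟨(f ∘ g) ∘ (g ∘ f), (hf.comp hg).comp (hg.comp hf), by simp [hfp, hgp],
        fun z hz => ?_⟩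
      simp only [Function.comp_apply]
      rw [h z hz, h' _ (hrot _ (hconj hz)), h' _ (hrot _ (hrot _ (hconj hz))),
        h _ (hrot _ (hrot _ (hrot _ (hconj hz))))]
      simp only [planeConj_planeRot, planeConj_planeConj, ← planeRot_add]
      congr 2; ring
    · refine ⟨f ∘ g, hf.comp hg, by simp [hfp, hgp], fun z hz => ?_⟩
      rw [Function.comp_apply, h' z hz, h _ (hrot _ (hconj hz)), planeConj_planeRot,
        planeConj_planeConj, ← planeRot_add]
      congr 2; ring

theorem isRiemannianIsometry_windFlow (hM : IsTwoSphereOfRevolution p)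
    (he : IsGeodesicPolarChart p q a e) (s : ℝ) :
    IsRiemannianIsometry (windFlow e 1 s) ∧ windFlow e 1 s p = p := by
  have := hM.compact
  obtain ⟨f, hf, hfp, h⟩ := he.exists_isometry_planeRot hM s
  have h1 : windFlow e 1 s = f := by
    funext x
    by_cases hx : x ∈ e.source
    · rw [← e.left_inv hx, windFlow_symm s (e.map_source hx), h _ (e.map_source hx)]
    · have : x = q := by rw [he.source_eq] at hx; exact not_not.1 hx
      rw [this, he.windFlow_cut, he.map_cut hf hfp]
  rw [h1]
  exact ⟨hf, hfp⟩

/-- Around the cut point the flow is linear in normal coordinates centred there, so that it is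
determined by the motion of two points. -/
theorem contMDiff_windFlow (hM : IsTwoSphereOfRevolution p) (hpq : IsPairOfPoles p q a)
    (he : IsGeodesicPolarChart p q a e) :
    ContMDiff (𝓘(ℝ, ℝ).prod (𝓡 2)) (𝓡 2) ∞ (fun z : ℝ × M => windFlow e 1 z.1 z.2) := by
  have := hM.compact
  obtain ⟨-, e', he'⟩ := hpq
  rintro ⟨s, x⟩
  by_cases hx : x ∈ e.source
  · exact he.contMDiffOn_windFlow.contMDiffAt
      ((isOpen_univ.prod e.open_source).mem_nhds ⟨mem_univ _, hx⟩)
  have hxq : x = q := by rw [he.source_eq] at hx; exact not_not.1 hx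
  have hx' : x ∈ e'.source := by rw [hxq]; exact he'.center_mem
  have ha := he.pos
  have hiso := fun s => he.isRiemannianIsometry_windFlow hM s
  set b : Fin 2 → Plane := fun i => EuclideanSpace.single i a with hb
  have hbn : ∀ i, ‖b i‖ = a := fun i => by
    rw [hb, PiLp.norm_single, Real.norm_of_nonneg ha.le]
  have hbm : ∀ i, b i ∈ e'.target := fun i => by rw [he'.mem_target_iff, hbn]; linarith
  have hbs : ∀ i, e'.symm (b i) ∈ e.source := fun i => by
    rw [he.source_eq]
    intro h
    have h1 := congrArg e' h
    rw [e'.right_inv (hbm i), he'.map_center] at h1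
    have h2 := hbn i
    rw [h1, norm_zero] at h2
    exact ha.ne h2
  -- The orbits of the two base points avoid `q`, so they depend smoothly on time. By linearity in
  -- the coordinates at `q` they determine the flow near `q`.
  set m : Fin 2 → ℝ → Plane := fun i s => e' (windFlow e 1 s (e'.symm (b i))) with hm
  have hmd : ∀ i, ContDiff ℝ ∞ (m i) := fun i => by
    rw [← contMDiff_iff_contDiff]
    have h1 : ContMDiff 𝓘(ℝ, ℝ) (𝓡 2) ∞ fun s => windFlow e 1 s (e'.symm (b i)) :=
      contMDiffOn_univ.1 (he.contMDiffOn_windFlow.comp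
        (contMDiff_id.prodMk contMDiff_const).contMDiffOn fun s _ => ⟨mem_univ _, hbs i⟩)
    exact contMDiffOn_univ.1 ((contMDiffOn_of_mem_maximalAtlas he'.mem_maximalAtlas).comp
      h1.contMDiffOn fun s _ =>
        he'.map_mem_source (hiso s).1 (he.windFlow_cut s) (e'.map_target (hbm i)))
  have hlin : ∀ s, ∀ z ∈ e'.target, windFlow e 1 s (e'.symm z) =
      e'.symm ((z 0 / a) • m 0 s + (z 1 / a) • m 1 s) ∧
      (z 0 / a) • m 0 s + (z 1 / a) • m 1 s ∈ e'.target := by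
    intro s z hz
    obtain ⟨L, hL, hLn⟩ := he'.exists_linear (hiso s).1 (he.windFlow_cut s)
    have hLm : ∀ i, m i s = L (b i) := fun i => by
      simp only [hm]
      rw [hL _ (hbm i), e'.right_inv]
      rw [he'.mem_target_iff, hLn, hbn]
      linarith
    have h1 : (z 0 / a) • b 0 + (z 1 / a) • b 1 = z := by
      ext i; fin_cases i <;> simp [hb, ha.ne']
    rw [hLm, hLm, ← map_smul, ← map_smul, ← map_add, h1]
    exact ⟨hL z hz, he'.mem_target_iff.2 ((hLn z).trans_lt (he'.mem_target_iff.1 hz))⟩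
  have h1 : ContMDiffOn (𝓘(ℝ, ℝ).prod (𝓡 2)) 𝓘(ℝ, ℝ × Plane) ∞
      (fun z : ℝ × M => (z.1, e' z.2)) (univ ×ˢ e'.source) :=
    contMDiffOn_fst.prodMk_space
      ((contMDiffOn_of_mem_maximalAtlas he'.mem_maximalAtlas).comp contMDiffOn_snd
        fun z hz => hz.2)
  have h2 : ContDiff ℝ ∞ fun w : ℝ × Plane => (w.2 0 / a) • m 0 w.1 + (w.2 1 / a) • m 1 w.1 := by
    have h3 : ∀ i, ContDiff ℝ ∞ fun w : ℝ × Plane => w.2 i / a := fun i => by fun_prop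
    exact ((h3 0).smul ((hmd 0).comp contDiff_fst)).add ((h3 1).smul ((hmd 1).comp contDiff_fst))
  have h4 := h2.contMDiff.comp_contMDiffOn h1
  refine (((contMDiffOn_symm_of_mem_maximalAtlas he'.mem_maximalAtlas).comp h4 fun z hz =>
    (hlin z.1 _ (e'.map_source hz.2)).2).congr fun z hz => ?_).contMDiffAt
      ((isOpen_univ.prod e'.open_source).mem_nhds ⟨mem_univ _, hx'⟩)
  have := (hlin z.1 _ (e'.map_source hz.2)).1
  rwa [e'.left_inv hz.2] at this

theorem isKillingFlow_windFlow (hM : IsTwoSphereOfRevolution p) (hpq : IsPairOfPoles p q a)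
    (he : IsGeodesicPolarChart p q a e) : IsKillingFlow (windFlow e 1) (angularField e) where
  contMDiff := he.contMDiff_windFlow hM hpq
  zero := windFlow_zero e 1
  add := he.windFlow_add
  generator s x := by
    rw [(isMIntegralCurve_windFlow he 1 x s).mfderiv]
    exact (one_smul ℝ _).trans (one_smul ℝ _)
  norm_map s x v := (he.isRiemannianIsometry_windFlow hM s).1.norm_map x v

end IsGeodesicPolarChart

end WindFlow

/-! ### Navigation from `h` to `F` and back. -/

theorem mainTheorem4 {M : Type*} [MetricSpace M] [ChartedSpace Plane M] [IsManifold (𝓡 2) ∞ M]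
    [RiemannianBundle (fun x : M => TangentSpace (𝓡 2) x)]
    [IsContMDiffRiemannianBundle (𝓡 2) ∞ Plane (fun x : M => TangentSpace (𝓡 2) x)]
    [IsRiemannianManifold (𝓡 2) M]
    (p q : M) (a : ℝ) (hM : IsTwoSphereOfRevolution p) (hpq : IsPairOfPoles p q a)
    (e : OpenPartialHomeomorph M Plane) (he : IsGeodesicPolarChart p q a e)
    (μ : ℝ) (hμ : ∀ x : M, |μ| * ‖angularField e x‖ < 1)
    (l : ℝ) (hl : 0 < l) (γ : ℝ → M)
    (hγ : IsGeodesicOn riemannianNorm γ (Icc 0 l))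
    (hunit : ∀ s ∈ Icc 0 l, ‖mfderivWithin 𝓘(ℝ, ℝ) (𝓡 2) γ (Icc 0 l) s (1 : ℝ)‖ = 1) :
    IsGeodesicOn (randersNorm (wind e μ)) (fun s => windFlow e μ s (γ s)) (Icc 0 l) ∧
    (IsConjugateAlong (randersNorm (wind e μ)) (fun s => windFlow e μ s (γ s)) l ↔
      IsConjugateAlong riemannianNorm γ l) := by
  have h := he.isKillingFlow_windFlow hM hpq
  set A := angularField e
  set φ := windFlow e 1
  have hwind : wind e μ = fun x => μ • A x := rfl
  have hflow : (fun s => windFlow e μ s (γ s)) = fun s => φ (μ * s) (γ s) :=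
    funext fun s => windFlow_eq_windFlow_one e μ s (γ s)
  have h0 : ∀ x : M, |(0 : ℝ)| * ‖A x‖ < 1 := fun x => by simp
  have hint : interior (Icc 0 l) = Ioo 0 l := interior_Icc
  have hμ0 : ∀ x : M, |0 + μ| * ‖A x‖ < 1 := fun x => by rw [zero_add]; exact hμ x
  -- At interior times the derivative within `[0, l]` is the ordinary one; the argument uses speeds
  -- only there.
  have hspeed : ∀ s ∈ Ioo 0 l, randersSpeed A 0 (velocity γ s) = 1 := fun s hs => by
    have h1 := hunit s (Ioo_subset_Icc_self hs)
    rw [mfderivWithin_of_mem_nhds (Icc_mem_nhds hs.1 hs.2)] at h1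
    have h2 := congrFun (congrFun (riemannianNorm_eq_randersNorm A) (γ s)) (velocity γ s).2
    exact h2.symm.trans h1
  rw [hwind, hflow, riemannianNorm_eq_randersNorm A]
  rw [riemannianNorm_eq_randersNorm A] at hγ
  obtain ⟨hP, hPspeed⟩ := hγ.flow h h0 hμ0 (by rw [hint]; exact isPreconnected_Ioo) one_pos
    (by rw [hint]; exact hspeed)
  simp only [one_mul, zero_add, hint] at hP hPspeed
  refine ⟨hP, fun hc => ?_, fun hc => ?_⟩
  -- Going back, the opposite wind `-μ A` is added to the unit speed `F`-geodesic, which restores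
  -- `h` and `γ`.
  · have h1 := hc.flow h hμ (ν := -μ) (fun x => by rw [add_neg_cancel]; exact h0 x) hl hPspeed
    have h2 : (fun s => φ (-μ * s) (φ (μ * s) (γ s))) = γ := funext fun s => by
      rw [← h.add, neg_mul, neg_add_cancel, h.zero]
    rwa [add_neg_cancel, h2] at h1
  · have h1 := hc.flow h h0 hμ0 hl hspeed
    rwa [zero_add] at h1

end
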